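/- Let $(M,\tau)$ be a tracial von Neumann algebra, that is, a von Neumann algebra with a fixed normal faithful trace state $\tau$. Let $L^2M$ be the completion of $M$ in the norm $\|x\|_2=\tau(x^*x)^{1/2}$, on which $M$ acts by left and by right multiplication; $\hat x$ is the vector given by $x \in M$. Subalgebras are von Neumann subalgebras with the same unit and the restricted trace. For a subalgebra $B\subset M$ let $E_B$ be the $\tau$-preserving conditional expectation onto $B$, $M\ominus B=\{x\in M: E_B(x)=0\}$, $L^2B\subset L^2M$ the closure of $\{\hat b : b \in B\}$, and $\mathcal U(B)$ the unitary group of $B$. An algebra is diffuse if it has no minimal projections. For subalgebras $B,B_0\subset M$, a closed $B$-$B_0$ sub-bimodule $K$ of $L^2M$ is a multiple of the coarse bimodule if there is a normal $*$-representation of $B\overline\otimes B_0^{op}$ on $K$ that sends $b\otimes b_0^{op}$ to $\xi\mapsto b\xi b_0$. $B$ is coarse in $M$ if it is diffuse and the $B$-$B$ bimodule $L^2M\ominus L^2B$ is a multiple of the coarse bimodule. $B,B_0$ is a coarse pair in $M$ if both are diffuse and the $B$-$B_0$ bimodule $L^2M$ is a multiple of the coarse bimodule. $B$ is mixing in $M$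 if it is diffuse and $\lim_u\|E_B(xuy)\|_2=0$ for all $x,y\in M\ominus B$, where the limit is over $u\in\mathcal U(B)$ tending to $0$ in the weak operator topology. $B,B_0$ is a mixing pair in $M$ if $B$ is diffuse and $\lim_u\|E_{B_0}(xuy)\|_2=0$ for all $x,y\in M$, with the same limit over $u\in\mathcal U(B)$. For subalgebras $Q,P\subset M$ let $\mathcal I_M(Q,P)$ be the set of $x\in M$ such that $L^2(QxP)$, the closed linear span of $\{\widehat{qxp}: q\in Q,\, p\in P\}$ in $L^2M$, has finite dimension as a right $P$-module (von Neumann dimension with respect to $\tau|_P$). Let $w\mathcal I_M(B,B_0)$, the set of weak intertwiners, be the union of $\mathcal I_M(A_0,B_0)$ over all diffuse von Neumann subalgebras $A_0\subset B$. $B$ is strongly malnormal in $M$ if it is diffuse and $\mathcal I_M(A_0,B)\subset B$ for every diffuse abelian von Neumann subalgebra $A_0\subset B$. Proposition 2.6.3. (a) Let $B\subset M$ be a diffuse von Neumann subalgebra. If $B$ is coarse in $M$, then $B$ is mixing in $M$. If $B$ is mixing in $M$, then $B$ is strongly malnormal in $M$. (b) Let $B\subset N\subset M$ be von Neumann subalgebras.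 If $B$ is coarse in $N$ and $N$ is coarse in $M$, then $B$ is coarse in $M$. The same holds with "coarse" replaced in all three places by "mixing", or by "strongly malnormal". (c) Let $B,B_0\subset M$ be diffuse von Neumann subalgebras. If $B,B_0$ is a coarse pair in $M$, then it is a mixing pair in $M$. If $B,B_0$ is a mixing pair in $M$, then $w\mathcal I_M(B,B_0)=\{0\}$. -/

import Mathlib

open Filter Topology TensorProduct
open scoped ComplexOrder InnerProductSpace ENNReal

universe u

noncomputable section

namespace VonNeumannAlgebra

variable {H : Type u} [NormedAddCommGroup H] [InnerProductSpace ℂ H] [CompleteSpace H]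

/-- A functional on a von Neumann algebra is normal if it is ultraweakly continuous, that is, of
the form `x ↦ ∑ n, ⟪ξ n, x (η n)⟫` for two square summable sequences of vectors. -/
def IsNormalFunctional (M : VonNeumannAlgebra H) (φ : M.toStarSubalgebra → ℂ) : Prop :=
  ∃ ξ η : ℕ → H, Summable (fun n => ‖ξ n‖ ^ 2) ∧ Summable (fun n => ‖η n‖ ^ 2) ∧
    ∀ x : M.toStarSubalgebra, HasSum (fun n => ⟪ξ n, (x : H →L[ℂ] H) (η n)⟫_ℂ) (φ x)

/-- A `*`-homomorphism from a von Neumann algebra to `B(K)` is normal if it is ultraweakly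
continuous, that is, all its coefficient functionals are normal. -/
def IsNormalRep (M : VonNeumannAlgebra H) {K : Type u} [NormedAddCommGroup K]
    [InnerProductSpace ℂ K] [CompleteSpace K] (π : M.toStarSubalgebra →⋆ₐ[ℂ] (K →L[ℂ] K)) : Prop :=
  ∀ ξ η : K, M.IsNormalFunctional fun x => ⟪ξ, π x η⟫_ℂ

/-- A von Neumann algebra is diffuse if it has no minimal projection: every nonzero projection
dominates a strictly smaller nonzero projection of the algebra. -/
def IsDiffuse (M : VonNeumannAlgebra H) : Prop :=
  ∀ p ∈ M, IsStarProjection p → p ≠ 0 →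
    ∃ q ∈ M, IsStarProjection q ∧ q ≠ 0 ∧ q ≠ p ∧ p * q = q

/-- The algebra is commutative. -/
def IsAbelian (M : VonNeumannAlgebra H) : Prop :=
  ∀ a ∈ M, ∀ b ∈ M, a * b = b * a

/-- The von Neumann algebra generated by a set of operators: the bicommutant of the `*`-closed set
`S ∪ star S`. -/
def generatedBy (S : Set (H →L[ℂ] H)) : VonNeumannAlgebra H where
  toStarSubalgebra := StarSubalgebra.centralizer ℂ (Set.centralizer (S ∪ star S))
  centralizer_centralizer' := by
    have hs : star (Set.centralizer (S ∪ star S)) = Set.centralizer (S ∪ star S) := by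
      rw [Set.star_centralizer, Set.union_star, star_star, Set.union_comm]
    change Set.centralizer (Set.centralizer
      (StarSubalgebra.centralizer ℂ (Set.centralizer (S ∪ star S)) : Set (H →L[ℂ] H))) =
      (StarSubalgebra.centralizer ℂ (Set.centralizer (S ∪ star S)) : Set (H →L[ℂ] H))
    rw [StarSubalgebra.coe_centralizer, hs, Set.union_self, Set.centralizer_centralizer_centralizer]

/-- A normal faithful trace state on a von Neumann algebra. The pair is a tracial von Neumann
algebra. -/
structure TraceState (M : VonNeumannAlgebra H) where
  toFun : M.toStarSubalgebra →ₗ[ℂ] ℂ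
  map_one : toFun 1 = 1
  nonneg : ∀ x : M.toStarSubalgebra, 0 ≤ (x : H →L[ℂ] H) → 0 ≤ toFun x
  faithful : ∀ x : M.toStarSubalgebra, toFun (star x * x) = 0 → x = 0
  tracial : ∀ x y : M.toStarSubalgebra, toFun (x * y) = toFun (y * x)
  normal : M.IsNormalFunctional toFun

namespace TraceState

variable {M : VonNeumannAlgebra H}

/-- The restriction of the trace to a von Neumann subalgebra. -/
def restrict (τ : TraceState M) {N : VonNeumannAlgebra H} (h : N ≤ M) : TraceState N where
  toFun := τ.toFun ∘ₗ
    (StarSubalgebra.inclusion (S₁ := N.toStarSubalgebra) (S₂ := M.toStarSubalgebra) h).toLinearMap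
  map_one := τ.map_one
  nonneg x hx := τ.nonneg _ hx
  faithful x hx := Subtype.ext (congrArg Subtype.val (τ.faithful ⟨x, h x.2⟩ hx) :)
  tracial x y := τ.tracial ⟨x, h x.2⟩ ⟨y, h y.2⟩
  normal := by
    obtain ⟨ξ, η, h1, h2, h3⟩ := τ.normal
    exact ⟨ξ, η, h1, h2, fun x => h3 _⟩

/-! ### The Hilbert space `L²M` with its left and right multiplications -/

set_option linter.unusedVariables false in
/-- The algebra `M`, viewed as a pre-Hilbert space with inner product `⟪x, y⟫ = τ(x* y)`. -/
def PreL2 (τ : TraceState M) : Type u := M.toStarSubalgebra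

instance (τ : TraceState M) : AddCommGroup τ.PreL2 :=
  inferInstanceAs (AddCommGroup M.toStarSubalgebra)

instance (τ : TraceState M) : Module ℂ τ.PreL2 :=
  inferInstanceAs (Module ℂ M.toStarSubalgebra)

/-- The identity map from `M` to the pre-Hilbert space. -/
def toPre (τ : TraceState M) : M.toStarSubalgebra ≃ₗ[ℂ] τ.PreL2 := LinearEquiv.refl ℂ _

theorem nonneg_star_mul_self (τ : TraceState M) (x : M.toStarSubalgebra) :
    0 ≤ τ.toFun (star x * x) :=
  τ.nonneg _ (star_mul_self_nonneg (x : H →L[ℂ] H))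

theorem toFun_mono (τ : TraceState M) {x y : M.toStarSubalgebra}
    (h : (x : H →L[ℂ] H) ≤ y) : τ.toFun x ≤ τ.toFun y := by
  have := τ.nonneg (y - x) (by simpa using h)
  simpa using this

theorem conj_toFun_star_mul (τ : TraceState M) (x y : M.toStarSubalgebra) :
    (starRingEnd ℂ) (τ.toFun (star y * x)) = τ.toFun (star x * y) := by
  have key : ∀ z : M.toStarSubalgebra, (τ.toFun (star z * z)).im = 0 := fun z =>
    ((Complex.le_def.1 (τ.nonneg_star_mul_self z)).2).symm
  have h1 := key (x + y)
  have h2 := key (x + Complex.I • y)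
  have hx := key x
  have hy := key y
  simp only [star_add, star_smul, add_mul, mul_add, map_add, smul_mul_assoc, mul_smul_comm,
    map_smul, smul_eq_mul, Complex.add_im, Complex.mul_im, Complex.mul_re, Complex.I_re,
    Complex.I_im, Complex.star_def, Complex.conj_I, Complex.neg_re, Complex.neg_im] at h1 h2
  apply Complex.ext
  · simp only [Complex.conj_re]
    linarith
  · simp only [Complex.conj_im]
    linarith

/-- The inner product `⟪x, y⟫ = τ(x* y)`. -/
abbrev preCore (τ : TraceState M) : InnerProductSpace.Core ℂ τ.PreL2 where
  inner x y := τ.toFun (star (τ.toPre.symm x) * τ.toPre.symm y)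
  conj_inner_symm x y := τ.conj_toFun_star_mul _ _
  re_inner_nonneg x := (Complex.le_def.1 (τ.nonneg_star_mul_self _)).1
  add_left x y z := by simp [add_mul]
  smul_left x y r := by simp
  definite x hx := τ.faithful _ hx

instance (τ : TraceState M) : NormedAddCommGroup τ.PreL2 :=
  τ.preCore.toNormedAddCommGroup

instance (τ : TraceState M) : InnerProductSpace ℂ τ.PreL2 :=
  InnerProductSpace.ofCore τ.preCore.toCore

theorem inner_pre (τ : TraceState M) (x y : M.toStarSubalgebra) :
    ⟪τ.toPre x, τ.toPre y⟫_ℂ = τ.toFun (star x * y) := rfl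

theorem norm_pre_sq (τ : TraceState M) (x : M.toStarSubalgebra) :
    ((‖τ.toPre x‖ ^ 2 : ℝ) : ℂ) = τ.toFun (star x * x) := by
  rw [← inner_pre, inner_self_eq_norm_sq_to_K]
  simp

theorem norm_pre_mul_left_le (τ : TraceState M) (a x : M.toStarSubalgebra) :
    ‖τ.toPre (a * x)‖ ≤ ‖(a : H →L[ℂ] H)‖ * ‖τ.toPre x‖ := by
  rw [← sq_le_sq₀ (by positivity) (by positivity), mul_pow, ← Complex.real_le_real,
    Complex.ofReal_mul, norm_pre_sq, norm_pre_sq]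
  have h : ((star (a * x) * (a * x) : M.toStarSubalgebra) : H →L[ℂ] H) ≤
      (((‖(a : H →L[ℂ] H)‖ ^ 2 : ℝ) : ℂ) • (star x * x) : M.toStarSubalgebra) := by
    have := CStarAlgebra.star_left_conjugate_le_norm_smul (a := (x : H →L[ℂ] H))
      (b := star (a : H →L[ℂ] H) * a) (hb := IsSelfAdjoint.star_mul_self _)
    rw [CStarRing.norm_star_mul_self, ← sq] at this
    rw [← Complex.coe_smul] at this
    simpa [mul_assoc] using this
  simpa using τ.toFun_mono h

theorem norm_pre_star (τ : TraceState M) (x : M.toStarSubalgebra) :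
    ‖τ.toPre (star x)‖ = ‖τ.toPre x‖ := by
  rw [← sq_eq_sq₀ (by positivity) (by positivity), ← Complex.ofReal_inj, norm_pre_sq,
    norm_pre_sq, star_star, τ.tracial]

theorem norm_pre_mul_right_le (τ : TraceState M) (a x : M.toStarSubalgebra) :
    ‖τ.toPre (x * a)‖ ≤ ‖(a : H →L[ℂ] H)‖ * ‖τ.toPre x‖ := by
  rw [← norm_pre_star, star_mul, ← τ.norm_pre_star x]
  simpa using τ.norm_pre_mul_left_le (star a) (star x)

/-- The Hilbert space `L²M`: the completion of `M` in the norm `‖x‖₂ = τ(x* x) ^ (1 / 2)`. -/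
abbrev L2 (τ : TraceState M) : Type u := UniformSpace.Completion τ.PreL2

/-- The vector `x̂` of `L²M` given by an element `x` of `M`. -/
def hat (τ : TraceState M) (x : M.toStarSubalgebra) : τ.L2 := (τ.toPre x : τ.L2)

/-- Left multiplication by `a ∈ M` on `L²M`. -/
def leftMul (τ : TraceState M) (a : M.toStarSubalgebra) : τ.L2 →L[ℂ] τ.L2 :=
  ((τ.toPre.toLinearMap ∘ₗ LinearMap.mulLeft ℂ a ∘ₗ τ.toPre.symm.toLinearMap).mkContinuous
    ‖(a : H →L[ℂ] H)‖ fun x => τ.norm_pre_mul_left_le a (τ.toPre.symm x)).completion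

/-- Right multiplication by `a ∈ M` on `L²M`, that is, `J a* J` with `J` the canonical
conjugation. -/
def rightMul (τ : TraceState M) (a : M.toStarSubalgebra) : τ.L2 →L[ℂ] τ.L2 :=
  ((τ.toPre.toLinearMap ∘ₗ LinearMap.mulRight ℂ a ∘ₗ τ.toPre.symm.toLinearMap).mkContinuous
    ‖(a : H →L[ℂ] H)‖ fun x => τ.norm_pre_mul_right_le a (τ.toPre.symm x)).completion

theorem inner_hat (τ : TraceState M) (x y : M.toStarSubalgebra) :
    ⟪τ.hat x, τ.hat y⟫_ℂ = τ.toFun (star x * y) := by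
  simp [hat, inner_pre]

theorem leftMul_hat (τ : TraceState M) (a x : M.toStarSubalgebra) :
    τ.leftMul a (τ.hat x) = τ.hat (a * x) := by
  simp only [leftMul, hat, ContinuousLinearMap.completion_apply_coe]
  rfl

theorem rightMul_hat (τ : TraceState M) (a x : M.toStarSubalgebra) :
    τ.rightMul a (τ.hat x) = τ.hat (x * a) := by
  simp only [rightMul, hat, ContinuousLinearMap.completion_apply_coe]
  rfl

/-- The closed linear span in `L²M` of a subset of `M`. -/
def closedSpan (τ : TraceState M) (S : Set M.toStarSubalgebra) : Submodule ℂ τ.L2 :=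
  (Submodule.span ℂ (τ.hat '' S)).topologicalClosure

instance (τ : TraceState M) (S : Set M.toStarSubalgebra) : CompleteSpace (τ.closedSpan S) :=
  inferInstanceAs (CompleteSpace (Submodule.span ℂ (τ.hat '' S)).topologicalClosure)

/-- The subspace `L²B` of `L²M`, for a von Neumann subalgebra `B` of `M`. -/
def L2Sub (τ : TraceState M) (B : VonNeumannAlgebra H) : Submodule ℂ τ.L2 :=
  τ.closedSpan {b | (b : H →L[ℂ] H) ∈ B}

instance (τ : TraceState M) (B : VonNeumannAlgebra H) : CompleteSpace (τ.L2Sub B) :=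
  inferInstanceAs (CompleteSpace (τ.closedSpan _))

theorem hat_mem_L2Sub (τ : TraceState M) (B : VonNeumannAlgebra H) (b : M.toStarSubalgebra)
    (hb : (b : H →L[ℂ] H) ∈ B) : τ.hat b ∈ τ.L2Sub B :=
  Submodule.le_topologicalClosure _ (Submodule.subset_span ⟨b, hb, rfl⟩)

/-- The vector of `L²M` given by `E_B(x)`, where `E_B` is the trace preserving conditional
expectation of `M` onto `B`. It is the orthogonal projection of `x̂` on `L²B`. Its norm is
`‖E_B(x)‖₂`. -/
def condExp (τ : TraceState M) (B : VonNeumannAlgebra H) (x : M.toStarSubalgebra) : τ.L2 :=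
  (τ.L2Sub B).starProjection (τ.hat x)

/-- If `e ∈ B` satisfies `τ(b e) = τ(b x)` for all `b ∈ B`, which characterizes `e = E_B(x)`, then
the vector `condExp` is `ê`. -/
theorem condExp_eq_hat (τ : TraceState M) (B : VonNeumannAlgebra H) (x e : M.toStarSubalgebra)
    (he : (e : H →L[ℂ] H) ∈ B) (h : ∀ b : M.toStarSubalgebra, (b : H →L[ℂ] H) ∈ B →
      τ.toFun (b * e) = τ.toFun (b * x)) : τ.condExp B x = τ.hat e := by
  refine (Submodule.eq_starProjection_of_mem_orthogonal (τ.hat_mem_L2Sub B e he) ?_)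
  have : (τ.L2Sub B)ᗮ = (Submodule.span ℂ (τ.hat '' {b | (b : H →L[ℂ] H) ∈ B}))ᗮ :=
    Submodule.orthogonal_closure _
  rw [this, Submodule.mem_orthogonal]
  intro v hv
  induction hv using Submodule.span_induction with
  | mem v hv =>
    obtain ⟨b, hb, rfl⟩ := hv
    rw [inner_sub_right, inner_hat, inner_hat, h (star b) (star_mem hb), sub_self]
  | zero => simp
  | add v w _ _ h1 h2 => rw [inner_add_left, h1, h2, add_zero]
  | smul c v _ h1 => rw [inner_smul_left, h1, mul_zero]

/-! ### Coarseness -/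

/-- The Hilbert tensor product `L²M ⊗̄ L²M`. -/
abbrev L2Tensor (τ : TraceState M) : Type u := UniformSpace.Completion (τ.L2 ⊗[ℂ] τ.L2)

/-- The operator `S ⊗ T` on `L²M ⊗̄ L²M`. -/
def tensorOp (τ : TraceState M) (S T : τ.L2 →L[ℂ] τ.L2) : τ.L2Tensor →L[ℂ] τ.L2Tensor :=
  (TensorProduct.mapL S T).completion

/-- The generators `b ⊗ b₀ᵒᵖ` of `B ⊗̄ B₀ᵒᵖ`. Here `B` acts on `L²M` by left multiplication, and
`B₀ᵒᵖ = J B₀ J` acts on `L²M` by right multiplication. -/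
def tensorGen (τ : TraceState M) (b b₀ : M.toStarSubalgebra) : τ.L2Tensor →L[ℂ] τ.L2Tensor :=
  τ.tensorOp (τ.leftMul b) (τ.rightMul b₀)

/-- The von Neumann algebra tensor product `B ⊗̄ B₀ᵒᵖ`, acting on `L²M ⊗̄ L²M`. -/
def tensorOpposite (τ : TraceState M) (B B₀ : VonNeumannAlgebra H) :
    VonNeumannAlgebra τ.L2Tensor :=
  generatedBy {T | ∃ b b₀ : M.toStarSubalgebra, (b : H →L[ℂ] H) ∈ B ∧ (b₀ : H →L[ℂ] H) ∈ B₀ ∧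
    T = τ.tensorGen b b₀}

theorem tensorGen_mem (τ : TraceState M) (B B₀ : VonNeumannAlgebra H) (b b₀ : M.toStarSubalgebra)
    (hb : (b : H →L[ℂ] H) ∈ B) (hb₀ : (b₀ : H →L[ℂ] H) ∈ B₀) :
    τ.tensorGen b b₀ ∈ (τ.tensorOpposite B B₀).toStarSubalgebra := by
  refine StarSubalgebra.mem_centralizer_iff ℂ |>.2 fun c hc => ?_
  have hT : τ.tensorGen b b₀ ∈ {T | ∃ b b₀ : M.toStarSubalgebra, (b : H →L[ℂ] H) ∈ B ∧
      (b₀ : H →L[ℂ] H) ∈ B₀ ∧ T = τ.tensorGen b b₀} := ⟨b, b₀, hb, hb₀, rfl⟩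
  refine ⟨(hc _ (Or.inl hT)).symm, ?_⟩
  have := congrArg star (hc (star (τ.tensorGen b b₀)) (Or.inr (by simpa using hT)))
  simpa using this

/-- A closed subspace `K` of `L²M`, as a Hilbert `B`-`B₀` bimodule, is a multiple of the coarse
bimodule: there is a normal representation of `B ⊗̄ B₀ᵒᵖ` on `K` that sends `b ⊗ b₀ᵒᵖ` to
`ξ ↦ b ξ b₀`. -/
def IsCoarseBimodule (τ : TraceState M) (B B₀ : VonNeumannAlgebra H) (K : Submodule ℂ τ.L2)
    [CompleteSpace K] : Prop :=
  ∃ π : (τ.tensorOpposite B B₀).toStarSubalgebra →⋆ₐ[ℂ] (K →L[ℂ] K),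
    (τ.tensorOpposite B B₀).IsNormalRep π ∧
    ∀ (b b₀ : M.toStarSubalgebra) (hb : (b : H →L[ℂ] H) ∈ B) (hb₀ : (b₀ : H →L[ℂ] H) ∈ B₀)
      (ξ : K), (π ⟨τ.tensorGen b b₀, τ.tensorGen_mem B B₀ b b₀ hb hb₀⟩ ξ : τ.L2) =
        τ.leftMul b (τ.rightMul b₀ ξ)

/-- `B` is a coarse subalgebra of `M`: it is diffuse, and `L²M ⊖ L²B` is a multiple of the coarse
`B`-bimodule. -/
def IsCoarse (τ : TraceState M) (B : VonNeumannAlgebra H) : Prop :=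
  B.IsDiffuse ∧ τ.IsCoarseBimodule B B (τ.L2Sub B)ᗮ

instance (τ : TraceState M) : CompleteSpace (⊤ : Submodule ℂ τ.L2) :=
  (isClosed_univ : IsClosed (Set.univ : Set τ.L2)).isComplete.completeSpace_coe

/-- `B, B₀` is a coarse pair in `M`: both are diffuse, and `L²M` is a multiple of the coarse
`B`-`B₀` bimodule. -/
def IsCoarsePair (τ : TraceState M) (B B₀ : VonNeumannAlgebra H) : Prop :=
  B.IsDiffuse ∧ B₀.IsDiffuse ∧ τ.IsCoarseBimodule B B₀ (⊤ : Submodule ℂ τ.L2)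

/-! ### Mixing -/

/-- The filter on `M` of the unitaries `u ∈ B` that tend to `0` in the weak operator topology. -/
def weaklyNullUnitaries (M B : VonNeumannAlgebra H) : Filter M.toStarSubalgebra :=
  comap (fun x => ContinuousLinearMap.WOTofCLM (x : H →L[ℂ] H)) (𝓝 0) ⊓
    𝓟 {u | (u : H →L[ℂ] H) ∈ B ∧ (u : H →L[ℂ] H) ∈ unitary (H →L[ℂ] H)}

/-- `B` is mixing in `M`: it is diffuse and `‖E_B(x u y)‖₂ → 0` for all `x, y ∈ M ⊖ B`, as the
unitary `u ∈ B` tends weakly to `0`. -/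
def IsMixing (τ : TraceState M) (B : VonNeumannAlgebra H) : Prop :=
  B.IsDiffuse ∧ ∀ x y : M.toStarSubalgebra, τ.condExp B x = 0 → τ.condExp B y = 0 →
    Tendsto (fun u => ‖τ.condExp B (x * u * y)‖) (weaklyNullUnitaries M B) (𝓝 0)

/-- `B, B₀` is a mixing pair in `M`: `B` is diffuse and `‖E_{B₀}(x u y)‖₂ → 0` for all
`x, y ∈ M`, as the unitary `u ∈ B` tends weakly to `0`. -/
def IsMixingPair (τ : TraceState M) (B B₀ : VonNeumannAlgebra H) : Prop :=
  B.IsDiffuse ∧ ∀ x y : M.toStarSubalgebra,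
    Tendsto (fun u => ‖τ.condExp B₀ (x * u * y)‖) (weaklyNullUnitaries M B) (𝓝 0)

/-! ### Intertwiners and strong malnormality -/

/-- The right action of `P` on `K` is intertwined by `V` with that on `ℓ²(ι) ⊗̄ L²P`. -/
def IsRightLinear (τ : TraceState M) (P : VonNeumannAlgebra H) (K : Submodule ℂ τ.L2) {ι : Type u}
    (V : K →ₗᵢ[ℂ] lp (fun _ : ι => τ.L2Sub P) 2) : Prop :=
  ∀ (p : M.toStarSubalgebra), (p : H →L[ℂ] H) ∈ P → ∀ ξ η : K, (η : τ.L2) = τ.rightMul p ξ →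
    ∀ i, (V η i : τ.L2) = τ.rightMul p (V ξ i)

/-- The dimension over `P`, relative to the trace, of a closed right `P`-submodule `K` of `L²M`:
it is `(Tr ⊗ τ)(V V*) = ∑ i, ‖V* (δ_i ⊗ 1̂)‖²` for any right `P`-linear isometry `V` of `K` into
`ℓ²(ι) ⊗̄ L²P`. The value does not depend on `V`, so the infimum selects it. -/
def rightDim (τ : TraceState M) (P : VonNeumannAlgebra H) (K : Submodule ℂ τ.L2)
    [CompleteSpace K] : ℝ≥0∞ :=
  open scoped Classical in
  sInf {d | ∃ (ι : Type u) (V : K →ₗᵢ[ℂ] lp (fun _ : ι => τ.L2Sub P) 2),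
    τ.IsRightLinear P K V ∧
    d = ∑' i, ‖ContinuousLinearMap.adjoint V.toContinuousLinearMap
      (lp.single 2 i ⟨τ.hat 1, τ.hat_mem_L2Sub P 1 (one_mem P)⟩)‖ₑ ^ 2}

/-- The intertwining space `I_M(Q, P)`: the set of `x ∈ M` such that `L²(Q x P)`, the closed span
of `Q x P` in `L²M`, has finite dimension as a right `P`-module. -/
def intertwiners (τ : TraceState M) (Q P : VonNeumannAlgebra H) : Set M.toStarSubalgebra :=
  {x | τ.rightDim P (τ.closedSpan {y | ∃ q p : M.toStarSubalgebra, (q : H →L[ℂ] H) ∈ Q ∧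
    (p : H →L[ℂ] H) ∈ P ∧ y = q * x * p}) < ⊤}

/-- The space of weak intertwiners from `B` to `B₀`: the set of intertwiners from some diffuse von
Neumann subalgebra of `B` to `B₀`. -/
def weakIntertwiners (τ : TraceState M) (B B₀ : VonNeumannAlgebra H) : Set M.toStarSubalgebra :=
  {x | ∃ A₀ : VonNeumannAlgebra H, A₀ ≤ B ∧ A₀.IsDiffuse ∧ x ∈ τ.intertwiners A₀ B₀}

/-- `B` is strongly malnormal in `M`: it is diffuse, and all intertwiners from a diffuse abelian
von Neumann subalgebra of `B` to `B` lie in `B`. -/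
def IsStronglyMalnormal (τ : TraceState M) (B : VonNeumannAlgebra H) : Prop :=
  B.IsDiffuse ∧ ∀ x : M.toStarSubalgebra,
    (∃ A₀ : VonNeumannAlgebra H, A₀ ≤ B ∧ A₀.IsDiffuse ∧ A₀.IsAbelian ∧ x ∈ τ.intertwiners A₀ B) →
    (x : H →L[ℂ] H) ∈ B

end TraceState

end VonNeumannAlgebra

end

noncomputable section

namespace VonNeumannAlgebra

variable {H : Type u} [NormedAddCommGroup H] [InnerProductSpace ℂ H] [CompleteSpace H]

namespace TraceState

variable {M : VonNeumannAlgebra H} (τ : M.TraceState)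

/-! ### The vectors `x̂` and the multiplication operators -/

/-! All computations take place in L²M, where E_B is an orthogonal projection. That E_B(x) is again
an operator is `exists_condExp_eq_hat`; it rests on `exists_eq_hat_of_bounded`, a Hahn–Banach
argument showing that the bounded vectors of L²P come from P.

Coarse implies mixing, for subalgebras and for pairs. With e = E_{B₀}(xuy), the trace property gives
‖e‖₂² = τ(x u y e*), which is the coefficient of u ⊗ (e*)ᵒᵖ between the vectors of x* and y. On a
multiple of the coarse bimodule this coefficient is normal, hence a sum of coefficients of L_u ⊗
R_{e*} on L²M ⊗̄ L²M. As L_u tends weakly to 0 and R_{e*} stays bounded, the sum tends to 0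
(`tendsto_norm_condExp_of_isCoarseBimodule`).

Mixing excludes intertwiners. If L²(AxP) has finite dimension over P, it has coordinates R_i, right
P-linear with values in L²P, such that ∑ ‖R_i* 1̂‖² is finite. For a unitary u of A, ⟪x, y⟫ = ⟪ux,
uy⟫ = ∑ ⟪R_i(ux), R_i(uy)⟫. The norm of R_i(uy) is at most ‖E_P(z* u y)‖₂ up to a small error, where
z approximates R_i* 1̂. So if E_P(zuy) tends to 0 for every z, dominated convergence gives ⟪x, y⟫ =
0 (`inner_eq_zero_of_mem_intertwiners`). The choice y = x settles the case of pairs, and y = x -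
E_B(x) that of subalgebras. The limit is not vacuous because a diffuse algebra contains weakly null
unitaries (`weaklyNullUnitaries_neBot`).

Transitivity. For coarseness, L²M ⊖ L²B is the sum of L²M ⊖ L²N and L²N ⊖ L²B, and the two
representations are added. For mixing, x and y are split along N and M ⊖ N. For strong malnormality,
let x be an intertwiner from A to B in M. Finite dimension of L²(AxB) over B passes to L²(AxN) over
N (`intertwiners_mono_right`): run Gram–Schmidt on the family qx, q ∈ A, once over B and once over
N; each step over N contributes no more to the dimension than the same step over B. Hence x ∈ N, and
the coordinates of L²(AxB) restrict to L²N, so x ∈ B. -/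

theorem hat_add (x y : M.toStarSubalgebra) : τ.hat (x + y) = τ.hat x + τ.hat y :=
  UniformSpace.Completion.coe_add _ _

theorem hat_smul (c : ℂ) (x : M.toStarSubalgebra) : τ.hat (c • x) = c • τ.hat x := by
  rw [hat, map_smul]
  exact UniformSpace.Completion.coe_smul c (τ.toPre x)

theorem hat_sub (x y : M.toStarSubalgebra) : τ.hat (x - y) = τ.hat x - τ.hat y :=
  UniformSpace.Completion.coe_sub _ _

theorem hat_zero : τ.hat 0 = 0 := UniformSpace.Completion.coe_zero

/-- The map `x ↦ x̂` as a linear map. -/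
def hatLinear : M.toStarSubalgebra →ₗ[ℂ] τ.L2 where
  toFun := τ.hat
  map_add' := τ.hat_add
  map_smul' := τ.hat_smul

theorem hat_injective : Function.Injective τ.hat :=
  (UniformSpace.Completion.coe_injective _).comp τ.toPre.injective

theorem denseRange_hat : DenseRange τ.hat :=
  (UniformSpace.Completion.denseRange_coe (α := τ.PreL2)).comp τ.toPre.surjective.denseRange
    (UniformSpace.Completion.continuous_coe _)

theorem norm_hat (x : M.toStarSubalgebra) : ‖τ.hat x‖ = ‖τ.toPre x‖ :=
  UniformSpace.Completion.norm_coe _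

theorem norm_hat_sq (x : M.toStarSubalgebra) :
    ((‖τ.hat x‖ ^ 2 : ℝ) : ℂ) = τ.toFun (star x * x) := by
  rw [norm_hat, norm_pre_sq]

theorem norm_hat_star (x : M.toStarSubalgebra) : ‖τ.hat (star x)‖ = ‖τ.hat x‖ := by
  rw [norm_hat, norm_hat, norm_pre_star]

theorem norm_hat_mul_le (a x : M.toStarSubalgebra) :
    ‖τ.hat (a * x)‖ ≤ ‖(a : H →L[ℂ] H)‖ * ‖τ.hat x‖ := by
  rw [norm_hat, norm_hat]
  exact τ.norm_pre_mul_left_le a x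

theorem norm_hat_mul_le' (a x : M.toStarSubalgebra) :
    ‖τ.hat (x * a)‖ ≤ ‖(a : H →L[ℂ] H)‖ * ‖τ.hat x‖ := by
  rw [norm_hat, norm_hat]
  exact τ.norm_pre_mul_right_le a x

theorem norm_hat_one : ‖τ.hat 1‖ = 1 := by
  have h := τ.norm_hat_sq 1
  rw [star_one, one_mul, τ.map_one] at h
  have h2 : ‖τ.hat 1‖ ^ 2 = 1 := by exact_mod_cast h
  exact (pow_eq_one_iff_of_nonneg (norm_nonneg _) two_ne_zero).1 h2

theorem norm_hat_le (x : M.toStarSubalgebra) : ‖τ.hat x‖ ≤ ‖(x : H →L[ℂ] H)‖ := by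
  simpa [norm_hat_one] using τ.norm_hat_mul_le x 1

variable {τ} in
/-- Continuous maps on `L²M` that agree on the vectors `x̂` are equal. -/
theorem eq_of_forall_hat {X : Type*} [TopologicalSpace X] [T2Space X] {f g : τ.L2 → X}
    (hf : Continuous f) (hg : Continuous g) (h : ∀ x, f (τ.hat x) = g (τ.hat x)) (ξ : τ.L2) :
    f ξ = g ξ :=
  congrFun (τ.denseRange_hat.equalizer hf hg (funext h)) ξ

variable {τ} in
theorem clm_ext {E : Type*} [NormedAddCommGroup E] [NormedSpace ℂ E] {S T : τ.L2 →L[ℂ] E}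
    (h : ∀ x, S (τ.hat x) = T (τ.hat x)) : S = T :=
  ContinuousLinearMap.ext (eq_of_forall_hat S.continuous T.continuous h)

theorem leftMul_rightMul_comm (a b : M.toStarSubalgebra) :
    τ.leftMul a * τ.rightMul b = τ.rightMul b * τ.leftMul a :=
  clm_ext fun x => by simp [rightMul_hat, leftMul_hat, mul_assoc]

theorem leftMul_rightMul (a b : M.toStarSubalgebra) (ξ : τ.L2) :
    τ.leftMul a (τ.rightMul b ξ) = τ.rightMul b (τ.leftMul a ξ) :=
  congrArg (· ξ) (τ.leftMul_rightMul_comm a b)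

theorem norm_leftMul_apply_le (a : M.toStarSubalgebra) (ξ : τ.L2) :
    ‖τ.leftMul a ξ‖ ≤ ‖(a : H →L[ℂ] H)‖ * ‖ξ‖ := by
  induction ξ using UniformSpace.Completion.induction_on with
  | hp => exact isClosed_le (by fun_prop) (by fun_prop)
  | ih x => exact (congrArg _ (τ.leftMul_hat a x)).trans_le (τ.norm_hat_mul_le a x)

theorem norm_rightMul_apply_le (a : M.toStarSubalgebra) (ξ : τ.L2) :
    ‖τ.rightMul a ξ‖ ≤ ‖(a : H →L[ℂ] H)‖ * ‖ξ‖ := by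
  induction ξ using UniformSpace.Completion.induction_on with
  | hp => exact isClosed_le (by fun_prop) (by fun_prop)
  | ih x => exact (congrArg _ (τ.rightMul_hat a x)).trans_le (τ.norm_hat_mul_le' a x)

theorem norm_leftMul_le (a : M.toStarSubalgebra) : ‖τ.leftMul a‖ ≤ ‖(a : H →L[ℂ] H)‖ :=
  ContinuousLinearMap.opNorm_le_bound _ (norm_nonneg _) (τ.norm_leftMul_apply_le a)

theorem norm_rightMul_le (a : M.toStarSubalgebra) : ‖τ.rightMul a‖ ≤ ‖(a : H →L[ℂ] H)‖ :=
  ContinuousLinearMap.opNorm_le_bound _ (norm_nonneg _) (τ.norm_rightMul_apply_le a)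

theorem inner_leftMul (a : M.toStarSubalgebra) (ξ η : τ.L2) :
    ⟪ξ, τ.leftMul a η⟫_ℂ = ⟪τ.leftMul (star a) ξ, η⟫_ℂ := by
  revert η
  refine eq_of_forall_hat (by fun_prop) (by fun_prop) fun y => ?_
  revert ξ
  refine eq_of_forall_hat (by fun_prop) (by fun_prop) fun x => ?_
  simp [leftMul_hat, inner_hat, mul_assoc]

theorem inner_rightMul (a : M.toStarSubalgebra) (ξ η : τ.L2) :
    ⟪ξ, τ.rightMul a η⟫_ℂ = ⟪τ.rightMul (star a) ξ, η⟫_ℂ := by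
  revert η
  refine eq_of_forall_hat (by fun_prop) (by fun_prop) fun y => ?_
  revert ξ
  refine eq_of_forall_hat (by fun_prop) (by fun_prop) fun x => ?_
  rw [rightMul_hat, rightMul_hat, inner_hat, inner_hat, star_mul, star_star, ← mul_assoc,
    τ.tracial, mul_assoc]

theorem star_rightMul (a : M.toStarSubalgebra) : star (τ.rightMul a) = τ.rightMul (star a) := by
  rw [ContinuousLinearMap.star_eq_adjoint, eq_comm, ContinuousLinearMap.eq_adjoint_iff]
  intro x y
  rw [inner_rightMul]

/-! ### Closed spans and the conditional expectation vector -/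

variable {τ}

theorem hat_mem_closedSpan {S : Set M.toStarSubalgebra} {x : M.toStarSubalgebra} (hx : x ∈ S) :
    τ.hat x ∈ τ.closedSpan S :=
  Submodule.le_topologicalClosure _ (Submodule.subset_span ⟨x, hx, rfl⟩)

theorem isClosed_closedSpan (S : Set M.toStarSubalgebra) :
    IsClosed (τ.closedSpan S : Set τ.L2) :=
  Submodule.isClosed_topologicalClosure _

theorem closedSpan_le {S : Set M.toStarSubalgebra} {K : Submodule ℂ τ.L2}
    (hK : IsClosed (K : Set τ.L2)) (h : ∀ x ∈ S, τ.hat x ∈ K) : τ.closedSpan S ≤ K :=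
  Submodule.topologicalClosure_minimal _
    (Submodule.span_le.2 (by rintro _ ⟨x, hx, rfl⟩; exact h x hx)) hK

theorem map_mem_of_mem_closedSpan {S : Set M.toStarSubalgebra} {E : Type*} [NormedAddCommGroup E]
    [NormedSpace ℂ E] {K : Submodule ℂ E} (hK : IsClosed (K : Set E)) (T : τ.L2 →L[ℂ] E)
    (h : ∀ x ∈ S, T (τ.hat x) ∈ K) {ξ : τ.L2} (hξ : ξ ∈ τ.closedSpan S) : T ξ ∈ K :=
  closedSpan_le (K := K.comap T.toLinearMap) (hK.preimage T.continuous) h hξ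

/-- An element of a closed span whose inner products with the generators vanish is zero. -/
theorem eq_zero_of_mem_closedSpan {S : Set M.toStarSubalgebra} {ξ : τ.L2}
    (hξ : ξ ∈ τ.closedSpan S) (h : ∀ x ∈ S, ⟪τ.hat x, ξ⟫_ℂ = 0) : ξ = 0 := by
  have h1 : τ.closedSpan S ≤ (ℂ ∙ ξ)ᗮ := closedSpan_le (Submodule.isClosed_orthogonal _)
    fun x hx => (Submodule.mem_orthogonal_singleton_iff_inner_left).2 (h x hx)
  exact inner_self_eq_zero.1 ((Submodule.mem_orthogonal_singleton_iff_inner_left).1 (h1 hξ))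

theorem mem_orthogonal_closedSpan {S : Set M.toStarSubalgebra} {ξ : τ.L2}
    (h : ∀ x ∈ S, ⟪τ.hat x, ξ⟫_ℂ = 0) : ξ ∈ (τ.closedSpan S)ᗮ := by
  rw [Submodule.mem_orthogonal']
  have h1 : τ.closedSpan S ≤ (ℂ ∙ ξ)ᗮ := closedSpan_le (Submodule.isClosed_orthogonal _)
    fun x hx => (Submodule.mem_orthogonal_singleton_iff_inner_left).2 (h x hx)
  exact fun u hu => (Submodule.mem_orthogonal_singleton_iff_inner_right).1 (h1 hu)

theorem isClosed_L2Sub (B : VonNeumannAlgebra H) : IsClosed (τ.L2Sub B : Set τ.L2) :=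
  isClosed_closedSpan _

theorem L2Sub_mono {B N : VonNeumannAlgebra H} (h : B ≤ N) : τ.L2Sub B ≤ τ.L2Sub N :=
  closedSpan_le (isClosed_L2Sub N) fun _ hx => τ.hat_mem_L2Sub _ _ (h hx)

theorem rightMul_mem_L2Sub {B : VonNeumannAlgebra H} {b : M.toStarSubalgebra}
    (hb : (b : H →L[ℂ] H) ∈ B) {ξ : τ.L2} (hξ : ξ ∈ τ.L2Sub B) : τ.rightMul b ξ ∈ τ.L2Sub B :=
  map_mem_of_mem_closedSpan (isClosed_L2Sub B) _ (fun x hx => by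
    rw [rightMul_hat]; exact τ.hat_mem_L2Sub _ _ (mul_mem hx hb)) hξ

theorem condExp_mem (B : VonNeumannAlgebra H) (x : M.toStarSubalgebra) :
    τ.condExp B x ∈ τ.L2Sub B := Submodule.starProjection_apply_mem _ _

theorem inner_condExp {B : VonNeumannAlgebra H} (x : M.toStarSubalgebra) {ξ : τ.L2}
    (hξ : ξ ∈ τ.L2Sub B) : ⟪ξ, τ.condExp B x⟫_ℂ = ⟪ξ, τ.hat x⟫_ℂ := by
  rw [condExp, ← Submodule.inner_starProjection_left_eq_right,
    Submodule.starProjection_eq_self_iff.2 hξ]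

/-- Trades the projection for a trace identity, from which the stability of M ⊖ B under adjoints and
under multiplication by B can be read off. -/
theorem condExp_eq_zero_iff {B : VonNeumannAlgebra H} (x : M.toStarSubalgebra) :
    τ.condExp B x = 0 ↔ ∀ b : M.toStarSubalgebra, (b : H →L[ℂ] H) ∈ B → τ.toFun (b * x) = 0 := by
  constructor
  · intro h b hb
    have := inner_condExp x (τ.hat_mem_L2Sub B (star b) (star_mem hb))
    rwa [h, inner_zero_right, inner_hat, star_star, eq_comm] at this
  · intro h
    refine eq_zero_of_mem_closedSpan (condExp_mem B x) fun b hb => ?_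
    rw [inner_condExp x (τ.hat_mem_L2Sub B b hb), inner_hat, h _ (star_mem hb)]

theorem condExp_add (B : VonNeumannAlgebra H) (x y : M.toStarSubalgebra) :
    τ.condExp B (x + y) = τ.condExp B x + τ.condExp B y := by
  simp [condExp, hat_add]

theorem condExp_sub (B : VonNeumannAlgebra H) (x y : M.toStarSubalgebra) :
    τ.condExp B (x - y) = τ.condExp B x - τ.condExp B y := by
  simp [condExp, hat_sub]

theorem condExp_of_mem {B : VonNeumannAlgebra H} {x : M.toStarSubalgebra}
    (hx : (x : H →L[ℂ] H) ∈ B) : τ.condExp B x = τ.hat x :=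
  Submodule.starProjection_eq_self_iff.2 (τ.hat_mem_L2Sub B x hx)

theorem condExp_star_eq_zero {B : VonNeumannAlgebra H} {x : M.toStarSubalgebra}
    (h : τ.condExp B x = 0) : τ.condExp B (star x) = 0 := by
  rw [condExp_eq_zero_iff] at h ⊢
  intro b hb
  have := τ.conj_toFun_star_mul x b
  rw [h _ (star_mem hb), map_zero] at this
  rw [τ.tracial, ← this]

theorem condExp_mul_left_eq_zero {B : VonNeumannAlgebra H} {x b : M.toStarSubalgebra}
    (h : τ.condExp B x = 0) (hb : (b : H →L[ℂ] H) ∈ B) : τ.condExp B (b * x) = 0 := by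
  rw [condExp_eq_zero_iff] at h ⊢
  intro c hc
  rw [← mul_assoc]
  exact h _ (mul_mem hc hb)

theorem condExp_mul_right_eq_zero {B : VonNeumannAlgebra H} {x b : M.toStarSubalgebra}
    (h : τ.condExp B x = 0) (hb : (b : H →L[ℂ] H) ∈ B) : τ.condExp B (x * b) = 0 := by
  rw [condExp_eq_zero_iff] at h ⊢
  intro c hc
  rw [← mul_assoc, τ.tracial, ← mul_assoc]
  exact h _ (mul_mem hb hc)

end TraceState

end VonNeumannAlgebra

end

noncomputable section

namespace VonNeumannAlgebra

variable {H : Type u} [NormedAddCommGroup H] [InnerProductSpace ℂ H] [CompleteSpace H]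

/-! ### Membership, weak limits and normality -/

theorem mem_of_forall_commutant {P : VonNeumannAlgebra H} {x : H →L[ℂ] H}
    (h : ∀ y ∈ P.commutant, y * x = x * y) : x ∈ P := by
  rw [← commutant_commutant P, mem_commutant_iff]
  exact h

theorem commute_of_mem_commutant {P : VonNeumannAlgebra H} {x y : H →L[ℂ] H} (hx : x ∈ P)
    (hy : y ∈ P.commutant) : y * x = x * y :=
  (mem_commutant_iff.1 hy x hx).symm

theorem cfc_mem {P : VonNeumannAlgebra H} {a : H →L[ℂ] H} (ha : a ∈ P) (f : ℝ → ℝ) :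
    cfc f a ∈ P :=
  mem_of_forall_commutant fun y hy =>
    ((show Commute a y from (commute_of_mem_commutant ha hy).symm).cfc_real f).eq.symm

theorem smul_mem {P : VonNeumannAlgebra H} {a : H →L[ℂ] H} (ha : a ∈ P) (c : ℂ) : c • a ∈ P :=
  P.toStarSubalgebra.smul_mem ha c

/-- A bounded family of operators has a weak limit along an ultrafilter. -/
theorem exists_weak_limit {α : Type*} (l : Ultrafilter α) (e : α → H →L[ℂ] H) (C : ℝ)
    (he : ∀ a, ‖e a‖ ≤ C) : ∃ e₀ : H →L[ℂ] H, ‖e₀‖ ≤ C ∧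
      ∀ ξ η, Tendsto (fun a => ⟪ξ, e a η⟫_ℂ) l (𝓝 ⟪ξ, e₀ η⟫_ℂ) := by
  have hb : ∀ ξ η : H, ∀ a, ‖⟪e a ξ, η⟫_ℂ‖ ≤ C * ‖ξ‖ * ‖η‖ := fun ξ η a =>
    (norm_inner_le_norm _ _).trans
      (by gcongr; exact (e a).le_of_opNorm_le (he a) ξ)
  -- Every coefficient stays in a compact disc, so it converges along the ultrafilter. The limits
  -- form a bounded sesquilinear form, which is represented by an operator.
  have hex : ∀ ξ η : H, ∃ z : ℂ, ‖z‖ ≤ C * ‖ξ‖ * ‖η‖ ∧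
      Tendsto (fun a => ⟪e a ξ, η⟫_ℂ) l (𝓝 z) := by
    intro ξ η
    obtain ⟨z, hz, hl⟩ := (isCompact_closedBall (0 : ℂ) (C * ‖ξ‖ * ‖η‖)).ultrafilter_le_nhds
      (l.map fun a => ⟪e a ξ, η⟫_ℂ) (by
        rw [le_principal_iff, Ultrafilter.mem_coe, Ultrafilter.mem_map]
        exact Filter.mem_of_superset univ_mem fun a _ => by simpa using hb ξ η a)
    exact ⟨z, by simpa using hz, hl⟩
  choose z hz hlim using hex
  obtain ⟨a₀⟩ : Nonempty α := l.nonempty_of_mem univ_mem |>.to_subtype.map Subtype.val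
  have hC : 0 ≤ C := (norm_nonneg _).trans (he a₀)
  have uniq : ∀ {ξ η : H} {w : ℂ}, Tendsto (fun a => ⟪e a ξ, η⟫_ℂ) l (𝓝 w) → z ξ η = w :=
    fun h => tendsto_nhds_unique (hlim _ _) h
  let B : H →L⋆[ℂ] H →L[ℂ] ℂ := LinearMap.mkContinuous₂
    (LinearMap.mk₂'ₛₗ (starRingEnd ℂ) (RingHom.id ℂ) z
      (fun ξ ξ' η => uniq (by simpa [inner_add_left] using (hlim ξ η).add (hlim ξ' η)))
      (fun c ξ η => uniq (by
        simpa [inner_smul_left, mul_comm] using (hlim ξ η).const_mul (starRingEnd ℂ c)))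
      (fun ξ η η' => uniq (by simpa [inner_add_right] using (hlim ξ η).add (hlim ξ η')))
      (fun c ξ η => uniq (by simpa [inner_smul_right] using (hlim ξ η).const_mul c))) C hz
  have hB : ∀ ξ η, ⟪InnerProductSpace.continuousLinearMapOfBilin B ξ, η⟫_ℂ = z ξ η := fun ξ η => by
    rw [InnerProductSpace.continuousLinearMapOfBilin_apply]
    rfl
  refine ⟨InnerProductSpace.continuousLinearMapOfBilin B, ?_, fun ξ η => ?_⟩
  · refine ContinuousLinearMap.opNorm_le_bound _ hC fun ξ => ?_
    set v := InnerProductSpace.continuousLinearMapOfBilin B ξ with hv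
    have h1 : ‖v‖ * ‖v‖ ≤ C * ‖ξ‖ * ‖v‖ := by
      calc ‖v‖ * ‖v‖ = ‖⟪v, v⟫_ℂ‖ := by
            rw [inner_self_eq_norm_sq_to_K]; simp [sq]
        _ ≤ _ := by
            conv_lhs => rw [hv, hB]
            exact hz _ _
    rcases (norm_nonneg v).eq_or_lt with h0 | h0
    · rw [← h0]; positivity
    · exact le_of_mul_le_mul_right h1 h0
  · have := (hlim η ξ).star
    rw [← hB, RCLike.star_def, inner_conj_symm] at this
    exact this.congr fun a => inner_conj_symm _ _

/-- By the bicommutant theorem, membership means commuting with P', and each such relation is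
preserved by weak limits. -/
theorem weak_limit_mem {P : VonNeumannAlgebra H} {α : Type*} {l : Filter α} [l.NeBot]
    {e : α → H →L[ℂ] H} {e₀ : H →L[ℂ] H} (he : ∀ a, e a ∈ P)
    (hlim : ∀ ξ η, Tendsto (fun a => ⟪ξ, e a η⟫_ℂ) l (𝓝 ⟪ξ, e₀ η⟫_ℂ)) : e₀ ∈ P := by
  refine mem_of_forall_commutant fun y hy => ?_
  refine ContinuousLinearMap.ext fun η => ext_inner_left ℂ fun ξ => ?_
  have h1 : Tendsto (fun a => ⟪ξ, (y * e a) η⟫_ℂ) l (𝓝 ⟪ξ, (y * e₀) η⟫_ℂ) := by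
    simpa [ContinuousLinearMap.adjoint_inner_left] using hlim (ContinuousLinearMap.adjoint y ξ) η
  have h2 : Tendsto (fun a => ⟪ξ, (e a * y) η⟫_ℂ) l (𝓝 ⟪ξ, (e₀ * y) η⟫_ℂ) := by
    simpa using hlim ξ (y η)
  exact tendsto_nhds_unique h1 (h2.congr fun a => by rw [commute_of_mem_commutant (he a) hy])

theorem summable_norm_mul_norm {E F : Type*} [NormedAddCommGroup E] [NormedAddCommGroup F]
    {ι : Type*} {ξ : ι → E} {η : ι → F} (hξ : Summable fun n => ‖ξ n‖ ^ 2)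
    (hη : Summable fun n => ‖η n‖ ^ 2) : Summable fun n => ‖ξ n‖ * ‖η n‖ := by
  refine Summable.of_nonneg_of_le (fun n => by positivity) (fun n => ?_) (hξ.add hη)
  nlinarith [sq_nonneg (‖ξ n‖ - ‖η n‖), sq_nonneg (‖ξ n‖), sq_nonneg (‖η n‖)]

/-- Sums of coefficients of bounded operators pass to weak limits. -/
theorem tendsto_tsum_inner {E : Type*} [NormedAddCommGroup E] [InnerProductSpace ℂ E]
    {α : Type*} {l : Filter α} {T : α → E →L[ℂ] E} {T₀ : E →L[ℂ] E} {C : ℝ}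
    (hT : ∀ᶠ a in l, ‖T a‖ ≤ C) (hlim : ∀ ξ η, Tendsto (fun a => ⟪ξ, T a η⟫_ℂ) l (𝓝 ⟪ξ, T₀ η⟫_ℂ))
    {ξ η : ℕ → E} (hξ : Summable fun n => ‖ξ n‖ ^ 2) (hη : Summable fun n => ‖η n‖ ^ 2) :
    Tendsto (fun a => ∑' n, ⟪ξ n, T a (η n)⟫_ℂ) l (𝓝 (∑' n, ⟪ξ n, T₀ (η n)⟫_ℂ)) := by
  refine tendsto_tsum_of_dominated_convergence
    ((summable_norm_mul_norm hξ hη).mul_left C) (fun n => hlim _ _) ?_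
  filter_upwards [hT] with a ha n
  calc ‖⟪ξ n, T a (η n)⟫_ℂ‖ ≤ ‖ξ n‖ * ‖T a (η n)‖ := norm_inner_le_norm _ _
    _ ≤ ‖ξ n‖ * (C * ‖η n‖) := by gcongr; exact (T a).le_of_opNorm_le ha _
    _ = _ := by ring

theorem IsNormalFunctional.tendsto {M : VonNeumannAlgebra H} {φ : M.toStarSubalgebra → ℂ}
    (hφ : M.IsNormalFunctional φ) {α : Type*} {l : Filter α} {e : α → M.toStarSubalgebra}
    {e₀ : M.toStarSubalgebra} {C : ℝ} (he : ∀ᶠ a in l, ‖(e a : H →L[ℂ] H)‖ ≤ C)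
    (hlim : ∀ ξ η, Tendsto (fun a => ⟪ξ, (e a : H →L[ℂ] H) η⟫_ℂ) l
      (𝓝 ⟪ξ, (e₀ : H →L[ℂ] H) η⟫_ℂ)) : Tendsto (fun a => φ (e a)) l (𝓝 (φ e₀)) := by
  obtain ⟨ξ, η, h1, h2, h3⟩ := hφ
  simpa only [(h3 _).tsum_eq] using tendsto_tsum_inner he hlim h1 h2

/-- Factorization `b = e k²` with `e` a contraction, `k` self-adjoint and `k²` close to
`|b| = b* e`. -/
theorem exists_approx_polar (b : H →L[ℂ] H) {ε : ℝ} (hε : 0 < ε) :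
    ∃ e k : H →L[ℂ] H, ‖e‖ ≤ 1 ∧ IsSelfAdjoint k ∧ e * k * k = b ∧
      k * k ≤ star b * e + (ε : ℂ) • 1 ∧
      ∀ P : VonNeumannAlgebra H, b ∈ P → e ∈ P ∧ k ∈ P := by
  have ha0 : 0 ≤ star b * b := star_mul_self_nonneg b
  have haP : ∀ P : VonNeumannAlgebra H, b ∈ P → star b * b ∈ P :=
    fun P hb => mul_mem (star_mem hb) hb
  obtain ⟨a, ha⟩ : ∃ a, a = star b * b := ⟨_, rfl⟩
  rw [← ha] at ha0
  simp only [← ha] at haP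
  have hasa : IsSelfAdjoint a := ha0.isSelfAdjoint
  have hsp : ∀ t ∈ spectrum ℝ a, 0 ≤ t := fun t ht => spectrum_nonneg_of_nonneg ha0 ht
  -- r(t) = √(|t| + ε²) is a regularized square root, bounded below by ε. So r(b*b) is close to |b|
  -- and invertible, and e = b r(b*b)⁻¹, k = r(b*b)^{1/2} replace the polar decomposition of b. The
  -- absolute value only makes r positive off the spectrum.
  obtain ⟨r, hrc, hrpos, hrsq⟩ : ∃ r : ℝ → ℝ, Continuous r ∧ (∀ t, 0 < r t) ∧
      ∀ t, r t * r t = |t| + ε ^ 2 :=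
    ⟨fun t => √(|t| + ε ^ 2), by fun_prop, fun t => Real.sqrt_pos.2 (by positivity),
      fun t => Real.mul_self_sqrt (by positivity)⟩
  have hεr : ∀ t, ε ≤ r t := fun t => by nlinarith [hrsq t, hrpos t, abs_nonneg t]
  have hric : Continuous fun t => (r t)⁻¹ := hrc.inv₀ fun t => (hrpos t).ne'
  have hrsc : Continuous fun t => √(r t) := by fun_prop
  have htc : Continuous fun t => t * (r t)⁻¹ := continuous_id.mul hric
  obtain ⟨g, hg⟩ : ∃ g, g = cfc (fun t => (r t)⁻¹) a := ⟨_, rfl⟩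
  obtain ⟨k, hk⟩ : ∃ k, k = cfc (fun t => √(r t)) a := ⟨_, rfl⟩
  have hgsa : IsSelfAdjoint g := hg ▸ cfc_predicate _ _
  have hksa : IsSelfAdjoint k := hk ▸ cfc_predicate _ _
  have hkk : k * k = cfc r a := by
    rw [hk, ← cfc_mul _ _ a hrsc.continuousOn hrsc.continuousOn]
    exact cfc_congr fun t _ => Real.mul_self_sqrt (hrpos t).le
  have hag : a * g = cfc (fun t => t * (r t)⁻¹) a := by
    rw [hg, cfc_mul (fun t : ℝ => t) (fun t => (r t)⁻¹) a continuousOn_id hric.continuousOn,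
      cfc_id' ℝ a]
  have hgr : g * (k * k) = 1 := by
    rw [hkk, hg, ← cfc_mul _ _ a hric.continuousOn hrc.continuousOn, ← cfc_one ℝ a]
    exact cfc_congr fun t _ => inv_mul_cancel₀ (hrpos t).ne'
  have hgag : g * (a * g) ≤ 1 := by
    rw [hag, hg, ← cfc_mul _ _ a hric.continuousOn htc.continuousOn]
    refine cfc_le_one _ _ fun t ht => ?_
    have h0 := hsp t ht
    have h2 := hrsq t
    rw [abs_of_nonneg h0] at h2
    have h3 := hrpos t
    have : (r t)⁻¹ * (t * (r t)⁻¹) = t / (r t * r t) := by field_simp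
    rw [this, h2, div_le_one (by positivity)]
    nlinarith
  have hle : k * k ≤ a * g + (ε : ℂ) • 1 := by
    have h1 : ((ε : ℂ) • (1 : H →L[ℂ] H)) = cfc (fun _ : ℝ => ε) a := by
      rw [cfc_const ε a, Algebra.algebraMap_eq_smul_one, Complex.coe_smul]
    rw [h1, hkk, hag, ← cfc_add a _ _ htc.continuousOn continuousOn_const]
    refine cfc_mono (fun t ht => ?_) hrc.continuousOn (htc.add continuous_const).continuousOn
    have h0 := hsp t ht
    have h2 := hrsq t
    rw [abs_of_nonneg h0] at h2
    have h3 := hrpos t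
    have h5 : r t = t * (r t)⁻¹ + ε ^ 2 * (r t)⁻¹ := by
      rw [← add_mul, ← h2, mul_assoc, mul_inv_cancel₀ h3.ne', mul_one]
    have h6 : ε ^ 2 * (r t)⁻¹ ≤ ε := by
      rw [← div_eq_mul_inv, div_le_iff₀ h3]
      nlinarith [hεr t]
    linarith
  refine ⟨b * g, k, ?_, hksa, ?_, ?_, fun P hb => ⟨mul_mem hb ?_, ?_⟩⟩
  · have h1 : star (b * g) * (b * g) ≤ 1 := by
      rwa [star_mul, hgsa.star_eq, mul_assoc, ← mul_assoc (star b), ← ha]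
    have h2 := (CStarAlgebra.norm_le_one_iff_of_nonneg _ (star_mul_self_nonneg (b * g))).2 h1
    rw [CStarRing.norm_star_mul_self] at h2
    nlinarith [norm_nonneg (b * g)]
  · rw [mul_assoc, mul_assoc, hgr, mul_one]
  · rwa [← mul_assoc, ← ha]
  · exact hg ▸ cfc_mem (haP P hb) _
  · exact hk ▸ cfc_mem (haP P hb) _

/-! ### Bounded vectors of L²P and the conditional expectation -/

namespace TraceState

variable {M : VonNeumannAlgebra H} {τ : M.TraceState}

/-- Normality of τ is what links the two Hilbert spaces: bounded weak convergence on H becomes weak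
convergence of the vectors in L²M, tested on the dense set of all x̂. -/
theorem tendsto_inner_hat {α : Type*} {l : Filter α} {e : α → M.toStarSubalgebra}
    {e₀ : M.toStarSubalgebra} {C : ℝ} (he : ∀ᶠ a in l, ‖(e a : H →L[ℂ] H)‖ ≤ C)
    (hlim : ∀ ξ η, Tendsto (fun a => ⟪ξ, (e a : H →L[ℂ] H) η⟫_ℂ) l
      (𝓝 ⟪ξ, (e₀ : H →L[ℂ] H) η⟫_ℂ)) (x : M.toStarSubalgebra) :
    Tendsto (fun a => ⟪τ.hat x, τ.hat (e a)⟫_ℂ) l (𝓝 ⟪τ.hat x, τ.hat e₀⟫_ℂ) := by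
  simp only [inner_hat]
  refine τ.normal.tendsto (C := ‖(x : H →L[ℂ] H)‖ * C) ?_ fun ξ η => ?_
  · filter_upwards [he] with a ha
    calc ‖((star x * e a : M.toStarSubalgebra) : H →L[ℂ] H)‖
        ≤ ‖star (x : H →L[ℂ] H)‖ * ‖(e a : H →L[ℂ] H)‖ := norm_mul_le _ _
      _ ≤ _ := by rw [norm_star]; gcongr
  · simpa [ContinuousLinearMap.star_eq_adjoint, ContinuousLinearMap.adjoint_inner_right]
      using hlim ((x : H →L[ℂ] H) ξ) η

/-- The vectors given by the elements of norm at most `C` in a subalgebra form a closed set. -/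
theorem isClosed_hat_ball {P : VonNeumannAlgebra H} (hP : P ≤ M) (C : ℝ) :
    IsClosed (τ.hat '' {e | (e : H →L[ℂ] H) ∈ P ∧ ‖(e : H →L[ℂ] H)‖ ≤ C}) := by
  rw [isClosed_iff_ultrafilter]
  intro ξ l hl hmem
  rw [← Ultrafilter.mem_coe] at hmem
  choose! e he heq using fun v (hv : v ∈ τ.hat '' {e | (e : H →L[ℂ] H) ∈ P ∧
    ‖(e : H →L[ℂ] H)‖ ≤ C}) => hv
  obtain ⟨v₀, hv₀⟩ := l.nonempty_of_mem hmem
  -- Off the image the constant value e v₀ is used, so that the norm bound required by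
  -- `exists_weak_limit` holds everywhere; the ultrafilter does not see these points.
  let e' : τ.L2 → M.toStarSubalgebra := fun v => by
    classical
    exact if v ∈ τ.hat '' {e | (e : H →L[ℂ] H) ∈ P ∧ ‖(e : H →L[ℂ] H)‖ ≤ C} then e v else e v₀
  have he' : ∀ v, (e' v : H →L[ℂ] H) ∈ P ∧ ‖(e' v : H →L[ℂ] H)‖ ≤ C := by
    intro v
    simp only [e']
    split_ifs with h
    exacts [he v h, he v₀ hv₀]
  obtain ⟨e₀, hn, hlim⟩ := exists_weak_limit l (fun v => (e' v : H →L[ℂ] H)) C fun v => (he' v).2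
  have hP₀ : e₀ ∈ P := weak_limit_mem (fun v => (he' v).1) hlim
  refine ⟨⟨e₀, hP hP₀⟩, ⟨hP₀, hn⟩, ?_⟩
  refine sub_eq_zero.1 ?_
  set δ := τ.hat ⟨e₀, hP hP₀⟩ - ξ with hδ
  have key : ∀ x, ⟪τ.hat x, δ⟫_ℂ = 0 := by
    intro x
    rw [hδ, inner_sub_right, sub_eq_zero]
    have h1 := tendsto_inner_hat (τ := τ) (l := (l : Filter τ.L2)) (e := e') (e₀ := ⟨e₀, hP hP₀⟩)
      (.of_forall fun v => (he' v).2) hlim x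
    have h2 : Tendsto (fun v => ⟪τ.hat x, v⟫_ℂ) l (𝓝 ⟪τ.hat x, ξ⟫_ℂ) :=
      ((by fun_prop : Continuous fun v => ⟪τ.hat x, v⟫_ℂ).tendsto ξ).mono_left hl
    refine tendsto_nhds_unique h1 (h2.congr' ?_)
    filter_upwards [hmem] with v hv
    simp only [e', if_pos hv, heq v hv]
  exact inner_self_eq_zero.1
    (eq_of_forall_hat (f := fun ζ => ⟪ζ, δ⟫_ℂ) (g := fun _ => 0) (by fun_prop) (by fun_prop) key δ)

theorem convex_hat_ball (P : VonNeumannAlgebra H) (C : ℝ) :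
    Convex ℝ (τ.hat '' {e | (e : H →L[ℂ] H) ∈ P ∧ ‖(e : H →L[ℂ] H)‖ ≤ C}) := by
  rintro _ ⟨e, ⟨h1, h2⟩, rfl⟩ _ ⟨f, ⟨h3, h4⟩, rfl⟩ s t hs ht hst
  refine ⟨(s : ℂ) • e + (t : ℂ) • f, ⟨add_mem (smul_mem h1 _) (smul_mem h3 _), ?_⟩, ?_⟩
  · calc ‖(s : ℂ) • (e : H →L[ℂ] H) + (t : ℂ) • (f : H →L[ℂ] H)‖
        ≤ ‖(s : ℂ) • (e : H →L[ℂ] H)‖ + ‖(t : ℂ) • (f : H →L[ℂ] H)‖ := norm_add_le _ _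
      _ ≤ s * C + t * C := by
          rw [norm_smul, norm_smul, Complex.norm_real, Complex.norm_real, Real.norm_of_nonneg hs,
            Real.norm_of_nonneg ht]
          gcongr
      _ = C := by rw [← add_mul, hst, one_mul]
  · rw [hat_add, hat_smul, hat_smul, Complex.coe_smul, Complex.coe_smul]

/-- A vector of `L²P` that is bounded by `C` is given by an element of `P` of norm at most `C`. -/
theorem exists_eq_hat_of_bounded {P : VonNeumannAlgebra H} (hP : P ≤ M) {ξ : τ.L2} {C : ℝ}
    (hC : 0 ≤ C) (hξ : ξ ∈ τ.L2Sub P)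
    (h : ∀ b c : M.toStarSubalgebra, (b : H →L[ℂ] H) ∈ P → (c : H →L[ℂ] H) ∈ P →
      ‖⟪τ.hat (b * c), ξ⟫_ℂ‖ ≤ C * ‖τ.hat b‖ * ‖τ.hat c‖) :
    ∃ e : M.toStarSubalgebra, (e : H →L[ℂ] H) ∈ P ∧ ‖(e : H →L[ℂ] H)‖ ≤ C ∧ τ.hat e = ξ := by
  by_contra hcon
  have hdisj : ξ ∉ τ.hat '' {e | (e : H →L[ℂ] H) ∈ P ∧ ‖(e : H →L[ℂ] H)‖ ≤ C} := by
    rintro ⟨e, ⟨h1, h2⟩, h3⟩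
    exact hcon ⟨e, h1, h2, h3⟩
  obtain ⟨f, u, hf1, hf2⟩ := RCLike.geometric_hahn_banach_closed_point (𝕜 := ℂ)
    (convex_hat_ball P C) (isClosed_hat_ball hP C) hdisj
  -- No functional given by some b ∈ P can separate ξ from the ball: with b = e k², the bound on ξ
  -- gives |⟪b, ξ⟫| ≤ C ‖k‖₂², while the element C e of the ball satisfies ⟪b, Ce⟫ = C τ(b* e) ≥ C
  -- (‖k‖₂² - ε), in real parts.
  have key : ∀ b : M.toStarSubalgebra, (b : H →L[ℂ] H) ∈ P → ∀ ε > 0,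
      ∃ e : M.toStarSubalgebra, (e : H →L[ℂ] H) ∈ P ∧ ‖(e : H →L[ℂ] H)‖ ≤ C ∧
        (⟪τ.hat b, ξ⟫_ℂ).re ≤ (⟪τ.hat b, τ.hat e⟫_ℂ).re + C * ε := by
    intro b hb ε hε
    obtain ⟨e, k, he1, hk, hekk, hle, hmem⟩ := exists_approx_polar (b : H →L[ℂ] H) hε
    obtain ⟨heP, hkP⟩ := hmem P hb
    let e' : M.toStarSubalgebra := ⟨e, hP heP⟩
    let k' : M.toStarSubalgebra := ⟨k, hP hkP⟩
    have hk' : star k' = k' := Subtype.ext hk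
    have hb' : e' * k' * k' = b := Subtype.ext hekk
    refine ⟨(C : ℂ) • e', smul_mem heP _, ?_, ?_⟩
    · calc ‖(C : ℂ) • e‖ = C * ‖e‖ := by
            rw [norm_smul, Complex.norm_real, Real.norm_of_nonneg hC]
        _ ≤ C := mul_le_of_le_one_right hC he1
    · have h1 : (⟪τ.hat b, ξ⟫_ℂ).re ≤ C * ‖τ.hat k'‖ ^ 2 := by
        refine (Complex.re_le_norm _).trans ?_
        rw [← hb']
        refine (h (e' * k') k' (mul_mem heP hkP) hkP).trans ?_
        rw [mul_assoc, sq]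
        gcongr
        calc ‖τ.hat (e' * k')‖ ≤ ‖e‖ * ‖τ.hat k'‖ := τ.norm_hat_mul_le e' k'
          _ ≤ ‖τ.hat k'‖ := mul_le_of_le_one_left (norm_nonneg _) he1
      have h2 : ‖τ.hat k'‖ ^ 2 ≤ (τ.toFun (star b * e')).re + ε := by
        have h3 := τ.toFun_mono (x := star k' * k') (y := star b * e' + (ε : ℂ) • 1)
          (by rw [hk']; exact hle)
        rw [← norm_hat_sq, map_add, map_smul, τ.map_one] at h3
        have h4 := (Complex.le_def.1 h3).1
        rw [Complex.ofReal_re] at h4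
        simpa using h4
      rw [hat_smul, inner_smul_right, inner_hat, Complex.re_ofReal_mul]
      nlinarith
  set ζ := (InnerProductSpace.toDual ℂ τ.L2).symm f with hζ
  have hfζ : ∀ v, f v = ⟪ζ, v⟫_ℂ := fun v => by
    rw [hζ, InnerProductSpace.toDual_symm_apply]
  set ζ' := (τ.L2Sub P).starProjection ζ with hζ'
  have hfζ' : ∀ v ∈ τ.L2Sub P, f v = ⟪ζ', v⟫_ℂ := fun v hv => by
    rw [hfζ, hζ', Submodule.inner_starProjection_left_eq_right,
      Submodule.starProjection_eq_self_iff.2 hv]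
  have hcl : ∀ δ > 0, ∃ b : M.toStarSubalgebra, (b : H →L[ℂ] H) ∈ P ∧ ‖ζ' - τ.hat b‖ < δ := by
    intro δ hδ
    have hz : ζ' ∈ τ.L2Sub P := Submodule.starProjection_apply_mem _ _
    rw [L2Sub, closedSpan, ← SetLike.mem_coe, Submodule.topologicalClosure_coe,
      Metric.mem_closure_iff] at hz
    obtain ⟨v, hv, hd⟩ := hz δ hδ
    have : Submodule.span ℂ (τ.hat '' {b | (b : H →L[ℂ] H) ∈ P}) ≤
        (P.toStarSubalgebra.toSubalgebra.toSubmodule.comap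
          M.toStarSubalgebra.toSubalgebra.toSubmodule.subtype).map τ.hatLinear :=
      Submodule.span_le.2 (by rintro _ ⟨b, hb, rfl⟩; exact ⟨b, hb, rfl⟩)
    obtain ⟨b, hb, rfl⟩ := this hv
    exact ⟨b, hb, by rwa [dist_eq_norm] at hd⟩
  -- γ is the separation gap. Replacing the functional by b costs at most γ/4 on ξ and e together,
  -- and the error C ε from `key` is at most γ/4, so the gap cannot close.
  set γ := (f ξ).re - u with hγ
  have hγ0 : 0 < γ := by have : u < (f ξ).re := hf2; linarith
  obtain ⟨b, hb, hbd⟩ := hcl (γ / (4 * (‖ξ‖ + C + 1))) (by positivity)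
  obtain ⟨e, heP, heC, hle⟩ := key b hb (γ / (4 * (C + 1))) (by positivity)
  have e1 : ∀ v ∈ τ.L2Sub P, |(f v).re - (⟪τ.hat b, v⟫_ℂ).re| ≤
      γ / (4 * (‖ξ‖ + C + 1)) * ‖v‖ := fun v hv => by
    rw [hfζ' v hv, ← Complex.sub_re, ← inner_sub_left]
    refine (Complex.abs_re_le_norm _).trans ((norm_inner_le_norm _ _).trans ?_)
    gcongr
  have e2 := e1 ξ hξ
  have e3 := e1 (τ.hat e) (τ.hat_mem_L2Sub P e heP)
  have e4 : (f (τ.hat e)).re < u := hf1 _ ⟨e, ⟨heP, heC⟩, rfl⟩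
  have e5 : ‖τ.hat e‖ ≤ C := (τ.norm_hat_le e).trans heC
  have e6 : γ / (4 * (‖ξ‖ + C + 1)) * ‖ξ‖ + γ / (4 * (‖ξ‖ + C + 1)) * ‖τ.hat e‖ ≤ γ / 4 := by
    rw [← mul_add, div_mul_eq_mul_div, div_le_div_iff₀ (by positivity) (by positivity)]
    nlinarith [norm_nonneg ξ, mul_le_mul_of_nonneg_left e5 hγ0.le]
  have e7 : C * (γ / (4 * (C + 1))) ≤ γ / 4 := by
    rw [mul_div_assoc', div_le_div_iff₀ (by positivity) (by positivity)]
    nlinarith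
  rw [abs_le] at e2 e3
  linarith [e2.1, e2.2, e3.1, e3.2]

/-- The trace preserving conditional expectation. -/
theorem exists_condExp_eq_hat {P : VonNeumannAlgebra H} (hP : P ≤ M) (x : M.toStarSubalgebra) :
    ∃ e : M.toStarSubalgebra, (e : H →L[ℂ] H) ∈ P ∧ ‖(e : H →L[ℂ] H)‖ ≤ ‖(x : H →L[ℂ] H)‖ ∧
      τ.condExp P x = τ.hat e := by
  -- The vector of E_P(x) is bounded by ‖x‖, because its inner product with the vector of bc, for b,
  -- c ∈ P, is ⟪b, x c*⟫.
  obtain ⟨e, h1, h2, h3⟩ := exists_eq_hat_of_bounded hP (norm_nonneg (x : H →L[ℂ] H))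
    (condExp_mem (τ := τ) P x) fun b c hb hc => by
      rw [inner_condExp x (τ.hat_mem_L2Sub P _ (mul_mem hb hc)), ← rightMul_hat,
        ← star_star c, ← inner_rightMul, rightMul_hat, star_star]
      refine (norm_inner_le_norm _ _).trans ?_
      have := τ.norm_hat_mul_le x (star c)
      rw [norm_hat_star] at this
      calc _ ≤ ‖τ.hat b‖ * (‖(x : H →L[ℂ] H)‖ * ‖τ.hat c‖) := by gcongr
        _ = _ := by ring
  exact ⟨e, h1, h2, h3.symm⟩

end TraceState

end VonNeumannAlgebra

end

noncomputable section

namespace VonNeumannAlgebra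

variable {H : Type u} [NormedAddCommGroup H] [InnerProductSpace ℂ H] [CompleteSpace H]

/-! ### Diffuse algebras contain weakly null unitaries -/

theorem inner_starProjection_apply {p : H →L[ℂ] H} (hp : IsStarProjection p) (ξ η : H) :
    ⟪ξ, p η⟫_ℂ = ⟪p ξ, p η⟫_ℂ := by
  conv_lhs => rw [← hp.isIdempotentElem.eq, mul_apply_eq_comp,
    ← ContinuousLinearMap.adjoint_inner_left, ← ContinuousLinearMap.star_eq_adjoint,
    hp.isSelfAdjoint.star_eq]

theorem norm_starProjection_sq {p : H →L[ℂ] H} (hp : IsStarProjection p) (ξ : H) :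
    ‖p ξ‖ ^ 2 = (⟪ξ, p ξ⟫_ℂ).re := by
  rw [inner_starProjection_apply hp, inner_self_eq_norm_sq_to_K]
  norm_cast

theorem norm_starProjection_le {p : H →L[ℂ] H} (hp : IsStarProjection p) (ξ : H) :
    ‖p ξ‖ ≤ ‖ξ‖ := by
  have h1 := norm_starProjection_sq hp ξ
  have h2 := (Complex.re_le_norm _).trans (norm_inner_le_norm (𝕜 := ℂ) ξ (p ξ))
  rw [← h1, sq] at h2
  rcases (norm_nonneg (p ξ)).eq_or_lt with h | h
  · rw [← h]; positivity
  · exact le_of_mul_le_mul_right h2 h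

/-- Any nonzero projection of a diffuse algebra dominates nonzero projections on which a given
finite sum of vector functionals is arbitrarily small. -/
theorem IsDiffuse.exists_small_projection {A : VonNeumannAlgebra H} (hA : A.IsDiffuse)
    (s : Finset H) {p : H →L[ℂ] H} (hpA : p ∈ A) (hp : IsStarProjection p) (hp0 : p ≠ 0) {ε : ℝ}
    (hε : 0 < ε) : ∃ q ∈ A, IsStarProjection q ∧ q ≠ 0 ∧ p * q = q ∧ ∑ ξ ∈ s, ‖q ξ‖ ^ 2 < ε := by
  -- The sum of the ‖q ξ‖² is additive over p = q + (p - q), so one of the two nonzero pieces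
  -- carries at most half of it. Iteration makes it as small as desired.
  have half : ∀ p ∈ A, IsStarProjection p → p ≠ 0 → ∃ q ∈ A, IsStarProjection q ∧ q ≠ 0 ∧
      p * q = q ∧ ∑ ξ ∈ s, ‖q ξ‖ ^ 2 ≤ (∑ ξ ∈ s, ‖p ξ‖ ^ 2) / 2 := by
    intro p hpA hp hp0
    obtain ⟨q, hqA, hq, hq0, hqp, hpq⟩ := hA p hpA hp hp0
    have hsub : IsStarProjection (p - q) := hq.sub_of_mul_eq_right hp hpq
    have hsum : ∑ ξ ∈ s, ‖p ξ‖ ^ 2 = ∑ ξ ∈ s, ‖q ξ‖ ^ 2 + ∑ ξ ∈ s, ‖(p - q) ξ‖ ^ 2 := by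
      rw [← Finset.sum_add_distrib]
      refine Finset.sum_congr rfl fun ξ _ => ?_
      rw [norm_starProjection_sq hp, norm_starProjection_sq hq, norm_starProjection_sq hsub,
        ← Complex.add_re, ← inner_add_right]
      simp
    rcases le_total (∑ ξ ∈ s, ‖q ξ‖ ^ 2) (∑ ξ ∈ s, ‖(p - q) ξ‖ ^ 2) with h | h
    · exact ⟨q, hqA, hq, hq0, hpq, by linarith⟩
    · exact ⟨p - q, sub_mem hpA hqA, hsub, sub_ne_zero.2 hqp.symm,
        by rw [mul_sub, hp.isIdempotentElem.eq, hpq], by linarith⟩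
  have iter : ∀ n : ℕ, ∃ q ∈ A, IsStarProjection q ∧ q ≠ 0 ∧ p * q = q ∧
      ∑ ξ ∈ s, ‖q ξ‖ ^ 2 ≤ (∑ ξ ∈ s, ‖p ξ‖ ^ 2) * (1 / 2) ^ n := by
    intro n
    induction n with
    | zero => exact ⟨p, hpA, hp, hp0, hp.isIdempotentElem.eq, by simp⟩
    | succ n ih =>
      obtain ⟨q, hqA, hq, hq0, hpq, hle⟩ := ih
      obtain ⟨r, hrA, hr, hr0, hqr, hle'⟩ := half q hqA hq hq0
      refine ⟨r, hrA, hr, hr0, by rw [← hqr, ← mul_assoc, hpq], hle'.trans ?_⟩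
      rw [pow_succ]
      linarith
  have hlim : Tendsto (fun n : ℕ => (∑ ξ ∈ s, ‖p ξ‖ ^ 2) * (1 / 2 : ℝ) ^ n) atTop (𝓝 0) := by
    simpa using (tendsto_pow_atTop_nhds_zero_of_lt_one (by norm_num : (0 : ℝ) ≤ 1 / 2)
      (by norm_num)).const_mul (∑ ξ ∈ s, ‖p ξ‖ ^ 2)
  obtain ⟨n, hn⟩ := (hlim.eventually (gt_mem_nhds hε)).exists
  obtain ⟨q, h1, h2, h3, h4, h5⟩ := iter n
  exact ⟨q, h1, h2, h3, h4, h5.trans_lt hn⟩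

theorem isStarProjection_sum {ι : Type*} {p : ι → H →L[ℂ] H} (t : Finset ι)
    (hp : ∀ i ∈ t, IsStarProjection (p i)) (ho : ∀ i ∈ t, ∀ j ∈ t, i ≠ j → p i * p j = 0) :
    IsStarProjection (∑ i ∈ t, p i) := by
  classical
  refine ⟨?_, ?_⟩
  · change (∑ i ∈ t, p i) * (∑ i ∈ t, p i) = ∑ i ∈ t, p i
    rw [Finset.sum_mul_sum]
    refine Finset.sum_congr rfl fun i hi => ?_
    rw [Finset.sum_eq_single_of_mem i hi fun j hj hji => ho i hi j hj hji.symm,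
      (hp i hi).isIdempotentElem.eq]
  · change star (∑ i ∈ t, p i) = _
    rw [star_sum]
    exact Finset.sum_congr rfl fun i hi => (hp i hi).isSelfAdjoint.star_eq

/-- In a diffuse algebra, the unit is a finite sum of orthogonal projections on each of which a
given finite sum of vector functionals is small. -/
theorem IsDiffuse.exists_small_partition {A : VonNeumannAlgebra H} (hA : A.IsDiffuse)
    (s : Finset H) {ε : ℝ} (hε : 0 < ε) : ∃ t : Finset (H →L[ℂ] H),
      (∀ p ∈ t, p ∈ A ∧ IsStarProjection p ∧ ∑ ξ ∈ s, ‖p ξ‖ ^ 2 < ε) ∧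
      (∀ p ∈ t, ∀ q ∈ t, p ≠ q → p * q = 0) ∧ ∑ p ∈ t, p = 1 := by
  classical
  let 𝓕 : Set (Set (H →L[ℂ] H)) := {F | (∀ p ∈ F, p ∈ A ∧ IsStarProjection p ∧ p ≠ 0 ∧
    ∑ ξ ∈ s, ‖p ξ‖ ^ 2 < ε) ∧ ∀ p ∈ F, ∀ q ∈ F, p ≠ q → p * q = 0}
  obtain ⟨F, hF⟩ : ∃ F, Maximal (· ∈ 𝓕) F := by
    refine zorn_subset 𝓕 fun c hc hchain => ⟨⋃₀ c, ⟨?_, ?_⟩, fun _ => Set.subset_sUnion_of_mem⟩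
    · rintro p ⟨G, hG, hpG⟩
      exact (hc hG).1 p hpG
    · rintro p ⟨G, hG, hpG⟩ q ⟨G', hG', hqG'⟩ hpq
      rcases hchain.total hG hG' with h | h
      · exact (hc hG').2 p (h hpG) q hqG' hpq
      · exact (hc hG).2 p hpG q (h hqG') hpq
  have hF1 := hF.prop.1
  have hF2 := hF.prop.2
  -- S is the complement of the supremum of the maximal family. Its projection lies in A because the
  -- commutant of A leaves S invariant; were it nonzero, a small projection below it would enlarge
  -- F.
  let S : Submodule ℂ H := ⨅ p ∈ F, p.ker
  have hSmem : ∀ ξ, ξ ∈ S ↔ ∀ p ∈ F, p ξ = 0 := fun ξ => by simp [S, Submodule.mem_iInf]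
  have hSclosed : IsClosed (S : Set H) := by
    have : (S : Set H) = ⋂ p ∈ F, {ξ | p ξ = 0} := by ext ξ; simp [hSmem]
    rw [this]
    exact isClosed_biInter fun p _ => isClosed_eq p.continuous continuous_const
  have : CompleteSpace S := hSclosed.isComplete.completeSpace_coe
  have heA : S.starProjection ∈ A := by
    rw [IsStarProjection.mem_iff isStarProjection_starProjection]
    intro y hy ξ hξ
    have hrange : S.starProjection.range = S := Submodule.range_starProjection S
    rw [hrange] at hξ ⊢
    rw [Submodule.mem_comap, hSmem]
    intro p hp
    have := congrArg (fun T : H →L[ℂ] H => T ξ) (commute_of_mem_commutant (hF1 p hp).1 hy)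
    have h2 := (hSmem ξ).1 hξ p hp
    simp only [mul_apply_eq_comp, h2, map_zero] at this
    exact this.symm
  have hpe : ∀ p ∈ F, p * S.starProjection = 0 := fun p hp => ContinuousLinearMap.ext fun ξ =>
    (hSmem _).1 (Submodule.starProjection_apply_mem _ _) p hp
  have he0 : S.starProjection = 0 := by
    by_contra hne
    obtain ⟨q, hqA, hq, hq0, heq, hqs⟩ :=
      hA.exists_small_projection s heA isStarProjection_starProjection hne hε
    have hFq : ∀ p ∈ F, p * q = 0 := fun p hp => by
      rw [← heq, ← mul_assoc, hpe p hp, zero_mul]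
    have hqF : ∀ p ∈ F, q * p = 0 := fun p hp => by
      have := congrArg star (hFq p hp)
      rwa [star_mul, (hF1 p hp).2.1.isSelfAdjoint.star_eq, hq.isSelfAdjoint.star_eq,
        star_zero] at this
    have hins : insert q F ∈ 𝓕 := by
      refine ⟨?_, ?_⟩
      · rintro p (rfl | hp)
        exacts [⟨hqA, hq, hq0, hqs⟩, hF1 p hp]
      · rintro p (rfl | hp) p' (rfl | hp') hne'
        exacts [absurd rfl hne', hqF p' hp', hFq p hp, hF2 p hp p' hp' hne']
    have hqmem : q ∈ F := hF.le_of_ge hins (Set.subset_insert q F) (Set.mem_insert q F)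
    exact hq0 (by rw [← hq.isIdempotentElem.eq]; exact hFq q hqmem)
  have hS : S = ⊥ := by
    rw [eq_bot_iff]
    intro ξ hξ
    rw [Submodule.mem_bot, ← Submodule.starProjection_eq_self_iff.2 hξ, he0,
      zero_apply]
  have hsumproj : ∀ t : Finset (H →L[ℂ] H), ↑t ⊆ F → IsStarProjection (∑ p ∈ t, p) := fun t ht =>
    isStarProjection_sum t (fun p hp => (hF1 p (ht hp)).2.1)
      fun p hp q hq => hF2 p (ht hp) q (ht hq)
  have hmono : ∀ t t' : Finset (H →L[ℂ] H), t ⊆ t' → ↑t' ⊆ F →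
      (∑ p ∈ t', p) * (∑ p ∈ t, p) = ∑ p ∈ t, p := by
    intro t t' htt ht'
    rw [Finset.mul_sum]
    refine Finset.sum_congr rfl fun p hp => ?_
    rw [Finset.sum_mul, Finset.sum_eq_single_of_mem p (htt hp) fun q hq hqp =>
      hF2 q (ht' hq) p (ht' (htt hp)) hqp, (hF1 p (ht' (htt hp))).2.1.isIdempotentElem.eq]
  -- The vectors fixed by a finite partial sum. They are dense, since a vector orthogonal to D is
  -- killed by every p ∈ F, hence lies in S = 0.
  let D : Submodule ℂ H :=
    { carrier := {ξ | ∃ t : Finset (H →L[ℂ] H), ↑t ⊆ F ∧ (∑ p ∈ t, p) ξ = ξ}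
      add_mem' := by
        rintro ξ η ⟨t, ht, hξ⟩ ⟨t', ht', hη⟩
        have hu : ((t ∪ t' : Finset _) : Set (H →L[ℂ] H)) ⊆ F := by simp [ht, ht']
        refine ⟨t ∪ t', hu, ?_⟩
        rw [map_add]
        congr 1
        · rw [← hξ, ← mul_apply_eq_comp, hmono _ _ Finset.subset_union_left hu]
        · rw [← hη, ← mul_apply_eq_comp, hmono _ _ Finset.subset_union_right hu]
      zero_mem' := ⟨∅, by simp, by simp⟩
      smul_mem' := by
        rintro c ξ ⟨t, ht, hξ⟩
        exact ⟨t, ht, by rw [map_smul, hξ]⟩ }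
  have hDdense : D.topologicalClosure = ⊤ := by
    rw [Submodule.topologicalClosure_eq_top_iff, eq_bot_iff, ← hS]
    intro ξ hξ
    rw [hSmem]
    intro p hp
    have hpD : p ξ ∈ D := ⟨{p}, by simpa using hp, by
      rw [Finset.sum_singleton, ← mul_apply_eq_comp,
        (hF1 p hp).2.1.isIdempotentElem.eq]⟩
    have := (Submodule.mem_orthogonal' D ξ).1 hξ _ hpD
    rw [inner_starProjection_apply (hF1 p hp).2.1] at this
    exact inner_self_eq_zero.1 this
  have happrox : ∀ δ > 0, ∀ s' : Finset H, ∃ t : Finset (H →L[ℂ] H), ↑t ⊆ F ∧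
      ∀ ξ ∈ s', ‖(1 - ∑ p ∈ t, p) ξ‖ < δ := by
    intro δ hδ s'
    induction s' using Finset.induction_on with
    | empty => exact ⟨∅, by simp, by simp⟩
    | insert ξ s' _ ih =>
      obtain ⟨t, ht, hts⟩ := ih
      have hξ : ξ ∈ closure (D : Set H) := by
        rw [← Submodule.topologicalClosure_coe, hDdense]; trivial
      obtain ⟨ζ, ⟨t', ht', hζ⟩, hd⟩ := Metric.mem_closure_iff.1 hξ δ hδ
      have hu : ((t ∪ t' : Finset _) : Set (H →L[ℂ] H)) ⊆ F := by simp [ht, ht']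
      -- Enlarging the finite family only decreases the remainder, so the approximations of
      -- different vectors can be combined.
      have hcontr : ∀ r : Finset (H →L[ℂ] H), r ⊆ t ∪ t' → ∀ η,
          ‖(1 - ∑ p ∈ t ∪ t', p) η‖ ≤ ‖(1 - ∑ p ∈ r, p) η‖ := by
        intro r hr η
        have h1 : (1 - ∑ p ∈ t ∪ t', p) * (1 - ∑ p ∈ r, p) = 1 - ∑ p ∈ t ∪ t', p := by
          rw [sub_mul, one_mul, mul_sub, hmono r _ hr hu, mul_one]
          abel
        rw [← h1, mul_apply_eq_comp]
        exact norm_starProjection_le (hsumproj _ hu).one_sub _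
      refine ⟨t ∪ t', hu, fun η hη => ?_⟩
      rcases Finset.mem_insert.1 hη with rfl | hη
      · refine (hcontr t' Finset.subset_union_right η).trans_lt ?_
        have h2 : (1 - ∑ p ∈ t', p) η = (1 - ∑ p ∈ t', p) (η - ζ) := by
          rw [map_sub, sub_apply _ _ ζ, one_apply_eq_self, hζ,
            sub_self, sub_zero]
        have ht'F : (t' : Set (H →L[ℂ] H)) ⊆ F := ht'
        rw [h2]
        exact (norm_starProjection_le (hsumproj t' ht'F).one_sub _).trans_lt
          (by rwa [← dist_eq_norm])
      · exact (hcontr t Finset.subset_union_left η).trans_lt (hts η hη)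
  obtain ⟨δ, hδ, hδs⟩ : ∃ δ > 0, (s.card : ℝ) * δ ^ 2 < ε := by
    have : Tendsto (fun δ : ℝ => (s.card : ℝ) * δ ^ 2) (𝓝[>] 0) (𝓝 0) := by
      have h : Continuous fun δ : ℝ => (s.card : ℝ) * δ ^ 2 := by fun_prop
      simpa using (h.tendsto 0).mono_left nhdsWithin_le_nhds
    obtain ⟨δ, h1, h2⟩ := ((this.eventually (gt_mem_nhds hε)).and self_mem_nhdsWithin).exists
    exact ⟨δ, h2, h1⟩
  obtain ⟨t, ht, hts⟩ := happrox δ hδ s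
  -- The remainder of a sufficiently long partial sum is itself small on s, so it can serve as the
  -- last member of the finite partition. It may be zero, but it is not in t, whose members are
  -- nonzero.
  set r := 1 - ∑ p ∈ t, p with hr
  have hrproj : IsStarProjection r := (hsumproj t ht).one_sub
  have htr : ∀ p ∈ t, p * r = 0 := by
    intro p hp
    rw [hr, mul_sub, mul_one, Finset.mul_sum, Finset.sum_eq_single_of_mem p hp fun q hq hqp =>
      hF2 p (ht hp) q (ht hq) hqp.symm, (hF1 p (ht hp)).2.1.isIdempotentElem.eq, sub_self]
  have hrt : ∀ p ∈ t, r * p = 0 := by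
    intro p hp
    have := congrArg star (htr p hp)
    rwa [star_mul, (hF1 p (ht hp)).2.1.isSelfAdjoint.star_eq, hrproj.isSelfAdjoint.star_eq,
      star_zero] at this
  have hrnot : r ∉ t := fun hmem => by
    have h1 := htr r hmem
    rw [hrproj.isIdempotentElem.eq] at h1
    exact (hF1 r (ht hmem)).2.2.1 h1
  refine ⟨insert r t, ?_, ?_, ?_⟩
  · intro p hp
    rcases Finset.mem_insert.1 hp with rfl | hp
    · refine ⟨sub_mem (one_mem A) (sum_mem fun p hp => (hF1 p (ht hp)).1), hrproj, ?_⟩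
      calc ∑ ξ ∈ s, ‖r ξ‖ ^ 2 ≤ ∑ ξ ∈ s, δ ^ 2 :=
            Finset.sum_le_sum fun ξ hξ => pow_le_pow_left₀ (norm_nonneg _) (hts ξ hξ).le 2
        _ = (s.card : ℝ) * δ ^ 2 := by simp
        _ < ε := hδs
    · exact ⟨(hF1 p (ht hp)).1, (hF1 p (ht hp)).2.1, (hF1 p (ht hp)).2.2.2⟩
  · intro p hp q hq hpq
    rcases Finset.mem_insert.1 hp with rfl | hp <;> rcases Finset.mem_insert.1 hq with rfl | hq
    · exact absurd rfl hpq
    · exact hrt q hq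
    · exact htr p hp
    · exact hF2 p (ht hp) q (ht hq) hpq
  · rw [Finset.sum_insert hrnot, hr, sub_add_cancel]

/-- Signs can be chosen so that a signed sum of vectors is no longer than in the orthogonal case. -/
theorem exists_signs {ι E : Type*} [NormedAddCommGroup E] [InnerProductSpace ℂ E] (t : Finset ι)
    (c : ι → E) : ∃ σ : ι → ℂ, (∀ i, σ i = 1 ∨ σ i = -1) ∧
      ‖∑ i ∈ t, σ i • c i‖ ^ 2 ≤ ∑ i ∈ t, ‖c i‖ ^ 2 := by
  classical
  induction t using Finset.induction_on with
  | empty => exact ⟨fun _ => 1, by simp, by simp⟩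
  | insert a t ha ih =>
    obtain ⟨σ, hσ, hle⟩ := ih
    -- The sign of the new vector makes the cross term in the squared norm nonpositive.
    obtain ⟨z, hz, hre⟩ : ∃ z : ℂ, (z = 1 ∨ z = -1) ∧
        (⟪z • c a, ∑ i ∈ t, σ i • c i⟫_ℂ).re ≤ 0 := by
      rcases le_total (⟪c a, ∑ i ∈ t, σ i • c i⟫_ℂ).re 0 with h | h
      · exact ⟨1, .inl rfl, by rwa [one_smul]⟩
      · refine ⟨-1, .inr rfl, ?_⟩
        rw [neg_one_smul, inner_neg_left, Complex.neg_re]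
        linarith
    have hsum : ∑ i ∈ t, Function.update σ a z i • c i = ∑ i ∈ t, σ i • c i :=
      Finset.sum_congr rfl fun i hi => by
        rw [Function.update_of_ne (fun h => ha (by rwa [h] at hi))]
    refine ⟨Function.update σ a z, fun i => ?_, ?_⟩
    · rcases eq_or_ne i a with rfl | h
      · rwa [Function.update_self]
      · rw [Function.update_of_ne h]; exact hσ i
    · rw [Finset.sum_insert ha, Finset.sum_insert ha, hsum, Function.update_self,
        norm_add_sq (𝕜 := ℂ)]
      have hz' : ‖z • c a‖ = ‖c a‖ := by
        rcases hz with rfl | rfl <;> simp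
      rw [hz']
      have : (RCLike.re ⟪z • c a, ∑ i ∈ t, σ i • c i⟫_ℂ : ℝ) ≤ 0 := hre
      linarith

/-- A diffuse von Neumann algebra contains unitaries with arbitrarily small coefficients. -/
theorem IsDiffuse.exists_small_unitary {A : VonNeumannAlgebra H} (hA : A.IsDiffuse)
    (s : Finset H) {ε : ℝ} (hε : 0 < ε) : ∃ u ∈ A, u ∈ unitary (H →L[ℂ] H) ∧
      ∀ ξ ∈ s, ∀ η ∈ s, ‖⟪ξ, u η⟫_ℂ‖ < ε := by
  set m := ∑ ξ ∈ s, ‖ξ‖ ^ 2 with hm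
  have hm0 : 0 ≤ m := by positivity
  obtain ⟨t, ht1, ht2, ht3⟩ := hA.exists_small_partition s
    (show 0 < ε ^ 2 / (2 * (m + 1)) by positivity)
  -- All coefficients of p at once, as one vector. With δ = ε² / (2(m + 1)) the bound on the pieces,
  -- ‖c p‖² ≤ (∑ ‖p ξ‖²)² ≤ δ ∑ ‖p ξ‖², and summing over the partition gives at most δ m < ε². The
  -- symmetry ∑ ±p with the signs of `exists_signs` then has all coefficients below ε.
  let c : (H →L[ℂ] H) → EuclideanSpace ℂ (s × s) := fun p =>
    WithLp.toLp 2 fun x => ⟪(x.1 : H), p x.2⟫_ℂ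
  obtain ⟨σ, hσ, hle⟩ := exists_signs t c
  have hσstar : ∀ p, star (σ p) = σ p := fun p => by rcases hσ p with h | h <;> simp [h]
  have hσσ : ∀ p, σ p * σ p = 1 := fun p => by rcases hσ p with h | h <;> simp [h]
  have hsq : (∑ p ∈ t, σ p • p) * (∑ p ∈ t, σ p • p) = 1 := by
    rw [← ht3, Finset.sum_mul_sum]
    refine Finset.sum_congr rfl fun p hp => ?_
    rw [Finset.sum_eq_single_of_mem p hp fun q hq hqp => by
        rw [smul_mul_smul_comm, ht2 p hp q hq hqp.symm, smul_zero],
      smul_mul_smul_comm, hσσ, one_smul, (ht1 p hp).2.1.isIdempotentElem.eq]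
  have hsa : star (∑ p ∈ t, σ p • p) = ∑ p ∈ t, σ p • p := by
    rw [star_sum]
    exact Finset.sum_congr rfl fun p hp => by
      rw [star_smul, hσstar, (ht1 p hp).2.1.isSelfAdjoint.star_eq]
  refine ⟨∑ p ∈ t, σ p • p, sum_mem fun p hp => smul_mem (ht1 p hp).1 _, ?_, ?_⟩
  · rw [Unitary.mem_iff, hsa]
    exact ⟨hsq, hsq⟩
  · have hbound : ∑ p ∈ t, ‖c p‖ ^ 2 ≤ ε ^ 2 / (2 * (m + 1)) * m := by
      have h1 : ∀ p ∈ t, ‖c p‖ ^ 2 ≤ ε ^ 2 / (2 * (m + 1)) * ∑ ξ ∈ s, ‖p ξ‖ ^ 2 := by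
        intro p hp
        have h2 : ‖c p‖ ^ 2 ≤ (∑ ξ ∈ s, ‖p ξ‖ ^ 2) * ∑ ξ ∈ s, ‖p ξ‖ ^ 2 := by
          rw [EuclideanSpace.norm_sq_eq, Fintype.sum_prod_type, Finset.sum_mul_sum,
            ← Finset.sum_coe_sort s]
          refine Finset.sum_le_sum fun ξ _ => ?_
          rw [← Finset.sum_coe_sort s]
          refine Finset.sum_le_sum fun η _ => ?_
          change ‖⟪(ξ : H), p η⟫_ℂ‖ ^ 2 ≤ _
          rw [inner_starProjection_apply (ht1 p hp).2.1, ← mul_pow]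
          exact pow_le_pow_left₀ (norm_nonneg _) (norm_inner_le_norm _ _) 2
        exact h2.trans (mul_le_mul_of_nonneg_right (ht1 p hp).2.2.le (by positivity))
      refine (Finset.sum_le_sum h1).trans ?_
      rw [← Finset.mul_sum, Finset.sum_comm, hm]
      refine mul_le_mul_of_nonneg_left (Finset.sum_le_sum fun ξ _ => le_of_eq ?_) (by positivity)
      have h3 : ∑ p ∈ t, ‖p ξ‖ ^ 2 = (⟪ξ, (∑ p ∈ t, p) ξ⟫_ℂ).re := by
        rw [sum_apply, inner_sum, Complex.re_sum]
        exact Finset.sum_congr rfl fun p hp => norm_starProjection_sq (ht1 p hp).2.1 ξ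
      rw [h3, ht3, one_apply_eq_self, inner_self_eq_norm_sq_to_K]
      norm_cast
    intro ξ hξ η hη
    have h4 : ‖⟪ξ, (∑ p ∈ t, σ p • p) η⟫_ℂ‖ ≤ ‖∑ p ∈ t, σ p • c p‖ := by
      have h5 := PiLp.norm_apply_le (∑ p ∈ t, σ p • c p) (⟨ξ, hξ⟩, ⟨η, hη⟩)
      refine le_trans (le_of_eq ?_) h5
      congr 1
      simp [c]
    have h6 : ‖∑ p ∈ t, σ p • c p‖ ^ 2 < ε ^ 2 := by
      refine (hle.trans hbound).trans_lt ?_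
      rw [div_mul_eq_mul_div, div_lt_iff₀ (by positivity)]
      nlinarith [sq_pos_of_pos hε]
    exact h4.trans_lt (lt_of_pow_lt_pow_left₀ 2 hε.le h6)

/-! ### The filter of weakly null unitaries and its action on L²M -/

namespace TraceState

variable {M : VonNeumannAlgebra H} {τ : M.TraceState}

theorem mem_weaklyNullUnitaries (M B : VonNeumannAlgebra H) :
    ∀ᶠ u : M.toStarSubalgebra in weaklyNullUnitaries M B, (u : H →L[ℂ] H) ∈ B ∧
      (u : H →L[ℂ] H) ∈ unitary (H →L[ℂ] H) :=
  mem_inf_of_right (mem_principal_self _)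

theorem weaklyNullUnitaries_mono {B N : VonNeumannAlgebra H} (h : B ≤ N) :
    weaklyNullUnitaries M B ≤ weaklyNullUnitaries M N :=
  inf_le_inf_left _ (principal_mono.2 fun _ hu => ⟨h hu.1, hu.2⟩)

theorem norm_le_one_of_mem_unitary {u : H →L[ℂ] H} (hu : u ∈ unitary (H →L[ℂ] H)) : ‖u‖ ≤ 1 := by
  have h := CStarRing.norm_star_mul_self (x := u)
  rw [(Unitary.mem_iff.1 hu).1] at h
  have h1 : ‖(1 : H →L[ℂ] H)‖ ≤ 1 := ContinuousLinearMap.norm_id_le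
  nlinarith [norm_nonneg u]

theorem eventually_norm_le_one (M B : VonNeumannAlgebra H) :
    ∀ᶠ u : M.toStarSubalgebra in weaklyNullUnitaries M B, ‖(u : H →L[ℂ] H)‖ ≤ 1 :=
  (mem_weaklyNullUnitaries M B).mono fun _ hu => norm_le_one_of_mem_unitary hu.2

theorem tendsto_inner_weaklyNullUnitaries (M B : VonNeumannAlgebra H) (ξ η : H) :
    Tendsto (fun u : M.toStarSubalgebra => ⟪ξ, (u : H →L[ℂ] H) η⟫_ℂ)
      (weaklyNullUnitaries M B) (𝓝 0) := by
  have h : Tendsto (fun x : M.toStarSubalgebra =>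
      ContinuousLinearMap.WOTofCLM (x : H →L[ℂ] H)) (weaklyNullUnitaries M B) (𝓝 0) :=
    tendsto_comap.mono_left inf_le_left
  have := ContinuousLinearMapWOT.tendsto_iff_forall_inner_apply_tendsto.1 h η ξ
  rw [ContinuousLinearMapWOT.zero_apply, inner_zero_right] at this
  exact this

/-- A basic weak neighbourhood of 0 involves finitely many vectors and functionals; Riesz turns the
functionals into vectors and `IsDiffuse.exists_small_unitary` applies. This is where diffuseness
enters the exclusion of intertwiners: without it, the limits could be vacuous. -/
theorem weaklyNullUnitaries_neBot {A : VonNeumannAlgebra H} (hAM : A ≤ M) (hA : A.IsDiffuse) :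
    (weaklyNullUnitaries M A).NeBot := by
  classical
  rw [weaklyNullUnitaries, inf_principal_neBot_iff]
  rintro U ⟨V, hV, hVU⟩
  obtain ⟨W, hW, hWV⟩ := ContinuousLinearMapWOT.hasBasis_seminorms.mem_iff.1 hV
  obtain ⟨s, r, hr, rfl⟩ := (SeminormFamily.basisSets_iff _).1 hW
  let R := (InnerProductSpace.toDual ℂ H).symm
  obtain ⟨u, huA, hu, hsmall⟩ := hA.exists_small_unitary
    (s.image Prod.fst ∪ s.image fun x => R x.2) hr
  refine ⟨⟨u, hAM huA⟩, hVU (hWV ?_), huA, hu⟩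
  rw [id, Seminorm.mem_ball, sub_zero]
  refine Seminorm.finset_sup_apply_lt hr fun x hx => ?_
  change ‖x.2 (u x.1)‖ < r
  rw [← InnerProductSpace.toDual_symm_apply (𝕜 := ℂ)]
  exact hsmall _ (Finset.mem_union_right _ (Finset.mem_image_of_mem _ hx)) _
    (Finset.mem_union_left _ (Finset.mem_image_of_mem _ hx))

/-- A family of functions on a metric space that are uniformly Lipschitz and tend to zero on a
dense set tends to zero everywhere. -/
theorem tendsto_zero_of_dense {α E : Type*} [NormedAddCommGroup E] {l : Filter α} {s : Set E}
    (hs : Dense s) {f : α → E → ℂ} {C : ℝ}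
    (hf : ∀ᶠ a in l, ∀ ξ ξ', ‖f a ξ‖ ≤ ‖f a ξ'‖ + C * ‖ξ - ξ'‖)
    (h : ∀ ξ ∈ s, Tendsto (fun a => f a ξ) l (𝓝 0)) (ξ : E) :
    Tendsto (fun a => f a ξ) l (𝓝 0) := by
  rw [Metric.tendsto_nhds]
  intro ε hε
  obtain ⟨ξ', hξ', hd⟩ := hs.exists_dist_lt ξ (show 0 < ε / (2 * (|C| + 1)) by positivity)
  filter_upwards [hf, Metric.tendsto_nhds.1 (h ξ' hξ') (ε / 2) (by positivity)] with a h1 h2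
  rw [dist_zero_right] at h2 ⊢
  rw [dist_eq_norm, lt_div_iff₀ (by positivity)] at hd
  have h3 := h1 ξ ξ'
  have h4 : C * ‖ξ - ξ'‖ ≤ |C| * ‖ξ - ξ'‖ :=
    mul_le_mul_of_nonneg_right (le_abs_self C) (norm_nonneg _)
  nlinarith [norm_nonneg (ξ - ξ')]

/-- Weak convergence to zero of a bounded family of operators can be tested on a dense set. -/
theorem tendsto_inner_zero_of_dense {α E : Type*} [NormedAddCommGroup E] [InnerProductSpace ℂ E]
    {l : Filter α} {s : Set E} (hs : Dense s) {T : α → E →L[ℂ] E} {C : ℝ}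
    (hT : ∀ᶠ a in l, ‖T a‖ ≤ C)
    (h : ∀ ξ ∈ s, ∀ η ∈ s, Tendsto (fun a => ⟪ξ, T a η⟫_ℂ) l (𝓝 0)) (ξ η : E) :
    Tendsto (fun a => ⟪ξ, T a η⟫_ℂ) l (𝓝 0) := by
  refine tendsto_zero_of_dense (C := ‖ξ‖ * C) hs (f := fun a η => ⟪ξ, T a η⟫_ℂ) ?_ ?_ η
  · filter_upwards [hT] with a ha η η'
    have h1 : ⟪ξ, T a η⟫_ℂ = ⟪ξ, T a η'⟫_ℂ + ⟪ξ, T a (η - η')⟫_ℂ := by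
      rw [← inner_add_right, ← map_add, add_sub_cancel]
    rw [h1, mul_assoc]
    refine (norm_add_le _ _).trans (by
      gcongr
      refine (norm_inner_le_norm _ _).trans ?_
      gcongr
      exact (T a).le_of_opNorm_le ha _)
  · intro η hη
    refine tendsto_zero_of_dense (C := C * ‖η‖) hs (f := fun a ξ => ⟪ξ, T a η⟫_ℂ) ?_
      (fun ξ hξ => h ξ hξ η hη) ξ
    filter_upwards [hT] with a ha ξ ξ'
    have h1 : ⟪ξ, T a η⟫_ℂ = ⟪ξ', T a η⟫_ℂ + ⟪ξ - ξ', T a η⟫_ℂ := by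
      rw [← inner_add_left, add_sub_cancel]
    rw [h1, mul_comm (C * ‖η‖)]
    refine (norm_add_le _ _).trans (by
      gcongr
      refine (norm_inner_le_norm _ _).trans ?_
      gcongr
      exact (T a).le_of_opNorm_le ha _)

/-- Weakly null unitaries of `B` act on `L²M` by operators that tend weakly to zero. -/
theorem tendsto_inner_leftMul (B : VonNeumannAlgebra H) (ξ η : τ.L2) :
    Tendsto (fun u => ⟪ξ, τ.leftMul u η⟫_ℂ) (weaklyNullUnitaries M B) (𝓝 0) := by
  have hbound := eventually_norm_le_one M B
  refine tendsto_inner_zero_of_dense τ.denseRange_hat (T := fun u => τ.leftMul u) (C := 1)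
    (hbound.mono fun u hu => (τ.norm_leftMul_le u).trans hu) ?_ ξ η
  rintro _ ⟨x, rfl⟩ _ ⟨y, rfl⟩
  -- The trace property moves y to the other side: ⟪x, u y⟫ = ⟪x y*, u⟫.
  have h := tendsto_inner_hat (τ := τ) (e := id) (e₀ := 0) hbound (fun ξ η => by
    simpa using tendsto_inner_weaklyNullUnitaries M B ξ η) (x * star y)
  rw [hat_zero, inner_zero_right] at h
  refine h.congr fun u => ?_
  rw [id, leftMul_hat, ← rightMul_hat, ← inner_rightMul, rightMul_hat]

end TraceState

end VonNeumannAlgebra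

end

noncomputable section

namespace VonNeumannAlgebra

variable {H : Type u} [NormedAddCommGroup H] [InnerProductSpace ℂ H] [CompleteSpace H]

namespace TraceState

variable {M : VonNeumannAlgebra H} {τ : M.TraceState}

/-! ### Operators on the Hilbert tensor product -/

theorem tensorOp_coe (S T : τ.L2 →L[ℂ] τ.L2) (t : τ.L2 ⊗[ℂ] τ.L2) :
    τ.tensorOp S T (t : τ.L2Tensor) = (TensorProduct.mapL S T t : τ.L2 ⊗[ℂ] τ.L2) := by
  rw [tensorOp, ContinuousLinearMap.completion_apply_coe]

theorem norm_tensorOp_le (S T : τ.L2 →L[ℂ] τ.L2) : ‖τ.tensorOp S T‖ ≤ ‖S‖ * ‖T‖ := by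
  refine ContinuousLinearMap.opNorm_le_bound _ (by positivity) fun ξ => ?_
  induction ξ using UniformSpace.Completion.induction_on with
  | hp => exact isClosed_le (by fun_prop) (by fun_prop)
  | ih t =>
    rw [tensorOp_coe, UniformSpace.Completion.norm_coe, UniformSpace.Completion.norm_coe]
    exact ContinuousLinearMap.le_of_opNorm_le _ (TensorProduct.norm_mapL_le S T) t

/-- If `S a` is bounded and tends weakly to zero and `T a` is bounded, then `S a ⊗ T a` tends
weakly to zero. -/
theorem tendsto_inner_tensorOp {α : Type*} {l : Filter α} {S T : α → τ.L2 →L[ℂ] τ.L2} {C D : ℝ}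
    (hS : ∀ᶠ a in l, ‖S a‖ ≤ C) (hT : ∀ᶠ a in l, ‖T a‖ ≤ D)
    (h : ∀ ξ η, Tendsto (fun a => ⟪ξ, S a η⟫_ℂ) l (𝓝 0)) (ξ η : τ.L2Tensor) :
    Tendsto (fun a => ⟪ξ, τ.tensorOp (S a) (T a) η⟫_ℂ) l (𝓝 0) := by
  refine tendsto_inner_zero_of_dense (UniformSpace.Completion.denseRange_coe (α := τ.L2 ⊗[ℂ] τ.L2))
    (T := fun a => τ.tensorOp (S a) (T a)) (C := C * D) ?_ ?_ ξ η
  · filter_upwards [hS, hT] with a h1 h2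
    exact (norm_tensorOp_le _ _).trans
      (mul_le_mul h1 h2 (norm_nonneg _) ((norm_nonneg _).trans h1))
  rintro _ ⟨s, rfl⟩ _ ⟨t, rfl⟩
  simp only [tensorOp_coe, UniformSpace.Completion.inner_coe]
  induction t using TensorProduct.induction_on with
  | zero => simpa only [map_zero, inner_zero_right] using tendsto_const_nhds
  | add t t' h1 h2 => simpa [inner_add_right] using h1.add h2
  | tmul c d =>
    induction s using TensorProduct.induction_on with
    | zero => simpa only [inner_zero_left] using tendsto_const_nhds
    | add s s' h1 h2 => simpa [inner_add_left] using h1.add h2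
    | tmul a b =>
      simp only [TensorProduct.mapL_tmul, TensorProduct.inner_tmul]
      refine squeeze_zero_norm' (a := fun x => ‖⟪a, S x c⟫_ℂ‖ * (‖b‖ * (D * ‖d‖))) ?_ ?_
      · filter_upwards [hT] with x hx
        rw [norm_mul]
        gcongr
        refine (norm_inner_le_norm _ _).trans ?_
        gcongr
        exact (T x).le_of_opNorm_le hx d
      · simpa using (h a c).norm.mul_const (‖b‖ * (D * ‖d‖))

/-! ### Coarse implies mixing -/

/-- The point is that ‖E_{B₀}(xuy)‖₂² is itself a bimodule coefficient: with e = E_{B₀}(xuy) it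
equals τ(x u y e*) = ⟪x*, u · y · e*⟫. Normality turns it into a sum of coefficients of L_u ⊗
R_{e*}. The second factor varies with u but is bounded by ‖x‖‖y‖, and weak convergence of the first
factor suffices. -/
theorem tendsto_norm_condExp_of_isCoarseBimodule {B B₀ : VonNeumannAlgebra H} (hB₀ : B₀ ≤ M)
    {K : Submodule ℂ τ.L2} [CompleteSpace K] (hK : τ.IsCoarseBimodule B B₀ K)
    {x y : M.toStarSubalgebra} (hx : τ.hat (star x) ∈ K) (hy : τ.hat y ∈ K) :
    Tendsto (fun u => ‖τ.condExp B₀ (x * u * y)‖) (weaklyNullUnitaries M B) (𝓝 0) := by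
  obtain ⟨π, hπ, hgen⟩ := hK
  obtain ⟨ξ, η, hξ, hη, hsum⟩ := hπ ⟨τ.hat (star x), hx⟩ ⟨τ.hat y, hy⟩
  choose e he hnorm heq using fun u => exists_condExp_eq_hat (τ := τ) hB₀ (x * u * y)
  have hbd := eventually_norm_le_one M B
  set C := ‖(x : H →L[ℂ] H)‖ * ‖(y : H →L[ℂ] H)‖
  have hv : ∀ᶠ u : M.toStarSubalgebra in weaklyNullUnitaries M B,
      ‖τ.rightMul (star (e u))‖ ≤ C := by
    filter_upwards [hbd] with u hu
    refine (τ.norm_rightMul_le _).trans ?_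
    calc ‖star (e u : H →L[ℂ] H)‖ ≤ ‖(x : H →L[ℂ] H) * u * y‖ := by
          rw [norm_star]; exact hnorm u
      _ ≤ ‖(x : H →L[ℂ] H)‖ * ‖(u : H →L[ℂ] H)‖ * ‖(y : H →L[ℂ] H)‖ :=
          (norm_mul_le _ _).trans (by gcongr; exact norm_mul_le _ _)
      _ ≤ ‖(x : H →L[ℂ] H)‖ * 1 * ‖(y : H →L[ℂ] H)‖ := by gcongr
      _ = C := by rw [mul_one]
  have hu1 : ∀ᶠ u : M.toStarSubalgebra in weaklyNullUnitaries M B, ‖τ.leftMul u‖ ≤ 1 :=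
    hbd.mono fun u hu => (τ.norm_leftMul_le u).trans hu
  have hlim : Tendsto (fun u => ∑' n, ⟪ξ n, τ.tensorGen u (star (e u)) (η n)⟫_ℂ)
      (weaklyNullUnitaries M B) (𝓝 0) := by
    have := tendsto_tsum_inner (T := fun u => τ.tensorGen u (star (e u))) (T₀ := 0)
      (C := 1 * C) (l := weaklyNullUnitaries M B) ?_ ?_ hξ hη
    · simpa using this
    · filter_upwards [hu1, hv] with u h1 h2
      exact (norm_tensorOp_le _ _).trans
        (mul_le_mul h1 h2 (norm_nonneg _) ((norm_nonneg _).trans h1))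
    · intro ξ η
      simpa [tensorGen] using tendsto_inner_tensorOp hu1 hv (tendsto_inner_leftMul B) ξ η
  have hsq : Tendsto (fun u => ‖τ.condExp B₀ (x * u * y)‖ ^ 2) (weaklyNullUnitaries M B)
      (𝓝 0) := by
    rw [tendsto_zero_iff_norm_tendsto_zero] at hlim
    refine hlim.congr' ?_
    filter_upwards [mem_weaklyNullUnitaries M B] with u hu
    have h1 := hsum ⟨τ.tensorGen u (star (e u)),
      τ.tensorGen_mem B B₀ u _ hu.1 (star_mem (he u))⟩
    rw [h1.tsum_eq]
    dsimp only
    rw [Submodule.coe_inner, hgen _ _ hu.1 (star_mem (he u)), rightMul_hat,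
      leftMul_hat, inner_hat, star_star]
    have h2 : ⟪τ.condExp B₀ (x * u * y), τ.condExp B₀ (x * u * y)⟫_ℂ =
        τ.toFun (x * (u * (y * star (e u)))) := by
      rw [inner_condExp _ (condExp_mem B₀ _), heq, inner_hat, τ.tracial]
      simp only [mul_assoc]
    rw [← h2, inner_self_eq_norm_sq_to_K]
    simp
  simpa using hsq.sqrt

theorem IsCoarse.isMixing {B : VonNeumannAlgebra H} (hB : B ≤ M) (h : τ.IsCoarse B) :
    τ.IsMixing B := by
  refine ⟨h.1, fun x y hx hy => tendsto_norm_condExp_of_isCoarseBimodule hB h.2 ?_ ?_⟩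
  · exact (Submodule.starProjection_apply_eq_zero_iff _).1 (condExp_star_eq_zero hx)
  · exact (Submodule.starProjection_apply_eq_zero_iff _).1 hy

theorem IsCoarsePair.isMixingPair {B B₀ : VonNeumannAlgebra H} (hB₀ : B₀ ≤ M)
    (h : τ.IsCoarsePair B B₀) : τ.IsMixingPair B B₀ :=
  ⟨h.1, fun _ _ => tendsto_norm_condExp_of_isCoarseBimodule hB₀ h.2.2 trivial trivial⟩

/-! ### Subalgebras -/

section restrict

variable {N : VonNeumannAlgebra H} (hN : N ≤ M)

/-- The inclusion of a von Neumann subalgebra, on elements. -/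
def incl (n : N.toStarSubalgebra) : M.toStarSubalgebra := ⟨n, hN n.2⟩

/-- The isometric inclusion of `L²N` in `L²M`. -/
def inclL2 : (τ.restrict hN).L2 →L[ℂ] τ.L2 :=
  ((τ.toPre.toLinearMap ∘ₗ (StarSubalgebra.inclusion (S₁ := N.toStarSubalgebra)
    (S₂ := M.toStarSubalgebra) hN).toLinearMap ∘ₗ
      (τ.restrict hN).toPre.symm.toLinearMap).mkContinuous 1 fun x => by
        rw [one_mul]
        refine le_of_eq ?_
        rw [← sq_eq_sq₀ (by positivity) (by positivity), ← Complex.ofReal_inj]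
        exact (τ.norm_pre_sq _).trans
          ((τ.restrict hN).norm_pre_sq ((τ.restrict hN).toPre.symm x)).symm).completion

theorem inclL2_hat (n : N.toStarSubalgebra) :
    inclL2 (τ := τ) hN ((τ.restrict hN).hat n) = τ.hat (incl hN n) := by
  simp only [inclL2, hat, ContinuousLinearMap.completion_apply_coe]
  rfl

theorem inner_inclL2 (ξ η : (τ.restrict hN).L2) :
    ⟪inclL2 hN ξ, inclL2 hN η⟫_ℂ = ⟪ξ, η⟫_ℂ := by
  revert η
  refine eq_of_forall_hat (by fun_prop) (by fun_prop) fun y => ?_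
  revert ξ
  refine eq_of_forall_hat (by fun_prop) (by fun_prop) fun x => ?_
  rw [inclL2_hat, inclL2_hat, inner_hat, inner_hat]
  rfl

theorem norm_inclL2 (ξ : (τ.restrict hN).L2) : ‖inclL2 hN ξ‖ = ‖ξ‖ := by
  rw [@norm_eq_sqrt_re_inner ℂ, inner_inclL2, ← @norm_eq_sqrt_re_inner ℂ]

theorem adjoint_inclL2_inclL2 (ξ : (τ.restrict hN).L2) :
    ContinuousLinearMap.adjoint (inclL2 hN) (inclL2 hN ξ) = ξ :=
  ext_inner_left ℂ fun η => by rw [ContinuousLinearMap.adjoint_inner_right, inner_inclL2]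

theorem inclL2_leftMul (n : N.toStarSubalgebra) (ξ : (τ.restrict hN).L2) :
    inclL2 hN ((τ.restrict hN).leftMul n ξ) = τ.leftMul (incl hN n) (inclL2 hN ξ) := by
  revert ξ
  refine eq_of_forall_hat (by fun_prop) (by fun_prop) fun y => ?_
  rw [leftMul_hat, inclL2_hat, inclL2_hat, leftMul_hat]
  rfl

theorem inclL2_rightMul (n : N.toStarSubalgebra) (ξ : (τ.restrict hN).L2) :
    inclL2 hN ((τ.restrict hN).rightMul n ξ) = τ.rightMul (incl hN n) (inclL2 hN ξ) := by
  revert ξ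
  refine eq_of_forall_hat (by fun_prop) (by fun_prop) fun y => ?_
  rw [rightMul_hat, inclL2_hat, inclL2_hat, rightMul_hat]
  rfl

theorem isClosed_map_inclL2 (K : Submodule ℂ (τ.restrict hN).L2) [CompleteSpace K] :
    IsClosed (K.map (inclL2 (τ := τ) hN).toLinearMap : Set τ.L2) := by
  have : IsComplete (K.map (inclL2 (τ := τ) hN).toLinearMap : Set τ.L2) := by
    rw [Submodule.map_coe]
    have hi : IsUniformInducing (inclL2 (τ := τ) hN) :=
      ((AddMonoidHomClass.isometry_iff_norm (inclL2 (τ := τ) hN)).2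
        (norm_inclL2 hN)).isUniformInducing
    exact hi.isComplete_iff.2 (completeSpace_coe_iff_isComplete.1 ‹CompleteSpace K›)
  exact this.isClosed

/-- The inclusion maps closed spans to closed spans. -/
theorem map_inclL2_closedSpan (S : Set N.toStarSubalgebra) :
    ((τ.restrict hN).closedSpan S).map (inclL2 (τ := τ) hN).toLinearMap =
      τ.closedSpan (incl hN '' S) := by
  refine le_antisymm ?_ (closedSpan_le (isClosed_map_inclL2 hN _) ?_)
  · rw [Submodule.map_le_iff_le_comap]
    refine closedSpan_le ((isClosed_closedSpan _).preimage (inclL2 (τ := τ) hN).continuous) ?_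
    intro x hx
    change inclL2 hN _ ∈ τ.closedSpan _
    rw [inclL2_hat]
    exact hat_mem_closedSpan ⟨x, hx, rfl⟩
  · rintro _ ⟨x, hx, rfl⟩
    exact ⟨_, hat_mem_closedSpan hx, inclL2_hat hN x⟩

theorem map_inclL2_L2Sub {B : VonNeumannAlgebra H} (hB : B ≤ N) :
    ((τ.restrict hN).L2Sub B).map (inclL2 (τ := τ) hN).toLinearMap = τ.L2Sub B := by
  rw [L2Sub, map_inclL2_closedSpan, L2Sub]
  congr 1
  ext x
  constructor
  · rintro ⟨b, hb, rfl⟩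
    exact hb
  · intro hx
    exact ⟨⟨x, hB hx⟩, hx, rfl⟩

theorem inclL2_mem_L2Sub {B : VonNeumannAlgebra H} (hB : B ≤ N) (ξ : (τ.restrict hN).L2) :
    inclL2 hN ξ ∈ τ.L2Sub B ↔ ξ ∈ (τ.restrict hN).L2Sub B := by
  rw [← map_inclL2_L2Sub hN hB]
  constructor
  · rintro ⟨η, hη, h⟩
    have : η = ξ := by
      rw [← adjoint_inclL2_inclL2 hN ξ, ← h]
      exact (adjoint_inclL2_inclL2 hN η).symm
    rwa [← this]
  · exact fun h => ⟨ξ, h, rfl⟩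

/-- Allows the mixing of B in N, a statement about the trace restricted to N, to be read inside L²M.
-/
theorem norm_condExp_restrict {B : VonNeumannAlgebra H} (hB : B ≤ N) (n : N.toStarSubalgebra) :
    ‖(τ.restrict hN).condExp B n‖ = ‖τ.condExp B (incl hN n)‖ := by
  rw [← norm_inclL2 hN]
  congr 1
  refine (Submodule.eq_starProjection_of_mem_orthogonal
    ((inclL2_mem_L2Sub hN hB _).2 (condExp_mem B n)) ?_).symm
  refine mem_orthogonal_closedSpan fun b hb => ?_
  have h1 : τ.hat b = inclL2 hN ((τ.restrict hN).hat ⟨b, hB hb⟩) :=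
    (inclL2_hat hN ⟨b, hB hb⟩).symm
  rw [inner_sub_right, h1, inner_inclL2, ← inclL2_hat, inner_inclL2,
    inner_condExp n ((τ.restrict hN).hat_mem_L2Sub B ⟨b, hB hb⟩ hb), sub_self]

/-- Every element of `M` is the sum of an element of `N` and an element of `M ⊖ N`. -/
theorem exists_sub_condExp_eq_zero (x : M.toStarSubalgebra) :
    ∃ n : N.toStarSubalgebra, τ.condExp N (x - incl hN n) = 0 := by
  obtain ⟨e, he, -, h⟩ := exists_condExp_eq_hat (τ := τ) hN x
  refine ⟨⟨e, he⟩, ?_⟩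
  rw [condExp_sub, h, sub_eq_zero]
  exact (condExp_of_mem he).symm

theorem condExp_eq_zero_of_le {B : VonNeumannAlgebra H} (hB : B ≤ N) {x : M.toStarSubalgebra}
    (h : τ.condExp N x = 0) : τ.condExp B x = 0 := by
  rw [condExp_eq_zero_iff] at h ⊢
  exact fun b hb => h b (hB hb)

theorem norm_condExp_le_of_le {B : VonNeumannAlgebra H} (hB : B ≤ N) (x : M.toStarSubalgebra) :
    ‖τ.condExp B x‖ ≤ ‖τ.condExp N x‖ := by
  have : τ.condExp B x = (τ.L2Sub B).starProjection (τ.condExp N x) := by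
    refine (Submodule.eq_starProjection_of_mem_orthogonal (condExp_mem B x) ?_).symm
    refine mem_orthogonal_closedSpan fun b hb => ?_
    rw [inner_sub_right, inner_condExp x (τ.hat_mem_L2Sub N b (hB hb)),
      inner_condExp x (τ.hat_mem_L2Sub B b hb), sub_self]
  rw [this]
  exact Submodule.norm_starProjection_apply_le _ _

/-- The unitaries of B lie in N and the weak topology is that of B(H) in both cases, so limits along
the filter on N transfer to M. -/
theorem weaklyNullUnitaries_le_map {B : VonNeumannAlgebra H} (hB : B ≤ N) :
    weaklyNullUnitaries M B ≤ map (incl hN) (weaklyNullUnitaries N B) := by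
  intro U hU
  rw [mem_map, weaklyNullUnitaries, mem_inf_principal, mem_comap] at hU
  obtain ⟨V, hV, hVU⟩ := hU
  rw [weaklyNullUnitaries, mem_inf_principal, mem_comap]
  exact ⟨V, hV, fun u hu hu' => hVU (a := ⟨u, hB hu'.1⟩) hu hu'⟩

/-- Write x and y as a part in N plus a part in M ⊖ N. The product of the two parts orthogonal to N
is controlled by mixing of N in M, since E_B factors through E_N; the product of the two parts in N
by mixing of B in N, these parts being in N ⊖ B. -/
theorem IsMixing.trans {B : VonNeumannAlgebra H} (hB : B ≤ N)
    (h₁ : (τ.restrict hN).IsMixing B) (h₂ : τ.IsMixing N) : τ.IsMixing B := by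
  refine ⟨h₁.1, fun x y hx hy => ?_⟩
  obtain ⟨n, hn⟩ := exists_sub_condExp_eq_zero (τ := τ) hN x
  obtain ⟨m, hm⟩ := exists_sub_condExp_eq_zero (τ := τ) hN y
  have key : ∀ {z : M.toStarSubalgebra} {k : N.toStarSubalgebra}, τ.condExp B z = 0 →
      τ.condExp N (z - incl hN k) = 0 → (τ.restrict hN).condExp B k = 0 := by
    intro z k hz hk
    rw [← norm_eq_zero, norm_condExp_restrict hN hB, norm_eq_zero]
    have := condExp_eq_zero_of_le hB hk
    rwa [condExp_sub, hz, zero_sub, neg_eq_zero] at this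
  have t1 : Tendsto (fun u => ‖τ.condExp N ((x - incl hN n) * u * (y - incl hN m))‖)
      (weaklyNullUnitaries M B) (𝓝 0) :=
    (h₂.2 _ _ hn hm).mono_left (weaklyNullUnitaries_mono hB)
  have t2 : Tendsto (fun u => ‖τ.condExp B (incl hN n * u * incl hN m)‖)
      (weaklyNullUnitaries M B) (𝓝 0) := by
    refine Tendsto.mono_left ?_ (weaklyNullUnitaries_le_map hN hB)
    rw [tendsto_map'_iff]
    refine (h₁.2 n m (key hx hn) (key hy hm)).congr fun u => ?_
    exact norm_condExp_restrict hN hB _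
  refine squeeze_zero' (.of_forall fun _ => norm_nonneg _) ?_ (by simpa using t1.add t2)
  filter_upwards [mem_weaklyNullUnitaries M B] with u hu
  have huN := hB hu.1
  -- The two mixed terms vanish exactly: u lies in N, so each is an element of M ⊖ N times an
  -- element of N, and E_N, hence E_B, kills it.
  have hsplit : x * u * y = (x - incl hN n) * u * (y - incl hN m) + (x - incl hN n) *
      (u * incl hN m) + (incl hN n * u) * (y - incl hN m) + incl hN n * u * incl hN m := by
    noncomm_ring
  have z1 : τ.condExp B ((x - incl hN n) * (u * incl hN m)) = 0 :=
    condExp_eq_zero_of_le hB (condExp_mul_right_eq_zero hn (mul_mem huN m.2))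
  have z2 : τ.condExp B ((incl hN n * u) * (y - incl hN m)) = 0 :=
    condExp_eq_zero_of_le hB (condExp_mul_left_eq_zero hm (mul_mem n.2 huN))
  rw [hsplit, condExp_add, condExp_add, condExp_add, z1, z2, add_zero, add_zero]
  exact (norm_add_le _ _).trans (by gcongr; exact norm_condExp_le_of_le hB _)

end restrict

end TraceState

end VonNeumannAlgebra

end

noncomputable section

namespace VonNeumannAlgebra

open ContinuousLinearMap (adjoint adjoint_inner_left adjoint_inner_right)

section Hilbert

variable {E F K K₁ K₂ : Type u}
  [NormedAddCommGroup E] [InnerProductSpace ℂ E] [CompleteSpace E]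
  [NormedAddCommGroup F] [InnerProductSpace ℂ F] [CompleteSpace F]
  [NormedAddCommGroup K] [InnerProductSpace ℂ K] [CompleteSpace K]
  [NormedAddCommGroup K₁] [InnerProductSpace ℂ K₁] [CompleteSpace K₁]
  [NormedAddCommGroup K₂] [InnerProductSpace ℂ K₂] [CompleteSpace K₂]

/-! ### Generated von Neumann algebras -/

/-- The commutant of a `*`-closed set is `*`-closed, so the second half of the star-centralizer
condition is redundant. -/
theorem mem_generatedBy_iff {S : Set (E →L[ℂ] E)} {T : E →L[ℂ] E} :
    T ∈ (generatedBy S).toStarSubalgebra ↔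
      ∀ c ∈ Set.centralizer (S ∪ star S), c * T = T * c := by
  refine (StarSubalgebra.mem_centralizer_iff ℂ).trans ⟨fun h c hc => (h c hc).1, fun h c hc => ?_⟩
  refine ⟨h c hc, h (star c) ?_⟩
  have : star (Set.centralizer (S ∪ star S)) = Set.centralizer (S ∪ star S) := by
    rw [Set.star_centralizer, Set.union_star, star_star, Set.union_comm]
  rw [← this]
  exact Set.star_mem_star.2 hc

theorem generatedBy_mono {S S' : Set (E →L[ℂ] E)} (h : S ⊆ S') :
    generatedBy S ≤ generatedBy S' := fun T hT =>
  mem_generatedBy_iff.2 fun c hc => (mem_generatedBy_iff (T := T)).1 hT c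
    (Set.centralizer_subset (Set.union_subset_union h (Set.star_subset_star.2 h)) hc)

theorem IsNormalFunctional.add {M : VonNeumannAlgebra E} {φ ψ : M.toStarSubalgebra → ℂ}
    (hφ : M.IsNormalFunctional φ) (hψ : M.IsNormalFunctional ψ) :
    M.IsNormalFunctional fun x => φ x + ψ x := by
  obtain ⟨ξ, η, h1, h2, h3⟩ := hφ
  obtain ⟨ξ', η', h1', h2', h3'⟩ := hψ
  let e : ℕ ⊕ ℕ ≃ ℕ := Equiv.natSumNatEquivNat
  have hs : ∀ {f g : ℕ → E}, (Summable fun n => ‖f n‖ ^ 2) → (Summable fun n => ‖g n‖ ^ 2) →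
      Summable fun n => ‖Sum.elim f g (e.symm n)‖ ^ 2 := by
    intro f g hf hg
    refine (e.symm.summable_iff (f := fun x => ‖Sum.elim f g x‖ ^ 2)).2 ?_
    exact Summable.sum _ hf hg
  refine ⟨fun n => Sum.elim ξ ξ' (e.symm n), fun n => Sum.elim η η' (e.symm n), hs h1 h1',
    hs h2 h2', fun x => ?_⟩
  refine (e.symm.hasSum_iff
    (f := fun k => ⟪Sum.elim ξ ξ' k, (x : E →L[ℂ] E) (Sum.elim η η' k)⟫_ℂ)).2 ?_
  exact HasSum.sum (h3 x) (h3' x)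

/-! ### Compression by an isometry -/

section compress

variable {S : Set (E →L[ℂ] E)} {S' : Set (F →L[ℂ] F)} {W : F →L[ℂ] E}

/-- W intertwines the generators in both directions, so W c W* commutes with the generators upstairs
whenever c commutes with those downstairs, and therefore with the whole bicommutant. -/
theorem commute_of_generatedBy
    (hS : ∀ g ∈ S ∪ star S, ∃ g' ∈ S' ∪ star S', g ∘L W = W ∘L g' ∧
      adjoint W ∘L g = g' ∘L adjoint W) {T : E →L[ℂ] E} (hT : T ∈ (generatedBy S).toStarSubalgebra)
    {c : F →L[ℂ] F} (hc : c ∈ Set.centralizer (S' ∪ star S')) :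
    (W ∘L c ∘L adjoint W) * T = T * (W ∘L c ∘L adjoint W) := by
  refine mem_generatedBy_iff.1 hT _ fun g hg => ?_
  obtain ⟨g', hg', h1, h2⟩ := hS g hg
  have h3 : g' ∘L c = c ∘L g' := hc g' hg'
  calc g ∘L (W ∘L c ∘L adjoint W) = (g ∘L W) ∘L c ∘L adjoint W := rfl
    _ = W ∘L (g' ∘L c) ∘L adjoint W := by rw [h1]; rfl
    _ = W ∘L c ∘L (g' ∘L adjoint W) := by rw [h3]; rfl
    _ = (W ∘L c ∘L adjoint W) ∘L g := by rw [← h2]; rfl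

/-- Compression by an isometry that intertwines the generators is a `*`-homomorphism between the
generated von Neumann algebras. -/
def compressHom (hW : adjoint W ∘L W = 1)
    (hS : ∀ g ∈ S ∪ star S, ∃ g' ∈ S' ∪ star S', g ∘L W = W ∘L g' ∧
      adjoint W ∘L g = g' ∘L adjoint W) :
    (generatedBy S).toStarSubalgebra →⋆ₐ[ℂ] (generatedBy S').toStarSubalgebra where
  toFun T := ⟨adjoint W ∘L (T : E →L[ℂ] E) ∘L W, mem_generatedBy_iff.2 fun c hc => by
    have h := commute_of_generatedBy hS T.2 hc
    calc c ∘L (adjoint W ∘L (T : E →L[ℂ] E) ∘L W)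
        = (adjoint W ∘L W) ∘L c ∘L (adjoint W ∘L (T : E →L[ℂ] E) ∘L W) := by rw [hW]; rfl
      _ = adjoint W ∘L ((W ∘L c ∘L adjoint W) * (T : E →L[ℂ] E)) ∘L W := rfl
      _ = adjoint W ∘L (T : E →L[ℂ] E) ∘L W ∘L c ∘L (adjoint W ∘L W) := by rw [h]; rfl
      _ = (adjoint W ∘L (T : E →L[ℂ] E) ∘L W) ∘L c := by rw [hW]; rfl⟩
  map_one' := Subtype.ext hW
  map_mul' T T' := Subtype.ext (by
    -- For c = 1 this says that the range projection W W* commutes with the algebra, which makes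
    -- compression multiplicative.
    have h := commute_of_generatedBy hS T.2 (c := 1) (fun g _ => (mul_one g).trans (one_mul g).symm)
    calc adjoint W ∘L ((T : E →L[ℂ] E) * (T' : E →L[ℂ] E)) ∘L W
        = (adjoint W ∘L W) ∘L adjoint W ∘L ((T : E →L[ℂ] E) ∘L (T' : E →L[ℂ] E)) ∘L W := by
          rw [hW]; rfl
      _ = adjoint W ∘L ((W ∘L 1 ∘L adjoint W) * (T : E →L[ℂ] E)) ∘L (T' : E →L[ℂ] E) ∘L W := rfl
      _ = _ := by rw [h]; rfl)
  map_zero' := Subtype.ext (by ext; simp)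
  map_add' T T' := Subtype.ext (by ext; simp)
  commutes' r := Subtype.ext (by
    change adjoint W ∘L (algebraMap ℂ (E →L[ℂ] E) r) ∘L W = algebraMap ℂ (F →L[ℂ] F) r
    rw [Algebra.algebraMap_eq_smul_one, Algebra.algebraMap_eq_smul_one, ← hW]
    ext; simp)
  map_star' T := Subtype.ext (by
    change adjoint W ∘L adjoint (T : E →L[ℂ] E) ∘L W = adjoint (adjoint W ∘L (T : E →L[ℂ] E) ∘L W)
    rw [ContinuousLinearMap.adjoint_comp, ContinuousLinearMap.adjoint_comp,
      ContinuousLinearMap.adjoint_adjoint]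
    rfl)

theorem compressHom_coe (hW : adjoint W ∘L W = 1)
    (hS : ∀ g ∈ S ∪ star S, ∃ g' ∈ S' ∪ star S', g ∘L W = W ∘L g' ∧
      adjoint W ∘L g = g' ∘L adjoint W) (T : (generatedBy S).toStarSubalgebra) :
    (compressHom hW hS T : F →L[ℂ] F) = adjoint W ∘L (T : E →L[ℂ] E) ∘L W := rfl

/-- A vector functional ⟪α, W* x W β⟫ is ⟪Wα, x Wβ⟫, and W preserves square summability. -/
theorem IsNormalRep.comp_compressHom (hW : adjoint W ∘L W = 1)
    (hS : ∀ g ∈ S ∪ star S, ∃ g' ∈ S' ∪ star S', g ∘L W = W ∘L g' ∧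
      adjoint W ∘L g = g' ∘L adjoint W) {π : (generatedBy S').toStarSubalgebra →⋆ₐ[ℂ] (K →L[ℂ] K)}
    (hπ : (generatedBy S').IsNormalRep π) :
    (generatedBy S).IsNormalRep (π.comp (compressHom hW hS)) := by
  intro ξ η
  obtain ⟨α, β, h1, h2, h3⟩ := hπ ξ η
  have hn : ∀ v, ‖W v‖ = ‖v‖ := W.norm_map_iff_adjoint_comp_self.2 hW
  refine ⟨fun n => W (α n), fun n => W (β n), by simpa only [hn] using h1,
    by simpa only [hn] using h2, fun x => ?_⟩
  have := h3 (compressHom hW hS x)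
  rw [compressHom_coe] at this
  simp only [ContinuousLinearMap.comp_apply, adjoint_inner_right] at this
  exact this

end compress

/-! ### Restriction and direct sums of representations -/

theorem IsNormalRep.comp_inclusion {A A' : VonNeumannAlgebra E} (h : A ≤ A')
    {π : A'.toStarSubalgebra →⋆ₐ[ℂ] (K →L[ℂ] K)} (hπ : A'.IsNormalRep π) :
    A.IsNormalRep (π.comp (StarSubalgebra.inclusion (S₁ := A.toStarSubalgebra)
      (S₂ := A'.toStarSubalgebra) h)) := by
  intro ξ η
  obtain ⟨α, β, h1, h2, h3⟩ := hπ ξ η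
  exact ⟨α, β, h1, h2, fun x => h3 _⟩

/-- The direct sum of two representations, on a Hilbert space that is decomposed by two
isometries. -/
def directSumRep {A : VonNeumannAlgebra E} (J₁ : K₁ →L[ℂ] K) (J₂ : K₂ →L[ℂ] K)
    (h₁ : adjoint J₁ ∘L J₁ = 1) (h₂ : adjoint J₂ ∘L J₂ = 1) (h₁₂ : adjoint J₁ ∘L J₂ = 0)
    (hsum : J₁ ∘L adjoint J₁ + J₂ ∘L adjoint J₂ = 1)
    (π₁ : A.toStarSubalgebra →⋆ₐ[ℂ] (K₁ →L[ℂ] K₁)) (π₂ : A.toStarSubalgebra →⋆ₐ[ℂ] (K₂ →L[ℂ] K₂)) :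
    A.toStarSubalgebra →⋆ₐ[ℂ] (K →L[ℂ] K) where
  toFun x := J₁ ∘L π₁ x ∘L adjoint J₁ + J₂ ∘L π₂ x ∘L adjoint J₂
  map_one' := by
    rw [map_one, map_one]
    exact hsum
  map_mul' x y := by
    have h₂₁ : adjoint J₂ ∘L J₁ = 0 := by
      have := congrArg adjoint h₁₂
      rwa [ContinuousLinearMap.adjoint_comp, ContinuousLinearMap.adjoint_adjoint, map_zero] at this
    have a1 : ∀ v, adjoint J₁ (J₁ v) = v := fun v => congrArg (fun T : K₁ →L[ℂ] K₁ => T v) h₁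
    have a2 : ∀ v, adjoint J₂ (J₂ v) = v := fun v => congrArg (fun T : K₂ →L[ℂ] K₂ => T v) h₂
    have a3 : ∀ v, adjoint J₁ (J₂ v) = 0 := fun v => congrArg (fun T : K₂ →L[ℂ] K₁ => T v) h₁₂
    have a4 : ∀ v, adjoint J₂ (J₁ v) = 0 := fun v => congrArg (fun T : K₁ →L[ℂ] K₂ => T v) h₂₁
    ext v
    simp [a1, a2, a3, a4]
  map_zero' := by ext; simp
  map_add' x y := by
    ext
    simp only [map_add, ContinuousLinearMap.comp_apply, add_apply]
    abel
  commutes' r := by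
    rw [Algebra.algebraMap_eq_smul_one, Algebra.algebraMap_eq_smul_one, map_smul, map_smul, map_one,
      map_one, ← hsum]
    ext; simp
  map_star' x := by
    rw [map_star, map_star, ContinuousLinearMap.star_eq_adjoint,
      ContinuousLinearMap.star_eq_adjoint,
      ContinuousLinearMap.star_eq_adjoint, map_add]
    simp only [ContinuousLinearMap.adjoint_comp, ContinuousLinearMap.adjoint_adjoint]
    rfl

theorem comp_adjoint_add_comp_adjoint {J₁ : K₁ →L[ℂ] K} {J₂ : K₂ →L[ℂ] K}
    (h₁ : adjoint J₁ ∘L J₁ = 1) (h₂ : adjoint J₂ ∘L J₂ = 1) (h₁₂ : adjoint J₁ ∘L J₂ = 0)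
    (h : ∀ ξ, ∃ a b, ξ = J₁ a + J₂ b) : J₁ ∘L adjoint J₁ + J₂ ∘L adjoint J₂ = 1 := by
  have h₂₁ : adjoint J₂ ∘L J₁ = 0 := by
    have := congrArg adjoint h₁₂
    rwa [ContinuousLinearMap.adjoint_comp, ContinuousLinearMap.adjoint_adjoint, map_zero] at this
  have a1 : ∀ v, adjoint J₁ (J₁ v) = v := fun v => DFunLike.congr_fun h₁ v
  have a2 : ∀ v, adjoint J₂ (J₂ v) = v := fun v => DFunLike.congr_fun h₂ v
  have a3 : ∀ v, adjoint J₁ (J₂ v) = 0 := fun v => DFunLike.congr_fun h₁₂ v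
  have a4 : ∀ v, adjoint J₂ (J₁ v) = 0 := fun v => DFunLike.congr_fun h₂₁ v
  refine ContinuousLinearMap.ext fun ξ => ?_
  obtain ⟨a, b, rfl⟩ := h ξ
  simp [a1, a2, a3, a4]

theorem directSumRep_apply {A : VonNeumannAlgebra E} {J₁ : K₁ →L[ℂ] K} {J₂ : K₂ →L[ℂ] K}
    (h₁ : adjoint J₁ ∘L J₁ = 1) (h₂ : adjoint J₂ ∘L J₂ = 1) (h₁₂ : adjoint J₁ ∘L J₂ = 0)
    (hsum : J₁ ∘L adjoint J₁ + J₂ ∘L adjoint J₂ = 1)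
    (π₁ : A.toStarSubalgebra →⋆ₐ[ℂ] (K₁ →L[ℂ] K₁)) (π₂ : A.toStarSubalgebra →⋆ₐ[ℂ] (K₂ →L[ℂ] K₂))
    (x : A.toStarSubalgebra) (ξ : K) :
    directSumRep J₁ J₂ h₁ h₂ h₁₂ hsum π₁ π₂ x ξ =
      J₁ (π₁ x (adjoint J₁ ξ)) + J₂ (π₂ x (adjoint J₂ ξ)) := rfl

theorem isNormalRep_directSumRep {A : VonNeumannAlgebra E} {J₁ : K₁ →L[ℂ] K} {J₂ : K₂ →L[ℂ] K}
    (h₁ : adjoint J₁ ∘L J₁ = 1) (h₂ : adjoint J₂ ∘L J₂ = 1) (h₁₂ : adjoint J₁ ∘L J₂ = 0)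
    (hsum : J₁ ∘L adjoint J₁ + J₂ ∘L adjoint J₂ = 1)
    {π₁ : A.toStarSubalgebra →⋆ₐ[ℂ] (K₁ →L[ℂ] K₁)} {π₂ : A.toStarSubalgebra →⋆ₐ[ℂ] (K₂ →L[ℂ] K₂)}
    (hπ₁ : A.IsNormalRep π₁) (hπ₂ : A.IsNormalRep π₂) :
    A.IsNormalRep (directSumRep J₁ J₂ h₁ h₂ h₁₂ hsum π₁ π₂) := by
  intro ξ η
  have : (fun x => ⟪ξ, directSumRep J₁ J₂ h₁ h₂ h₁₂ hsum π₁ π₂ x η⟫_ℂ) =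
      fun x => ⟪adjoint J₁ ξ, π₁ x (adjoint J₁ η)⟫_ℂ + ⟪adjoint J₂ ξ, π₂ x (adjoint J₂ η)⟫_ℂ := by
    funext x
    rw [adjoint_inner_left, adjoint_inner_left, ← inner_add_right]
    rfl
  rw [this]
  exact (hπ₁ _ _).add (hπ₂ _ _)

end Hilbert

variable {H : Type u} [NormedAddCommGroup H] [InnerProductSpace ℂ H] [CompleteSpace H]

namespace TraceState

variable {M : VonNeumannAlgebra H} {τ : M.TraceState}

/-! ### Transitivity of coarseness -/

theorem continuous_inner_completion_ext {E : Type u} [NormedAddCommGroup E] [InnerProductSpace ℂ E]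
    {S T : UniformSpace.Completion E →L[ℂ] UniformSpace.Completion E}
    (h : ∀ s t : E, ⟪(s : UniformSpace.Completion E), S t⟫_ℂ =
      ⟪T (s : UniformSpace.Completion E), (t : UniformSpace.Completion E)⟫_ℂ) :
    star S = T := by
  rw [ContinuousLinearMap.star_eq_adjoint, eq_comm, ContinuousLinearMap.eq_adjoint_iff]
  intro x y
  induction x, y using UniformSpace.Completion.induction_on₂ with
  | hp => exact isClosed_eq (by fun_prop) (by fun_prop)
  | ih s t => exact (h s t).symm

theorem star_tensorGen (b b₀ : M.toStarSubalgebra) :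
    star (τ.tensorGen b b₀) = τ.tensorGen (star b) (star b₀) := by
  refine continuous_inner_completion_ext fun s t => ?_
  simp only [tensorGen, tensorOp_coe, UniformSpace.Completion.inner_coe]
  induction t using TensorProduct.induction_on with
  | zero => simp only [map_zero, inner_zero_right]
  | add t t' h1 h2 => simp only [map_add, inner_add_right, h1, h2]
  | tmul c d =>
    induction s using TensorProduct.induction_on with
    | zero => simp only [map_zero, inner_zero_left]
    | add s s' h1 h2 => simp only [map_add, inner_add_left, h1, h2]
    | tmul a b =>
      simp only [TensorProduct.mapL_tmul, TensorProduct.inner_tmul, inner_leftMul, inner_rightMul]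

variable {N : VonNeumannAlgebra H} (hN : N ≤ M)

/-- The isometric inclusion of `L²N ⊗̄ L²N` in `L²M ⊗̄ L²M`. -/
def inclTensor : (τ.restrict hN).L2Tensor →L[ℂ] τ.L2Tensor :=
  (TensorProduct.mapL (inclL2 (τ := τ) hN) (inclL2 (τ := τ) hN)).completion

theorem inclTensor_coe (t : (τ.restrict hN).L2 ⊗[ℂ] (τ.restrict hN).L2) :
    inclTensor (τ := τ) hN (t : (τ.restrict hN).L2Tensor) =
      (TensorProduct.mapL (inclL2 (τ := τ) hN) (inclL2 (τ := τ) hN) t : τ.L2 ⊗[ℂ] τ.L2) := by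
  rw [inclTensor, ContinuousLinearMap.completion_apply_coe]

theorem adjoint_inclTensor_comp :
    adjoint (inclTensor (τ := τ) hN) ∘L inclTensor (τ := τ) hN = 1 := by
  rw [← ContinuousLinearMap.norm_map_iff_adjoint_comp_self]
  intro ξ
  induction ξ using UniformSpace.Completion.induction_on with
  | hp => exact isClosed_eq (by fun_prop) (by fun_prop)
  | ih t =>
    let ι : (τ.restrict hN).L2 →ₗᵢ[ℂ] τ.L2 := ⟨(inclL2 hN).toLinearMap, norm_inclL2 hN⟩
    rw [inclTensor_coe, UniformSpace.Completion.norm_coe, UniformSpace.Completion.norm_coe]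
    rw [TensorProduct.mapL_apply]
    exact TensorProduct.norm_map ι ι t

theorem tensorGen_comp_inclTensor (b b₀ : N.toStarSubalgebra) :
    τ.tensorGen (incl hN b) (incl hN b₀) ∘L inclTensor hN =
      inclTensor hN ∘L (τ.restrict hN).tensorGen b b₀ := by
  refine ContinuousLinearMap.ext fun ξ => ?_
  induction ξ using UniformSpace.Completion.induction_on with
  | hp => exact isClosed_eq (by fun_prop) (by fun_prop)
  | ih t =>
    simp only [ContinuousLinearMap.comp_apply, inclTensor_coe, tensorGen, tensorOp_coe]
    congr 1
    induction t using TensorProduct.induction_on with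
    | zero => simp only [map_zero]
    | add t t' h1 h2 => simp only [map_add, h1, h2]
    | tmul c d => simp only [TensorProduct.mapL_tmul, inclL2_leftMul, inclL2_rightMul]

theorem adjoint_inclTensor_comp_tensorGen (b b₀ : N.toStarSubalgebra) :
    adjoint (inclTensor hN) ∘L τ.tensorGen (incl hN b) (incl hN b₀) =
      (τ.restrict hN).tensorGen b b₀ ∘L adjoint (inclTensor hN) := by
  have h := congrArg adjoint (tensorGen_comp_inclTensor (τ := τ) hN (star b) (star b₀))
  rw [ContinuousLinearMap.adjoint_comp, ContinuousLinearMap.adjoint_comp,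
    ← ContinuousLinearMap.star_eq_adjoint, ← ContinuousLinearMap.star_eq_adjoint,
    star_tensorGen, star_tensorGen, star_star, star_star] at h
  rw [← h]
  congr 2
  · exact (star_star (incl hN b)).symm
  · exact (star_star (incl hN b₀)).symm

theorem exists_intertwined_generator {B : VonNeumannAlgebra H} (hB : B ≤ N)
    {S : Set (τ.L2Tensor →L[ℂ] τ.L2Tensor)}
    (hS : S = {T | ∃ b b₀ : M.toStarSubalgebra, (b : H →L[ℂ] H) ∈ B ∧ (b₀ : H →L[ℂ] H) ∈ B ∧
      T = τ.tensorGen b b₀})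
    {S' : Set ((τ.restrict hN).L2Tensor →L[ℂ] (τ.restrict hN).L2Tensor)}
    (hS' : S' = {T | ∃ b b₀ : N.toStarSubalgebra, (b : H →L[ℂ] H) ∈ B ∧ (b₀ : H →L[ℂ] H) ∈ B ∧
      T = (τ.restrict hN).tensorGen b b₀}) :
    ∀ g ∈ S ∪ star S, ∃ g' ∈ S' ∪ star S', g ∘L inclTensor hN = inclTensor hN ∘L g' ∧
      adjoint (inclTensor hN) ∘L g = g' ∘L adjoint (inclTensor hN) := by
  subst hS hS'
  have key : ∀ g, (∃ b b₀ : M.toStarSubalgebra, (b : H →L[ℂ] H) ∈ B ∧ (b₀ : H →L[ℂ] H) ∈ B ∧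
      g = τ.tensorGen b b₀) → ∃ g', (∃ b b₀ : N.toStarSubalgebra, (b : H →L[ℂ] H) ∈ B ∧
        (b₀ : H →L[ℂ] H) ∈ B ∧ g' = (τ.restrict hN).tensorGen b b₀) ∧
      g ∘L inclTensor hN = inclTensor hN ∘L g' ∧
      adjoint (inclTensor hN) ∘L g = g' ∘L adjoint (inclTensor hN) := by
    rintro _ ⟨b, b₀, hb, hb₀, rfl⟩
    exact ⟨_, ⟨⟨b, hB hb⟩, ⟨b₀, hB hb₀⟩, hb, hb₀, rfl⟩,
      tensorGen_comp_inclTensor hN ⟨b, hB hb⟩ ⟨b₀, hB hb₀⟩,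
      adjoint_inclTensor_comp_tensorGen hN ⟨b, hB hb⟩ ⟨b₀, hB hb₀⟩⟩
  rintro g (hg | hg)
  · obtain ⟨g', h1, h2⟩ := key g hg
    exact ⟨g', .inl h1, h2⟩
  · obtain ⟨b, b₀, hb, hb₀, h⟩ := hg
    -- The adjoint of b ⊗ b₀ᵒᵖ is b* ⊗ (b₀*)ᵒᵖ, so the generating set is already `*`-closed.
    obtain ⟨g', h1, h2⟩ := key g ⟨star b, star b₀, star_mem hb, star_mem hb₀, by
      rw [← star_tensorGen, ← h, star_star]⟩
    exact ⟨g', .inl h1, h2⟩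

/-- The restriction of `B ⊗̄ Bᵒᵖ` from `L²M ⊗̄ L²M` to `L²N ⊗̄ L²N`. -/
def restrictTensor {B : VonNeumannAlgebra H} (hB : B ≤ N) :
    (τ.tensorOpposite B B).toStarSubalgebra →⋆ₐ[ℂ]
      ((τ.restrict hN).tensorOpposite B B).toStarSubalgebra :=
  compressHom (adjoint_inclTensor_comp hN) (exists_intertwined_generator (τ := τ) hN hB rfl rfl)

theorem IsNormalRep.comp_restrictTensor {B : VonNeumannAlgebra H} (hB : B ≤ N) {K : Type u}
    [NormedAddCommGroup K] [InnerProductSpace ℂ K] [CompleteSpace K]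
    {π : ((τ.restrict hN).tensorOpposite B B).toStarSubalgebra →⋆ₐ[ℂ] (K →L[ℂ] K)}
    (hπ : ((τ.restrict hN).tensorOpposite B B).IsNormalRep π) :
    (τ.tensorOpposite B B).IsNormalRep (π.comp (restrictTensor hN hB)) :=
  hπ.comp_compressHom _ _

theorem restrictTensor_tensorGen {B : VonNeumannAlgebra H} (hB : B ≤ N) (b b₀ : M.toStarSubalgebra)
    (hb : (b : H →L[ℂ] H) ∈ B) (hb₀ : (b₀ : H →L[ℂ] H) ∈ B) :
    restrictTensor hN hB ⟨τ.tensorGen b b₀, τ.tensorGen_mem B B b b₀ hb hb₀⟩ =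
      ⟨(τ.restrict hN).tensorGen ⟨b, hB hb⟩ ⟨b₀, hB hb₀⟩,
        (τ.restrict hN).tensorGen_mem B B ⟨b, hB hb⟩ ⟨b₀, hB hb₀⟩ hb hb₀⟩ := by
  have h : adjoint (inclTensor hN) ∘L τ.tensorGen b b₀ ∘L inclTensor hN =
      (τ.restrict hN).tensorGen ⟨b, hB hb⟩ ⟨b₀, hB hb₀⟩ := by
    have h1 : τ.tensorGen b b₀ ∘L inclTensor hN = _ :=
      tensorGen_comp_inclTensor (τ := τ) hN ⟨b, hB hb⟩ ⟨b₀, hB hb₀⟩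
    rw [h1, ← ContinuousLinearMap.comp_assoc, adjoint_inclTensor_comp]
    exact one_mul _
  exact Subtype.ext h

theorem tensorOpposite_mono {B N : VonNeumannAlgebra H} (h : B ≤ N) :
    τ.tensorOpposite B B ≤ τ.tensorOpposite N N :=
  generatedBy_mono (by rintro _ ⟨b, b₀, hb, hb₀, rfl⟩; exact ⟨b, b₀, h hb, h hb₀, rfl⟩)

theorem L2Sub_self : τ.L2Sub M = ⊤ := by
  refine eq_top_iff.2 fun ξ _ => ?_
  have : ξ ∈ closure (Set.range τ.hat) := τ.denseRange_hat ξ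
  refine closure_minimal ?_ (isClosed_L2Sub M) this
  rintro _ ⟨x, rfl⟩
  exact τ.hat_mem_L2Sub M x x.2

theorem orthogonal_L2Sub_le {B N : VonNeumannAlgebra H} (h : B ≤ N) :
    (τ.L2Sub N)ᗮ ≤ (τ.L2Sub B)ᗮ := Submodule.orthogonal_le (L2Sub_mono h)

theorem inclL2_mem_orthogonal {B : VonNeumannAlgebra H} (hB : B ≤ N) (ξ : (τ.restrict hN).L2) :
    inclL2 hN ξ ∈ (τ.L2Sub B)ᗮ ↔ ξ ∈ ((τ.restrict hN).L2Sub B)ᗮ := by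
  rw [← map_inclL2_L2Sub hN hB, Submodule.mem_orthogonal, Submodule.mem_orthogonal]
  constructor
  · intro h η hη
    rw [← inner_inclL2 hN]
    exact h _ ⟨η, hη, rfl⟩
  · rintro h _ ⟨η, hη, rfl⟩
    exact (inner_inclL2 hN η ξ).trans (h η hη)

theorem IsCoarseBimodule.mono {B N : VonNeumannAlgebra H} (h : B ≤ N) {K : Submodule ℂ τ.L2}
    [CompleteSpace K] (hK : τ.IsCoarseBimodule N N K) : τ.IsCoarseBimodule B B K := by
  obtain ⟨π, hπ, hgen⟩ := hK
  refine ⟨π.comp (StarSubalgebra.inclusion (S₁ := (τ.tensorOpposite B B).toStarSubalgebra)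
    (S₂ := (τ.tensorOpposite N N).toStarSubalgebra) (tensorOpposite_mono h)),
    hπ.comp_inclusion (tensorOpposite_mono h), fun b b₀ hb hb₀ ξ => ?_⟩
  rw [← hgen b b₀ (h hb) (h hb₀) ξ, StarAlgHom.comp_apply]
  rfl

/-- The algebra B ⊗̄ Bᵒᵖ is realized on L²N ⊗̄ L²N for the restricted trace and on L²M ⊗̄ L²M for τ.
Composition with the compression from the latter to the former puts the representation on the
algebra needed for M. -/
theorem IsCoarseBimodule.exists_rep {B : VonNeumannAlgebra H} (hB : B ≤ N)
    {K : Submodule ℂ (τ.restrict hN).L2} [CompleteSpace K]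
    (hK : (τ.restrict hN).IsCoarseBimodule B B K) :
    ∃ π : (τ.tensorOpposite B B).toStarSubalgebra →⋆ₐ[ℂ] (K →L[ℂ] K),
      (τ.tensorOpposite B B).IsNormalRep π ∧
      ∀ (b b₀ : M.toStarSubalgebra) (hb : (b : H →L[ℂ] H) ∈ B) (hb₀ : (b₀ : H →L[ℂ] H) ∈ B)
        (ξ : K), inclL2 hN (π ⟨τ.tensorGen b b₀, τ.tensorGen_mem B B b b₀ hb hb₀⟩ ξ :
          (τ.restrict hN).L2) = τ.leftMul b (τ.rightMul b₀ (inclL2 hN ξ)) := by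
  obtain ⟨π, hπ, hgen⟩ := hK
  refine ⟨π.comp (restrictTensor hN hB), IsNormalRep.comp_restrictTensor hN hB hπ,
    fun b b₀ hb hb₀ ξ => ?_⟩
  rw [StarAlgHom.comp_apply, restrictTensor_tensorGen hN hB b b₀ hb hb₀,
    hgen ⟨b, hB hb⟩ ⟨b₀, hB hb₀⟩ hb hb₀, inclL2_leftMul, inclL2_rightMul]
  rfl

theorem inclL2_mem (ξ : (τ.restrict hN).L2) : inclL2 hN ξ ∈ τ.L2Sub N :=
  (inclL2_mem_L2Sub hN le_rfl ξ).2 (by rw [L2Sub_self]; exact Submodule.mem_top)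

/-- `L²M ⊖ L²B` is the direct sum of `L²M ⊖ L²N` and `L²N ⊖ L²B`. -/
theorem exists_add_inclL2 {B : VonNeumannAlgebra H} (hB : B ≤ N) {ξ : τ.L2}
    (hξ : ξ ∈ (τ.L2Sub B)ᗮ) : ∃ α ∈ (τ.L2Sub N)ᗮ, ∃ β ∈ ((τ.restrict hN).L2Sub B)ᗮ,
      ξ = α + inclL2 hN β := by
  obtain ⟨ζ, hζ, hζe⟩ : (τ.L2Sub N).starProjection ξ ∈
      ((τ.restrict hN).L2Sub N).map (inclL2 (τ := τ) hN).toLinearMap := by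
    rw [map_inclL2_L2Sub hN le_rfl]
    exact Submodule.starProjection_apply_mem _ _
  have hperp : ξ - (τ.L2Sub N).starProjection ξ ∈ (τ.L2Sub N)ᗮ :=
    Submodule.sub_starProjection_mem_orthogonal _
  have hζe' : inclL2 hN ζ = (τ.L2Sub N).starProjection ξ := hζe
  refine ⟨_, hperp, ζ, ?_, by rw [hζe', sub_add_cancel]⟩
  rw [← inclL2_mem_orthogonal hN hB, hζe']
  have := sub_mem hξ (orthogonal_L2Sub_le hB hperp)
  rwa [sub_sub_cancel] at this

/-- L²M ⊖ L²B is decomposed by two isometries: J₁ from L²M ⊖ L²N, where the representation for N is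
restricted to B, and J₂ from L²N ⊖ L²B, where that of B in N is carried over. Their direct sum is
normal and acts correctly on the generators. -/
theorem IsCoarse.trans {B : VonNeumannAlgebra H} (hB : B ≤ N)
    (h₁ : (τ.restrict hN).IsCoarse B) (h₂ : τ.IsCoarse N) : τ.IsCoarse B := by
  refine ⟨h₁.1, ?_⟩
  obtain ⟨ρ₂, hρ₂, e2⟩ := IsCoarseBimodule.exists_rep hN hB h₁.2
  obtain ⟨ρ₁, hρ₁, e1⟩ := h₂.2.mono hB
  clear h₁ h₂
  obtain ⟨J₁, hJ₁⟩ : ∃ J₁ : (τ.L2Sub N)ᗮ →L[ℂ] (τ.L2Sub B)ᗮ, ∀ ξ, (J₁ ξ : τ.L2) = ξ :=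
    ⟨((τ.L2Sub N)ᗮ.subtypeL).codRestrict _ fun ξ => orthogonal_L2Sub_le hB ξ.2,
      fun ξ => ContinuousLinearMap.coe_codRestrict_apply _ _ _ ξ⟩
  obtain ⟨J₂, hJ₂⟩ : ∃ J₂ : ((τ.restrict hN).L2Sub B)ᗮ →L[ℂ] (τ.L2Sub B)ᗮ,
      ∀ ξ, (J₂ ξ : τ.L2) = inclL2 hN ξ :=
    ⟨(inclL2 hN ∘L ((τ.restrict hN).L2Sub B)ᗮ.subtypeL).codRestrict _ fun ξ =>
      (inclL2_mem_orthogonal hN hB _).2 ξ.2,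
      fun ξ => ContinuousLinearMap.coe_codRestrict_apply _ _ _ ξ⟩
  have h₁ : adjoint J₁ ∘L J₁ = 1 := J₁.norm_map_iff_adjoint_comp_self.1 fun ξ => by
    rw [Submodule.coe_norm, hJ₁, Submodule.coe_norm]
  have h₂ : adjoint J₂ ∘L J₂ = 1 := J₂.norm_map_iff_adjoint_comp_self.1 fun ξ => by
    rw [Submodule.coe_norm, hJ₂, norm_inclL2, Submodule.coe_norm]
  have h₁₂ : adjoint J₁ ∘L J₂ = 0 := by
    refine ContinuousLinearMap.ext fun ξ => ext_inner_left ℂ fun η => ?_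
    rw [ContinuousLinearMap.comp_apply, adjoint_inner_right, zero_apply, inner_zero_right,
      Submodule.coe_inner, hJ₁, hJ₂]
    exact (Submodule.mem_orthogonal' _ _).1 η.2 _ (inclL2_mem (τ := τ) hN ξ)
  have hsum : J₁ ∘L adjoint J₁ + J₂ ∘L adjoint J₂ = 1 := by
    refine comp_adjoint_add_comp_adjoint h₁ h₂ h₁₂ fun ξ => ?_
    obtain ⟨α, hα, β, hβ, h⟩ := exists_add_inclL2 hN hB ξ.2
    exact ⟨⟨α, hα⟩, ⟨β, hβ⟩, Subtype.ext (by rw [Submodule.coe_add, hJ₁, hJ₂, h])⟩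
  refine ⟨directSumRep J₁ J₂ h₁ h₂ h₁₂ hsum ρ₁ ρ₂,
    isNormalRep_directSumRep h₁ h₂ h₁₂ hsum hρ₁ hρ₂, fun b b₀ hb hb₀ ξ => ?_⟩
  have hξ : (ξ : τ.L2) = (adjoint J₁ ξ : τ.L2) + inclL2 hN (adjoint J₂ ξ) := by
    rw [← hJ₁, ← hJ₂, ← Submodule.coe_add, ← ContinuousLinearMap.comp_apply,
      ← ContinuousLinearMap.comp_apply, ← add_apply, hsum, one_apply_eq_self]
  rw [directSumRep_apply, Submodule.coe_add, hJ₁, hJ₂, e1 b b₀ hb hb₀, e2 b b₀ hb hb₀, ← map_add,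
    ← map_add, ← hξ]

end TraceState

end VonNeumannAlgebra

end

noncomputable section

namespace VonNeumannAlgebra

variable {H : Type u} [NormedAddCommGroup H] [InnerProductSpace ℂ H] [CompleteSpace H]

namespace TraceState

variable {M : VonNeumannAlgebra H} {τ : M.TraceState}

open ContinuousLinearMap (adjoint adjoint_inner_left adjoint_inner_right)

/-! ### Right modules of finite dimension -/

theorem closure_hat (P : VonNeumannAlgebra H) :
    closure (τ.hat '' {b | (b : H →L[ℂ] H) ∈ P}) = (τ.L2Sub P : Set τ.L2) := by
  let S : Submodule ℂ M.toStarSubalgebra :=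
    { carrier := {b | (b : H →L[ℂ] H) ∈ P}
      add_mem' := fun ha hb => add_mem (S := VonNeumannAlgebra H) ha hb
      zero_mem' := zero_mem P
      smul_mem' := fun c _ ha => smul_mem ha c }
  have h : Submodule.span ℂ (τ.hat '' {b | (b : H →L[ℂ] H) ∈ P}) = S.map τ.hatLinear := by
    have : (τ.hat '' {b | (b : H →L[ℂ] H) ∈ P}) = (S.map τ.hatLinear : Set τ.L2) := rfl
    rw [this, Submodule.span_eq]
  rw [L2Sub, closedSpan, h, Submodule.topologicalClosure_coe]
  rfl

theorem norm_le_of_forall_inner {E : Type*} [NormedAddCommGroup E] [InnerProductSpace ℂ E]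
    {ξ : E} {C : ℝ} (h : ‖⟪ξ, ξ⟫_ℂ‖ ≤ C * ‖ξ‖) (hC : 0 ≤ C) : ‖ξ‖ ≤ C := by
  rcases eq_or_ne ξ 0 with rfl | h0
  · simpa
  · rw [inner_self_eq_norm_sq_to_K, norm_pow, RCLike.norm_ofReal, abs_norm, sq] at h
    exact le_of_mul_le_mul_right h (norm_pos_iff.2 h0)

theorem norm_le_of_mem_L2Sub {P : VonNeumannAlgebra H} {ξ : τ.L2} (hξ : ξ ∈ τ.L2Sub P) {C : ℝ}
    (hC : 0 ≤ C) (h : ∀ b : M.toStarSubalgebra, (b : H →L[ℂ] H) ∈ P →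
      ‖⟪τ.hat b, ξ⟫_ℂ‖ ≤ C * ‖τ.hat b‖) : ‖ξ‖ ≤ C := by
  have hcl : IsClosed {η : τ.L2 | ‖⟪η, ξ⟫_ℂ‖ ≤ C * ‖η‖} :=
    isClosed_le (by fun_prop) (by fun_prop)
  refine norm_le_of_forall_inner ?_ hC
  have h1 : closure (τ.hat '' {b | (b : H →L[ℂ] H) ∈ P}) ⊆ {η : τ.L2 | ‖⟪η, ξ⟫_ℂ‖ ≤ C * ‖η‖} :=
    closure_minimal (by rintro _ ⟨b, hb, rfl⟩; exact h b hb) hcl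
  exact h1 (by rw [closure_hat]; exact hξ)

theorem inner_adjoint_single {E F : Type*} [NormedAddCommGroup E] [InnerProductSpace ℂ E]
    [CompleteSpace E] [NormedAddCommGroup F] [InnerProductSpace ℂ F] [CompleteSpace F] {ι : Type*}
    [DecidableEq ι] (V : E →L[ℂ] lp (fun _ : ι => F) 2) (i : ι) (a : F) (η : E) :
    ⟪adjoint V (lp.single 2 i a), η⟫_ℂ = ⟪a, V η i⟫_ℂ := by
  rw [adjoint_inner_left, lp.inner_single_left]

theorem norm_le_of_inner_eq {E F : Type*} [NormedAddCommGroup E] [InnerProductSpace ℂ E]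
    [NormedAddCommGroup F] [InnerProductSpace ℂ F] {ξ : E} {ζ η : F} (h : ⟪ξ, ξ⟫_ℂ = ⟪ζ, η⟫_ℂ)
    (hη : ‖η‖ ≤ ‖ξ‖) : ‖ξ‖ ≤ ‖ζ‖ := by
  refine norm_le_of_forall_inner ?_ (norm_nonneg _)
  rw [h]
  exact (norm_inner_le_norm _ _).trans (by gcongr)

/-- The operator `R` is right `P`-linear with values in `L²P`. -/
structure IsRightMap (τ : M.TraceState) (P : VonNeumannAlgebra H) (R : τ.L2 →L[ℂ] τ.L2) : Prop where
  mem : ∀ ξ, R ξ ∈ τ.L2Sub P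
  comm : ∀ p : M.toStarSubalgebra, (p : H →L[ℂ] H) ∈ P → ∀ ξ,
    R (τ.rightMul p ξ) = τ.rightMul p (R ξ)

namespace IsRightMap

variable {P : VonNeumannAlgebra H} {R : τ.L2 →L[ℂ] τ.L2}

theorem adjoint_comm (hR : τ.IsRightMap P R) {p : M.toStarSubalgebra} (hp : (p : H →L[ℂ] H) ∈ P)
    (ξ : τ.L2) : adjoint R (τ.rightMul p ξ) = τ.rightMul p (adjoint R ξ) := by
  refine ext_inner_right ℂ fun η => ?_
  rw [adjoint_inner_left]
  have h1 := inner_rightMul (τ := τ) (star p) ξ (R η)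
  have h2 := inner_rightMul (τ := τ) (star p) (adjoint R ξ) η
  rw [star_star] at h1 h2
  rw [← h1, ← h2, ← hR.comm _ (star_mem hp), adjoint_inner_left]

theorem adjoint_hat (hR : τ.IsRightMap P R) {b : M.toStarSubalgebra} (hb : (b : H →L[ℂ] H) ∈ P) :
    adjoint R (τ.hat b) = τ.rightMul b (adjoint R (τ.hat 1)) := by
  rw [← hR.adjoint_comm hb, rightMul_hat, one_mul]

/-- A right P-linear map is determined by the vector ζ = R* 1̂: tested against P, R(ŷ) behaves like
E_P(ζ* y), even though ζ need not come from M. -/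
theorem inner_hat_apply (hR : τ.IsRightMap P R) {b : M.toStarSubalgebra}
    (hb : (b : H →L[ℂ] H) ∈ P) (y : M.toStarSubalgebra) :
    ⟪τ.hat b, R (τ.hat y)⟫_ℂ = ⟪adjoint R (τ.hat 1), τ.hat (y * star b)⟫_ℂ := by
  rw [← adjoint_inner_left, hR.adjoint_hat hb]
  have h2 := inner_rightMul (τ := τ) (star b) (adjoint R (τ.hat 1)) (τ.hat y)
  rw [star_star] at h2
  rw [← h2, rightMul_hat]

theorem norm_apply_hat_le (hR : τ.IsRightMap P R) (y : M.toStarSubalgebra) :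
    ‖R (τ.hat y)‖ ≤ ‖(y : H →L[ℂ] H)‖ * ‖adjoint R (τ.hat 1)‖ := by
  refine norm_le_of_mem_L2Sub (hR.mem _) (by positivity) fun b hb => ?_
  rw [hR.inner_hat_apply hb]
  refine (norm_inner_le_norm _ _).trans ?_
  have := norm_hat_mul_le (τ := τ) y (star b)
  rw [norm_hat_star] at this
  calc _ ≤ ‖adjoint R (τ.hat 1)‖ * (‖(y : H →L[ℂ] H)‖ * ‖τ.hat b‖) := by gcongr
    _ = _ := by ring

/-- If R* 1̂ were ẑ, then R(ŷ) would be E_P(z* y). The second term is the price for replacing R* 1̂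
by ẑ, and involves the operator norm of y only. -/
theorem norm_apply_hat_le_add (hR : τ.IsRightMap P R) (y z : M.toStarSubalgebra) :
    ‖R (τ.hat y)‖ ≤ ‖τ.condExp P (star z * y)‖ +
      ‖adjoint R (τ.hat 1) - τ.hat z‖ * ‖(y : H →L[ℂ] H)‖ := by
  refine norm_le_of_mem_L2Sub (hR.mem _) (by positivity) fun b hb => ?_
  rw [hR.inner_hat_apply hb]
  have h1 : ⟪adjoint R (τ.hat 1), τ.hat (y * star b)⟫_ℂ =
      ⟪τ.hat b, τ.condExp P (star z * y)⟫_ℂ +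
        ⟪adjoint R (τ.hat 1) - τ.hat z, τ.hat (y * star b)⟫_ℂ := by
    rw [inner_condExp _ (τ.hat_mem_L2Sub P b hb), inner_sub_left, inner_hat, inner_hat,
      ← mul_assoc (star z), τ.tracial (star z * y) (star b)]
    ring
  have := norm_hat_mul_le (τ := τ) y (star b)
  rw [norm_hat_star] at this
  rw [h1]
  refine (norm_add_le _ _).trans ?_
  calc _ ≤ ‖τ.hat b‖ * ‖τ.condExp P (star z * y)‖ +
        ‖adjoint R (τ.hat 1) - τ.hat z‖ * ‖τ.hat (y * star b)‖ := by
        gcongr <;> exact norm_inner_le_norm _ _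
    _ ≤ ‖τ.hat b‖ * ‖τ.condExp P (star z * y)‖ +
        ‖adjoint R (τ.hat 1) - τ.hat z‖ * (‖(y : H →L[ℂ] H)‖ * ‖τ.hat b‖) := by gcongr
    _ = _ := by ring

/-- Approximate R* 1̂ by some ẑ; the error is uniform in u because ‖uy‖ ≤ ‖y‖. -/
theorem tendsto_norm (hR : τ.IsRightMap P R) {A : VonNeumannAlgebra H} {y : M.toStarSubalgebra}
    (hy : ∀ z : M.toStarSubalgebra, Tendsto (fun u => ‖τ.condExp P (z * u * y)‖)
      (weaklyNullUnitaries M A) (𝓝 0)) :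
    Tendsto (fun u => ‖R (τ.hat (u * y))‖) (weaklyNullUnitaries M A) (𝓝 0) := by
  rw [Metric.tendsto_nhds]
  intro ε hε
  obtain ⟨z, hz⟩ : ∃ z, ‖adjoint R (τ.hat 1) - τ.hat z‖ * (‖(y : H →L[ℂ] H)‖ + 1) < ε / 2 := by
    obtain ⟨z, hz⟩ := Metric.denseRange_iff.1 (denseRange_hat τ) (adjoint R (τ.hat 1))
      (ε / 2 / (‖(y : H →L[ℂ] H)‖ + 1)) (by positivity)
    rw [dist_eq_norm] at hz
    exact ⟨z, (lt_div_iff₀ (by positivity)).1 hz⟩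
  filter_upwards [(hy (star z)).eventually_lt_const (show (0 : ℝ) < ε / 2 by positivity),
    eventually_norm_le_one M A] with u hu hu1
  rw [Real.dist_eq, sub_zero, abs_norm]
  refine (hR.norm_apply_hat_le_add _ z).trans_lt ?_
  have h2 : ‖((u * y : M.toStarSubalgebra) : H →L[ℂ] H)‖ ≤ ‖(y : H →L[ℂ] H)‖ + 1 :=
    calc _ ≤ ‖(u : H →L[ℂ] H)‖ * ‖(y : H →L[ℂ] H)‖ := norm_mul_le _ _
      _ ≤ 1 * ‖(y : H →L[ℂ] H)‖ := by gcongr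
      _ ≤ _ := by linarith
  have h3 := mul_le_mul_of_nonneg_left h2 (norm_nonneg (adjoint R (τ.hat 1) - τ.hat z))
  rw [← mul_assoc]
  linarith

end IsRightMap

/-- A frame of the right `P`-module `K`: the coordinates of a right `P`-linear partial isometry,
with initial space `K`, from `L²M` to a multiple of `L²P`. -/
structure IsRightFrame (τ : M.TraceState) (P : VonNeumannAlgebra H) (K : Submodule ℂ τ.L2)
    {ι : Type u} (R : ι → τ.L2 →L[ℂ] τ.L2) : Prop where
  isRightMap : ∀ i, τ.IsRightMap P (R i)
  hasSum_inner : ∀ ξ ∈ K, ∀ η, HasSum (fun i => ⟪R i ξ, R i η⟫_ℂ) ⟪ξ, η⟫_ℂ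

theorem starProjection_rightMul {P : VonNeumannAlgebra H} {K : Submodule ℂ τ.L2} [CompleteSpace K]
    (hK : ∀ p : M.toStarSubalgebra, (p : H →L[ℂ] H) ∈ P → ∀ ξ ∈ K, τ.rightMul p ξ ∈ K)
    {p : M.toStarSubalgebra} (hp : (p : H →L[ℂ] H) ∈ P) (ξ : τ.L2) :
    K.starProjection (τ.rightMul p ξ) = τ.rightMul p (K.starProjection ξ) := by
  refine Submodule.eq_starProjection_of_mem_orthogonal
    (hK p hp _ (Submodule.starProjection_apply_mem _ _)) ?_
  rw [Submodule.mem_orthogonal]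
  intro v hv
  rw [← map_sub, inner_rightMul]
  exact (Submodule.mem_orthogonal _ _).1 (Submodule.sub_starProjection_mem_orthogonal ξ) _
    (hK _ (star_mem hp) _ hv)

/-- The operators R_i are the coordinates of an isometry V of finite value in the definition of the
dimension, preceded by the projection on K. They are defined on all of L²M, and R_i* 1̂ has norm at
most that of V*(δ_i ⊗ 1̂). -/
theorem exists_isRightFrame {P : VonNeumannAlgebra H} {K : Submodule ℂ τ.L2} [CompleteSpace K]
    (hK : ∀ p : M.toStarSubalgebra, (p : H →L[ℂ] H) ∈ P → ∀ ξ ∈ K, τ.rightMul p ξ ∈ K)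
    (h : τ.rightDim P K < ⊤) : ∃ (ι : Type u) (R : ι → τ.L2 →L[ℂ] τ.L2),
      τ.IsRightFrame P K R ∧ Summable fun i => ‖adjoint (R i) (τ.hat 1)‖ ^ 2 := by
  classical
  rw [rightDim, sInf_lt_iff] at h
  obtain ⟨_, ⟨ι, V, hV, rfl⟩, hd⟩ := h
  let c : ∀ i : ι, lp (fun _ : ι => τ.L2Sub P) 2 →L[ℂ] τ.L2Sub P := fun i =>
    lp.evalCLM ℂ (fun _ : ι => τ.L2Sub P) 2 i
  let R : ι → τ.L2 →L[ℂ] τ.L2 := fun i =>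
    (τ.L2Sub P).subtypeL ∘L c i ∘L V.toContinuousLinearMap ∘L K.orthogonalProjectionOnto
  have hRapp : ∀ i ξ, R i ξ = (V (K.orthogonalProjectionOnto ξ) i : τ.L2) := fun i ξ => rfl
  refine ⟨ι, R, ⟨fun i => ⟨fun ξ => ?_, fun p hp ξ => ?_⟩, fun ξ hξ η => ?_⟩, ?_⟩
  · rw [hRapp]; exact Subtype.mem _
  · rw [hRapp, hRapp]
    refine hV p hp _ _ ?_ i
    have := starProjection_rightMul hK hp ξ
    rw [Submodule.starProjection_apply, Submodule.starProjection_apply] at this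
    exact this
  · have h1 := lp.hasSum_inner (𝕜 := ℂ) (V (K.orthogonalProjectionOnto ξ))
      (V (K.orthogonalProjectionOnto η))
    rw [V.inner_map_map] at h1
    have h2 : ⟪K.orthogonalProjectionOnto ξ, K.orthogonalProjectionOnto η⟫_ℂ = ⟪ξ, η⟫_ℂ := by
      rw [Submodule.coe_inner, ← Submodule.starProjection_apply, ← Submodule.starProjection_apply,
        ← Submodule.inner_starProjection_left_eq_right,
        Submodule.starProjection_eq_self_iff.2 hξ, Submodule.starProjection_eq_self_iff.2 hξ]
    rw [h2] at h1
    exact h1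
  · have h1 : ∀ i, ‖adjoint (R i) (τ.hat 1)‖ ≤ ‖adjoint V.toContinuousLinearMap
        (lp.single 2 i ⟨τ.hat 1, τ.hat_mem_L2Sub P 1 (one_mem P)⟩)‖ := fun i => by
      have h2 := inner_adjoint_single V.toContinuousLinearMap i
        (⟨τ.hat 1, τ.hat_mem_L2Sub P 1 (one_mem P)⟩ : τ.L2Sub P)
        (K.orthogonalProjectionOnto (adjoint (R i) (τ.hat 1)))
      have h3 := adjoint_inner_left (R i) (adjoint (R i) (τ.hat 1)) (τ.hat 1)
      exact norm_le_of_inner_eq (h3.trans h2.symm) (K.norm_orthogonalProjectionOnto_apply_le _)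
    have h2 := ENNReal.summable_toReal hd.ne
    refine Summable.of_nonneg_of_le (fun _ => by positivity) (fun i => ?_) h2
    rw [ENNReal.toReal_pow, toReal_enorm]
    convert pow_le_pow_left₀ (norm_nonneg _) (h1 i) 2

/-- Converse of `exists_isRightFrame`: coordinates satisfying Parseval's identity on K assemble to
an isometry, whose value bounds the infimum. -/
theorem rightDim_lt_top {P : VonNeumannAlgebra H} {K : Submodule ℂ τ.L2} [CompleteSpace K]
    {ι : Type u} {R : ι → τ.L2 →L[ℂ] τ.L2} (hR : ∀ i, τ.IsRightMap P (R i))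
    (hs : ∀ ξ ∈ K, HasSum (fun i => ‖R i ξ‖ ^ 2) (‖ξ‖ ^ 2))
    (h : Summable fun i => ‖adjoint (R i) (τ.hat 1)‖ ^ 2) : τ.rightDim P K < ⊤ := by
  classical
  have hmem : ∀ ξ : K, Memℓp (fun i => (⟨R i ξ, (hR i).mem ξ⟩ : τ.L2Sub P)) 2 := fun ξ => by
    refine memℓp_gen ?_
    have := (hs ξ ξ.2).summable
    simpa using this
  let V₀ : K →ₗ[ℂ] lp (fun _ : ι => τ.L2Sub P) 2 :=
    { toFun := fun ξ => ⟨_, hmem ξ⟩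
      map_add' := fun ξ η => lp.ext (funext fun i => Subtype.ext (map_add (R i) _ _))
      map_smul' := fun a ξ => lp.ext (funext fun i => Subtype.ext (map_smul (R i) a _)) }
  let V : K →ₗᵢ[ℂ] lp (fun _ : ι => τ.L2Sub P) 2 :=
    { V₀ with
      norm_map' := fun ξ => by
        rw [← sq_eq_sq₀ (norm_nonneg _) (norm_nonneg _)]
        have h1 := lp.hasSum_norm (p := 2) (by norm_num) (V₀ ξ)
        have h2 := hs ξ ξ.2
        simp only [ENNReal.toReal_ofNat, Real.rpow_ofNat] at h1
        exact h1.unique h2 }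
  have hVapp : ∀ ξ i, (V ξ i : τ.L2) = R i ξ := fun ξ i => rfl
  have hV : τ.IsRightLinear P K V := fun p hp ξ η hη i => by
    rw [hVapp, hVapp, hη, (hR i).comm p hp]
  rw [rightDim]
  refine lt_of_le_of_lt (sInf_le ⟨ι, V, hV, rfl⟩) ?_
  · have h1 : ∀ i, ‖adjoint V.toContinuousLinearMap
        (lp.single 2 i ⟨τ.hat 1, τ.hat_mem_L2Sub P 1 (one_mem P)⟩)‖ ≤
          ‖adjoint (R i) (τ.hat 1)‖ := fun i => by
      obtain ⟨η, hη⟩ : ∃ η, η = adjoint V.toContinuousLinearMap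
        (lp.single 2 i ⟨τ.hat 1, τ.hat_mem_L2Sub P 1 (one_mem P)⟩) := ⟨_, rfl⟩
      have h2 := inner_adjoint_single V.toContinuousLinearMap i
        (⟨τ.hat 1, τ.hat_mem_L2Sub P 1 (one_mem P)⟩ : τ.L2Sub P) η
      have h3 := adjoint_inner_left (R i) (η : τ.L2) (τ.hat 1)
      rw [← hη] at h2 ⊢
      exact norm_le_of_inner_eq (h2.trans h3.symm) le_rfl
    have h2 : ∑' i, ENNReal.ofReal (‖adjoint (R i) (τ.hat 1)‖ ^ 2) ≠ ⊤ :=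
      h.tsum_ofReal_ne_top
    refine lt_of_le_of_lt (ENNReal.tsum_le_tsum fun i => ?_) h2.lt_top
    rw [ENNReal.ofReal_pow (norm_nonneg _), ofReal_norm]
    gcongr
    rw [← ofReal_norm, ← ofReal_norm]
    refine ENNReal.ofReal_le_ofReal ?_
    convert h1 i

end TraceState

end VonNeumannAlgebra

end

noncomputable section

namespace VonNeumannAlgebra

variable {H : Type u} [NormedAddCommGroup H] [InnerProductSpace ℂ H] [CompleteSpace H]

namespace TraceState

variable {M : VonNeumannAlgebra H} {τ : M.TraceState}

open ContinuousLinearMap (adjoint adjoint_inner_left adjoint_inner_right)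

/-! ### Mixing excludes intertwiners -/

theorem rightMul_mem_closedSpan_mul {Q P : VonNeumannAlgebra H} {x p : M.toStarSubalgebra}
    (hp : (p : H →L[ℂ] H) ∈ P) {ξ : τ.L2}
    (hξ : ξ ∈ τ.closedSpan {y | ∃ q p : M.toStarSubalgebra, (q : H →L[ℂ] H) ∈ Q ∧
      (p : H →L[ℂ] H) ∈ P ∧ y = q * x * p}) :
    τ.rightMul p ξ ∈ τ.closedSpan {y | ∃ q p : M.toStarSubalgebra, (q : H →L[ℂ] H) ∈ Q ∧
      (p : H →L[ℂ] H) ∈ P ∧ y = q * x * p} := by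
  refine map_mem_of_mem_closedSpan (isClosed_closedSpan _) _ ?_ hξ
  rintro _ ⟨q, p', hq, hp', rfl⟩
  rw [rightMul_hat]
  exact hat_mem_closedSpan ⟨q, p' * p, hq, mul_mem hp' hp, by rw [mul_assoc]⟩

/-- Unitaries u of A leave ⟪x, y⟫ = ⟪ux, uy⟫ unchanged, and ux stays in L²(AxP). Expanded in a
frame, the i-th term tends to 0 because R_i(uy) does, and it is dominated by ‖x‖‖y‖‖R_i* 1̂‖², which
is summable because the dimension is finite. -/
theorem inner_eq_zero_of_mem_intertwiners {A P : VonNeumannAlgebra H} (hAM : A ≤ M)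
    (hA : A.IsDiffuse) {x y : M.toStarSubalgebra} (hx : x ∈ τ.intertwiners A P)
    (hy : ∀ z : M.toStarSubalgebra, Tendsto (fun u => ‖τ.condExp P (z * u * y)‖)
      (weaklyNullUnitaries M A) (𝓝 0)) : ⟪τ.hat x, τ.hat y⟫_ℂ = 0 := by
  obtain ⟨ι, R, hR, hs⟩ := exists_isRightFrame (fun p hp ξ hξ => rightMul_mem_closedSpan_mul hp hξ)
    hx
  have hne := weaklyNullUnitaries_neBot hAM hA
  have hev := (mem_weaklyNullUnitaries M A).and (eventually_norm_le_one M A)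
  have hmul : ∀ u w : M.toStarSubalgebra, ‖(u : H →L[ℂ] H)‖ ≤ 1 →
      ‖((u * w : M.toStarSubalgebra) : H →L[ℂ] H)‖ ≤ ‖(w : H →L[ℂ] H)‖ := fun u w hu =>
    calc _ ≤ ‖(u : H →L[ℂ] H)‖ * ‖(w : H →L[ℂ] H)‖ := norm_mul_le _ _
      _ ≤ 1 * ‖(w : H →L[ℂ] H)‖ := by gcongr
      _ = _ := one_mul _
  have key : Tendsto (fun u => ∑' i, ⟪R i (τ.hat (u * x)), R i (τ.hat (u * y))⟫_ℂ)
      (weaklyNullUnitaries M A) (𝓝 (∑' _ : ι, 0)) := by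
    refine tendsto_tsum_of_dominated_convergence
      (bound := fun i => ‖(x : H →L[ℂ] H)‖ * ‖(y : H →L[ℂ] H)‖ * ‖adjoint (R i) (τ.hat 1)‖ ^ 2)
      (hs.mul_left _) (fun i => ?_) ?_
    · rw [tendsto_zero_iff_norm_tendsto_zero]
      have h1 := ((hR.isRightMap i).tendsto_norm hy).const_mul
        (‖(x : H →L[ℂ] H)‖ * ‖adjoint (R i) (τ.hat 1)‖)
      rw [mul_zero] at h1
      refine squeeze_zero' (Eventually.of_forall fun _ => norm_nonneg _) ?_ h1
      filter_upwards [hev] with u hu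
      refine (norm_inner_le_norm _ _).trans ?_
      gcongr
      refine ((hR.isRightMap i).norm_apply_hat_le _).trans ?_
      gcongr
      exact hmul u x hu.2
    · filter_upwards [hev] with u hu i
      refine (norm_inner_le_norm _ _).trans ?_
      calc _ ≤ (‖((u * x : M.toStarSubalgebra) : H →L[ℂ] H)‖ * ‖adjoint (R i) (τ.hat 1)‖) *
            (‖((u * y : M.toStarSubalgebra) : H →L[ℂ] H)‖ * ‖adjoint (R i) (τ.hat 1)‖) := by
            gcongr <;> exact (hR.isRightMap i).norm_apply_hat_le _
        _ ≤ (‖(x : H →L[ℂ] H)‖ * ‖adjoint (R i) (τ.hat 1)‖) *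
            (‖(y : H →L[ℂ] H)‖ * ‖adjoint (R i) (τ.hat 1)‖) := by
            gcongr
            · exact hmul u x hu.2
            · exact hmul u y hu.2
        _ = _ := by ring
  rw [tsum_zero] at key
  refine tendsto_nhds_unique (tendsto_const_nhds.congr' ?_) key
  filter_upwards [hev] with u hu
  rw [(hR.hasSum_inner (τ.hat (u * x)) (hat_mem_closedSpan ⟨u, 1, hu.1.1, one_mem P, by simp⟩)
    (τ.hat (u * y))).tsum_eq, inner_hat, inner_hat]
  have h1 : star u * u = 1 := Subtype.ext (Unitary.star_mul_self_of_mem hu.1.2)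
  rw [star_mul, mul_assoc, ← mul_assoc (star u), h1, one_mul]

/-- With y = x - E_B(x), mixing gives E_B(zuy) → 0 for all z, not only for z ∈ M ⊖ B: the part of z
in B contributes E_B(z) u E_B(y) = 0. So y is orthogonal to x; it is also orthogonal to E_B(x),
hence to itself. -/
theorem IsMixing.isStronglyMalnormal {B : VonNeumannAlgebra H} (hB : B ≤ M) (h : τ.IsMixing B) :
    τ.IsStronglyMalnormal B := by
  refine ⟨h.1, ?_⟩
  rintro x ⟨A, hAB, hA, -, hx⟩
  obtain ⟨n, hn⟩ := exists_sub_condExp_eq_zero (τ := τ) hB x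
  set y := x - incl hB n with hy
  have h0 : ⟪τ.hat x, τ.hat y⟫_ℂ = 0 := by
    refine inner_eq_zero_of_mem_intertwiners (hAB.trans hB) hA hx fun z => ?_
    obtain ⟨m, hm⟩ := exists_sub_condExp_eq_zero (τ := τ) hB z
    have h1 := (h.2 _ _ hm hn).mono_left (weaklyNullUnitaries_mono hAB)
    refine h1.congr' ?_
    filter_upwards [mem_weaklyNullUnitaries M A] with u hu
    have h2 : z * u * y = (z - incl hB m) * u * y + incl hB m * u * y := by
      rw [← add_mul, ← add_mul, sub_add_cancel]
    rw [h2, condExp_add, condExp_mul_left_eq_zero (b := incl hB m * u) hn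
      (mul_mem m.2 (hAB hu.1)), add_zero]
  have h1 : ⟪τ.hat (incl hB n), τ.hat y⟫_ℂ = 0 := by
    rw [← inner_condExp _ (τ.hat_mem_L2Sub B _ n.2), hn, inner_zero_right]
  have h2 : τ.hat y = 0 := by
    rw [← inner_self_eq_zero (𝕜 := ℂ)]
    have h2 := hat_sub τ x (incl hB n)
    rw [← hy] at h2
    conv_lhs => enter [2]; rw [h2]
    rw [inner_sub_left, h0, h1, sub_zero]
  have h3 : x = incl hB n := by
    refine τ.hat_injective (sub_eq_zero.1 ?_)
    rw [← hat_sub, h2]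
  rw [h3]
  exact n.2

theorem zero_mem_intertwiners (Q P : VonNeumannAlgebra H) :
    (0 : M.toStarSubalgebra) ∈ τ.intertwiners Q P := by
  -- The module generated by 0 is zero, so it has the empty frame.
  refine rightDim_lt_top (ι := PEmpty) (R := fun i => i.elim) (fun i => i.elim) (fun ξ hξ => ?_)
    (by simp)
  have : ξ = 0 := eq_zero_of_mem_closedSpan hξ (by
    rintro _ ⟨q, p, -, -, rfl⟩
    simp [hat_zero])
  rw [this]
  simp

theorem IsMixingPair.weakIntertwiners_eq {B B₀ : VonNeumannAlgebra H} (hB : B ≤ M)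
    (h : τ.IsMixingPair B B₀) : τ.weakIntertwiners B B₀ = {0} := by
  ext x
  refine ⟨?_, ?_⟩
  · rintro ⟨A, hAB, hA, hx⟩
    refine τ.hat_injective ?_
    rw [hat_zero, ← inner_self_eq_zero (𝕜 := ℂ)]
    exact inner_eq_zero_of_mem_intertwiners (hAB.trans hB) hA hx fun z =>
      (h.2 z x).mono_left (weaklyNullUnitaries_mono hAB)
  · rintro rfl
    exact ⟨B, le_rfl, h.1, zero_mem_intertwiners _ _⟩

end TraceState

end VonNeumannAlgebra

end

noncomputable section

namespace VonNeumannAlgebra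

open ContinuousLinearMap (adjoint adjoint_inner_left adjoint_inner_right)

section Hilbert

variable {E : Type*} [NormedAddCommGroup E] [InnerProductSpace ℂ E] [CompleteSpace E]

/-! ### Polar decomposition and orthogonal sums of partial isometries -/

theorem norm_cfcAbs_apply (T : E →L[ℂ] E) (ξ : E) : ‖CFC.abs T ξ‖ = ‖T ξ‖ := by
  have h1 : adjoint (CFC.abs T) = CFC.abs T := by
    rw [← ContinuousLinearMap.star_eq_adjoint]
    exact (IsSelfAdjoint.of_nonneg (CFC.abs_nonneg T)).star_eq
  have h2 : CFC.abs T (CFC.abs T ξ) = adjoint T (T ξ) := by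
    rw [← ContinuousLinearMap.star_eq_adjoint, ← mul_apply_eq_comp, CFC.abs_mul_abs,
      mul_apply_eq_comp]
  have h3 : ⟪CFC.abs T ξ, CFC.abs T ξ⟫_ℂ = ⟪T ξ, T ξ⟫_ℂ := by
    rw [← adjoint_inner_right, h1, h2, adjoint_inner_right]
  rw [inner_self_eq_norm_sq_to_K, inner_self_eq_norm_sq_to_K] at h3
  rw [← sq_eq_sq₀ (norm_nonneg _) (norm_nonneg _)]
  exact_mod_cast h3

/-- `W` is the partial isometry in the polar decomposition of `T`. -/
structure IsPolarPart (T W : E →L[ℂ] E) : Prop where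
  apply_eq_zero : ∀ ξ, T ξ = 0 → W ξ = 0
  mem_closure : ∀ ξ, W ξ ∈ T.range.topologicalClosure
  apply_adjoint_apply : ∀ ξ, T (adjoint W (W ξ)) = T ξ
  norm_adjoint : ∀ η ∈ T.range.topologicalClosure, ‖adjoint W η‖ = ‖η‖
  commute : ∀ S : E →L[ℂ] E, Commute T S → Commute T (star S) → Commute W S

/-- Since ‖|T| ξ‖ = ‖T ξ‖, the map |T| ξ ↦ T ξ extends to an isometry on the closed range of |T|; W
is this isometry, extended by zero. Whatever commutes with T and whose adjoint does too commutes
with |T|, hence with W. -/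
theorem exists_isPolarPart (T : E →L[ℂ] E) : ∃ W, IsPolarPart T W := by
  set A := CFC.abs T with hA
  have hnorm : ∀ ξ, ‖A ξ‖ = ‖T ξ‖ := norm_cfcAbs_apply T
  have hAadj : adjoint A = A := by
    rw [← ContinuousLinearMap.star_eq_adjoint]
    exact (IsSelfAdjoint.of_nonneg (CFC.abs_nonneg T)).star_eq
  let S : Submodule ℂ E := A.range.topologicalClosure
  have hSc : IsClosed (S : Set E) := Submodule.isClosed_topologicalClosure _
  have : CompleteSpace S := hSc.completeSpace_coe
  have hAS : ∀ ξ, A ξ ∈ S := fun ξ => Submodule.le_topologicalClosure _ ⟨ξ, rfl⟩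
  let e : E →ₗ[ℂ] S := A.toLinearMap.codRestrict S hAS
  have he : DenseRange e := by
    rw [DenseRange, Subtype.dense_iff]
    intro x hx
    refine closure_mono ?_ hx
    rintro _ ⟨ξ, rfl⟩
    exact ⟨⟨A ξ, hAS ξ⟩, ⟨ξ, rfl⟩, rfl⟩
  have hb : ∀ ξ, ‖T.toLinearMap ξ‖ ≤ 1 * ‖e ξ‖ := fun ξ => by
    rw [one_mul]; exact (hnorm ξ).ge
  let W₀ : S →L[ℂ] E := T.toLinearMap.extendOfNorm e
  have hW₀ : ∀ ξ, W₀ (e ξ) = T ξ := LinearMap.extendOfNorm_eq he ⟨1, hb⟩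
  have hW₀n : ∀ ξ, ‖W₀ ξ‖ = ‖ξ‖ := fun ξ => congrFun (he.equalizer (g := fun ξ => ‖W₀ ξ‖)
    (h := fun ξ => ‖ξ‖) (by fun_prop) (by fun_prop)
    (funext fun ξ => (congrArg norm (hW₀ ξ)).trans (hnorm ξ).symm)) ξ
  have hW₀i : ∀ ξ η, ⟪W₀ ξ, W₀ η⟫_ℂ = ⟪ξ, η⟫_ℂ :=
    (⟨W₀.toLinearMap, hW₀n⟩ : S →ₗᵢ[ℂ] E).inner_map_map
  let W : E →L[ℂ] E := W₀ ∘L S.orthogonalProjectionOnto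
  have hWapp : ∀ ξ, W ξ = W₀ (S.orthogonalProjectionOnto ξ) := fun ξ => rfl
  have hWA : ∀ ξ, W (A ξ) = T ξ := fun ξ => by
    have : S.orthogonalProjectionOnto (A ξ) = e ξ :=
      Submodule.orthogonalProjectionOnto_mem_subspace_eq_self (e ξ)
    rw [hWapp, this, hW₀]
  have hWi : ∀ ξ η, ⟪W ξ, W η⟫_ℂ = ⟪S.starProjection ξ, η⟫_ℂ := fun ξ η => by
    rw [hWapp, hWapp, hW₀i, Submodule.coe_inner, ← Submodule.starProjection_apply,
      ← Submodule.starProjection_apply, ← Submodule.inner_starProjection_left_eq_right,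
      Submodule.starProjection_eq_self_iff.2 (Submodule.starProjection_apply_mem _ _)]
  have hWW : ∀ ξ, adjoint W (W ξ) = S.starProjection ξ := fun ξ =>
    ext_inner_right ℂ fun η => by rw [adjoint_inner_left, hWi]
  have hWS : ∀ ξ, W (S.starProjection ξ) = W ξ := fun ξ => by
    rw [hWapp, hWapp, Submodule.starProjection_apply,
      Submodule.orthogonalProjectionOnto_mem_subspace_eq_self]
  have hker : ∀ ξ, A ξ = 0 → ξ ∈ Sᗮ := fun ξ hξ => by
    rw [Submodule.orthogonal_closure, Submodule.mem_orthogonal]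
    rintro _ ⟨η, rfl⟩
    change ⟪A η, ξ⟫_ℂ = 0
    rw [← hAadj, adjoint_inner_left, hξ, inner_zero_right]
  have hker' : ∀ ξ ∈ Sᗮ, A ξ = 0 := fun ξ hξ => by
    rw [← inner_self_eq_zero (𝕜 := ℂ), ← adjoint_inner_left, hAadj]
    exact (Submodule.mem_orthogonal _ _).1 hξ _ (hAS _)
  have hWz : ∀ ξ ∈ Sᗮ, W ξ = 0 := fun ξ hξ => by
    rw [← hWS, (Submodule.starProjection_apply_eq_zero_iff S).2 hξ, map_zero]
  refine ⟨W, ⟨fun ξ hξ => ?_, fun ξ => ?_, fun ξ => ?_, fun η hη => ?_,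
    fun R h₁ h₂ => ?_⟩⟩
  · exact hWz ξ (hker ξ (norm_eq_zero.1 (by rw [hnorm, hξ, norm_zero])))
  · rw [hWapp]
    have hcl : IsClosed {s : S | W₀ s ∈ T.range.topologicalClosure} :=
      (Submodule.isClosed_topologicalClosure _).preimage W₀.continuous
    refine he.induction_on (p := fun s => W₀ s ∈ T.range.topologicalClosure) _ hcl fun ξ => ?_
    rw [hW₀]
    exact Submodule.le_topologicalClosure _ ⟨ξ, rfl⟩
  · rw [hWW]
    have h1 : A (ξ - S.starProjection ξ) = 0 :=
      hker' _ (Submodule.sub_starProjection_mem_orthogonal ξ)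
    have h2 : T (ξ - S.starProjection ξ) = 0 :=
      norm_eq_zero.1 (by rw [← hnorm, h1, norm_zero])
    rw [map_sub, sub_eq_zero] at h2
    exact h2.symm
  · have hcl : IsClosed {η : E | ‖adjoint W η‖ = ‖η‖} :=
      isClosed_eq (by fun_prop) (by fun_prop)
    refine closure_minimal (s := (T.range : Set E)) ?_ hcl hη
    rintro _ ⟨ξ, rfl⟩
    change ‖adjoint W (T ξ)‖ = ‖T ξ‖
    rw [← hWA, hWW, Submodule.starProjection_eq_self_iff.2 (hAS ξ), hWA, hnorm]
  · have hAR : ∀ ξ, A (R ξ) = R (A ξ) := fun ξ => congrArg (· ξ) (h₁.cfcAbs_left h₂).eq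
    have hAR' : ∀ ξ, A (star R ξ) = star R (A ξ) := fun ξ =>
      congrArg (· ξ) ((h₂.cfcAbs_left (by rwa [star_star])).eq)
    have hSR : ∀ ξ ∈ S, W (R ξ) = R (W ξ) := fun ξ hξ => by
      refine closure_minimal (s := (A.range : Set E)) (t := {ξ | W (R ξ) = R (W ξ)}) ?_
        (isClosed_eq (by fun_prop) (by fun_prop)) hξ
      rintro _ ⟨ξ, rfl⟩
      change W (R (A ξ)) = R (W (A ξ))
      rw [← hAR, hWA, hWA]
      exact congrArg (· ξ) h₁.eq
    ext ξ
    change W (R ξ) = R (W ξ)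
    have h3 : ξ - S.starProjection ξ ∈ Sᗮ := Submodule.sub_starProjection_mem_orthogonal ξ
    have h4 : W (R (ξ - S.starProjection ξ)) = 0 :=
      hWz _ (hker _ (by rw [hAR, hker' _ h3, map_zero]))
    rw [← hWS ξ, ← hSR _ (Submodule.starProjection_apply_mem _ _)]
    rw [map_sub, map_sub, sub_eq_zero] at h4
    exact h4

namespace IsPolarPart

variable {T W : E →L[ℂ] E}

theorem norm_adjoint_apply (h : IsPolarPart T W) (ξ : E) : ‖adjoint W (W ξ)‖ = ‖W ξ‖ :=
  h.norm_adjoint _ (h.mem_closure ξ)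

theorem norm_apply_le (h : IsPolarPart T W) (ξ : E) : ‖W ξ‖ ≤ ‖ξ‖ :=
  TraceState.norm_le_of_inner_eq (adjoint_inner_right W ξ (W ξ)).symm
    (h.norm_adjoint_apply ξ).le

theorem adjoint_eq_zero (h : IsPolarPart T W) {η : E}
    (hη : η ∈ T.range.topologicalClosureᗮ) : adjoint W η = 0 :=
  ext_inner_left ℂ fun ξ => by
    rw [adjoint_inner_right, inner_zero_right]
    exact (Submodule.mem_orthogonal _ _).1 hη _ (h.mem_closure ξ)

end IsPolarPart

/-- Parseval for an internal Hilbert sum: R_i sees only the component in G_i, and preserves its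
norm. -/
theorem hasSum_norm_sq_of_orthogonal {ι : Type*} {G : ι → Submodule ℂ E}
    (hG : ∀ i, IsClosed (G i : Set E)) (ho : ∀ i j, i ≠ j → ∀ ξ ∈ G i, ∀ η ∈ G j, ⟪ξ, η⟫_ℂ = 0)
    {R : ι → E →L[ℂ] E} (hR : ∀ i, ∀ ξ ∈ G i, ‖R i ξ‖ = ‖ξ‖) (hR₀ : ∀ i, ∀ ξ ∈ (G i)ᗮ, R i ξ = 0)
    {ξ : E} (hξ : ξ ∈ (⨆ i, G i).topologicalClosure) :
    HasSum (fun i => ‖R i ξ‖ ^ 2) (‖ξ‖ ^ 2) := by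
  have : ∀ i, CompleteSpace (G i) := fun i => (hG i).completeSpace_coe
  have hV : OrthogonalFamily ℂ (fun i => G i) fun i => (G i).subtypeₗᵢ :=
    fun i j hij a b => ho i j hij a a.2 b b.2
  have h1 := hV.range_linearIsometry
  have h2 : ∀ i, LinearMap.range ((G i).subtypeₗᵢ).toLinearMap = G i := fun i =>
    Submodule.range_subtype _
  simp only [h2] at h1
  rw [← h1] at hξ
  obtain ⟨f, rfl⟩ := hξ
  have h3 := lp.hasSum_norm (p := 2) (by norm_num) f
  simp only [ENNReal.toReal_ofNat, Real.rpow_ofNat] at h3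
  have h4 : ∀ i, ‖R i (hV.linearIsometry f)‖ = ‖f i‖ := fun i => by
    have h5 := (hV.hasSum_linearIsometry f).mapL (R i)
    have h6 : HasSum (fun j => R i ((G j).subtypeₗᵢ (f j))) (R i (f i)) := by
      refine hasSum_single i fun j hj => hR₀ i _ ?_
      rw [Submodule.mem_orthogonal]
      exact fun η hη => ho i j hj.symm η hη _ (f j).2
    rw [h5.unique h6, hR i _ (f i).2]
    rfl
  have h7 : ‖hV.linearIsometry.toLinearMap f‖ = ‖f‖ := hV.linearIsometry.norm_map f
  rw [h7]
  simp only [← h4] at h3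
  exact h3

end Hilbert

end VonNeumannAlgebra

end

noncomputable section

namespace VonNeumannAlgebra

variable {H : Type u} [NormedAddCommGroup H] [InnerProductSpace ℂ H] [CompleteSpace H]

namespace TraceState

variable {M : VonNeumannAlgebra H} {τ : M.TraceState}

open ContinuousLinearMap (adjoint adjoint_inner_left adjoint_inner_right)

/-! ### Gram–Schmidt orthogonalization over a von Neumann algebra -/

/-- The closed right `P`-submodule of `L²M` generated by the vectors of a set. -/
def rightSpan (τ : M.TraceState) (P : VonNeumannAlgebra H) (S : Set M.toStarSubalgebra) :
    Submodule ℂ τ.L2 :=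
  τ.closedSpan {y | ∃ z ∈ S, ∃ p : M.toStarSubalgebra, (p : H →L[ℂ] H) ∈ P ∧ y = z * p}

instance (P : VonNeumannAlgebra H) (S : Set M.toStarSubalgebra) :
    CompleteSpace (τ.rightSpan P S) :=
  inferInstanceAs (CompleteSpace (τ.closedSpan _))

theorem isClosed_rightSpan (P : VonNeumannAlgebra H) (S : Set M.toStarSubalgebra) :
    IsClosed (τ.rightSpan P S : Set τ.L2) := isClosed_closedSpan _

theorem hat_mul_mem_rightSpan {P : VonNeumannAlgebra H} {S : Set M.toStarSubalgebra}
    {z p : M.toStarSubalgebra} (hz : z ∈ S) (hp : (p : H →L[ℂ] H) ∈ P) :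
    τ.hat (z * p) ∈ τ.rightSpan P S :=
  hat_mem_closedSpan ⟨z, hz, p, hp, rfl⟩

theorem rightSpan_le {P : VonNeumannAlgebra H} {S : Set M.toStarSubalgebra} {K : Submodule ℂ τ.L2}
    (hK : IsClosed (K : Set τ.L2))
    (h : ∀ z ∈ S, ∀ p : M.toStarSubalgebra, (p : H →L[ℂ] H) ∈ P → τ.hat (z * p) ∈ K) :
    τ.rightSpan P S ≤ K :=
  closedSpan_le hK (by rintro _ ⟨z, hz, p, hp, rfl⟩; exact h z hz p hp)

theorem rightSpan_mono {P N : VonNeumannAlgebra H} (hPN : P ≤ N) {S S' : Set M.toStarSubalgebra}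
    (h : S ⊆ S') : τ.rightSpan P S ≤ τ.rightSpan N S' :=
  rightSpan_le (isClosed_rightSpan _ _) fun _ hz _ hp => hat_mul_mem_rightSpan (h hz) (hPN hp)

theorem rightMul_mem_rightSpan {P : VonNeumannAlgebra H} {S : Set M.toStarSubalgebra}
    (p : M.toStarSubalgebra) (hp : (p : H →L[ℂ] H) ∈ P) (ξ : τ.L2) (hξ : ξ ∈ τ.rightSpan P S) :
    τ.rightMul p ξ ∈ τ.rightSpan P S := by
  refine map_mem_of_mem_closedSpan (isClosed_closedSpan _) _ ?_ hξ
  rintro _ ⟨z, hz, q, hq, rfl⟩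
  rw [rightMul_hat, mul_assoc]
  exact hat_mem_closedSpan ⟨z, hz, q * p, mul_mem hq hp, rfl⟩

/-- The map `p̂ ↦ (1 - e) (z p)^` on `L²P`, where `e` is the projection on `L`, extended by zero. -/
def orthMul (τ : M.TraceState) (P : VonNeumannAlgebra H) (L : Submodule ℂ τ.L2) [CompleteSpace L]
    (z : M.toStarSubalgebra) : τ.L2 →L[ℂ] τ.L2 :=
  (1 - L.starProjection) ∘L τ.leftMul z ∘L (τ.L2Sub P).starProjection

/-! ### The multiplication by z made orthogonal to L, and its polar part -/

section

variable {P : VonNeumannAlgebra H} {L : Submodule ℂ τ.L2} [CompleteSpace L]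
  {z : M.toStarSubalgebra}

theorem orthMul_apply (ξ : τ.L2) : τ.orthMul P L z ξ =
    τ.leftMul z ((τ.L2Sub P).starProjection ξ) -
      L.starProjection (τ.leftMul z ((τ.L2Sub P).starProjection ξ)) := rfl

theorem orthMul_hat {m : M.toStarSubalgebra} (hm : (m : H →L[ℂ] H) ∈ P) :
    τ.orthMul P L z (τ.hat m) = τ.hat (z * m) - L.starProjection (τ.hat (z * m)) := by
  rw [orthMul_apply, Submodule.starProjection_eq_self_iff.2 (τ.hat_mem_L2Sub P m hm), leftMul_hat]

theorem closure_range_orthMul_le {L' : Submodule ℂ τ.L2} (hL' : IsClosed (L' : Set τ.L2))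
    (h : L ≤ L')
    (hz : ∀ p : M.toStarSubalgebra, (p : H →L[ℂ] H) ∈ P → τ.hat (z * p) ∈ L') :
    (τ.orthMul P L z).range.topologicalClosure ≤ L' := by
  refine Submodule.topologicalClosure_minimal _ ?_ hL'
  rintro _ ⟨ξ, rfl⟩
  refine sub_mem ?_ (h (Submodule.starProjection_apply_mem _ _))
  exact map_mem_of_mem_closedSpan hL' (τ.leftMul z) (fun p hp => by
    rw [leftMul_hat]; exact hz p hp) (Submodule.starProjection_apply_mem _ _)

theorem closure_range_orthMul_le_orthogonal :
    (τ.orthMul P L z).range.topologicalClosure ≤ Lᗮ := by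
  refine Submodule.topologicalClosure_minimal _ ?_ (Submodule.isClosed_orthogonal _)
  rintro _ ⟨ξ, rfl⟩
  exact Submodule.sub_starProjection_mem_orthogonal _

theorem orthMul_commute
    (hL : ∀ p : M.toStarSubalgebra, (p : H →L[ℂ] H) ∈ P → ∀ ξ ∈ L, τ.rightMul p ξ ∈ L)
    {p : M.toStarSubalgebra} (hp : (p : H →L[ℂ] H) ∈ P) :
    Commute (τ.orthMul P L z) (τ.rightMul p) := by
  ext ξ
  change τ.orthMul P L z (τ.rightMul p ξ) = τ.rightMul p (τ.orthMul P L z ξ)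
  rw [orthMul_apply, orthMul_apply,
    starProjection_rightMul (fun p hp ξ hξ => rightMul_mem_L2Sub hp hξ) hp,
    leftMul_rightMul, starProjection_rightMul hL hp, map_sub]

/-- The polar part vanishes where `orthMul` does, in particular off L²P, so its adjoint takes values
in L²P. It inherits right P-linearity, as it commutes with all operators that commute with `orthMul`
together with their adjoints. -/
theorem isRightMap_adjoint_of_isPolarPart
    (hL : ∀ p : M.toStarSubalgebra, (p : H →L[ℂ] H) ∈ P → ∀ ξ ∈ L, τ.rightMul p ξ ∈ L)
    {W : τ.L2 →L[ℂ] τ.L2} (hW : IsPolarPart (τ.orthMul P L z) W) :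
    τ.IsRightMap P (adjoint W) := by
  refine ⟨fun η => ?_, fun p hp ξ => ?_⟩
  · rw [← Submodule.orthogonal_orthogonal (τ.L2Sub P), Submodule.mem_orthogonal]
    intro ξ hξ
    rw [adjoint_inner_right, hW.apply_eq_zero ξ, inner_zero_left]
    rw [orthMul_apply, (Submodule.starProjection_apply_eq_zero_iff _).2 hξ, map_zero, map_zero,
      sub_zero]
  · have h1 : Commute W (τ.rightMul (star p)) :=
      hW.commute _ (orthMul_commute hL (star_mem hp)) (by
        rw [star_rightMul, star_star]; exact orthMul_commute hL hp)
    have h2 := h1.star_star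
    rw [star_rightMul, star_star] at h2
    exact congrArg (· ξ) h2.eq

/-- The vector W*W 1̂ of L²P is bounded by 1, because ⟪bc, W*W 1̂⟫ = ⟪b, W*W c*⟫, so it is given by
some s ∈ P, the support of `orthMul` on L²P. Then `orthMul` agrees on ŝ and 1̂, which says that z(1
- s) lies in L. -/
theorem exists_support_of_isPolarPart (hP : P ≤ M)
    (hL : ∀ p : M.toStarSubalgebra, (p : H →L[ℂ] H) ∈ P → ∀ ξ ∈ L, τ.rightMul p ξ ∈ L)
    {W : τ.L2 →L[ℂ] τ.L2} (hW : IsPolarPart (τ.orthMul P L z) W) :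
    ∃ s : M.toStarSubalgebra, (s : H →L[ℂ] H) ∈ P ∧ τ.hat (z * (1 - s)) ∈ L ∧
      ‖τ.hat s‖ = ‖W (τ.hat 1)‖ := by
  have hR := isRightMap_adjoint_of_isPolarPart hL hW
  obtain ⟨s, hs, -, hs1⟩ := exists_eq_hat_of_bounded hP zero_le_one
    (hR.mem (W (τ.hat 1))) (fun b c _ hc => by
      have h1 : τ.rightMul (star c) (adjoint W (W (τ.hat 1))) =
          adjoint W (W (τ.hat (star c))) := by
        have h2 := hR.adjoint_comm (p := star c) (star_mem hc) (τ.hat 1)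
        rw [ContinuousLinearMap.adjoint_adjoint, rightMul_hat, one_mul] at h2
        rw [h2, ← hR.comm (star c) (star_mem hc)]
      have h3 := inner_rightMul (τ := τ) (star c) (τ.hat b) (adjoint W (W (τ.hat 1)))
      rw [star_star, rightMul_hat, h1] at h3
      rw [← h3, one_mul]
      refine (norm_inner_le_norm _ _).trans ?_
      rw [hW.norm_adjoint_apply, ← τ.norm_hat_star c]
      gcongr
      exact hW.norm_apply_le _)
  refine ⟨s, hs, ?_, by rw [hs1, hW.norm_adjoint_apply]⟩
  have h4 := hW.apply_adjoint_apply (τ.hat 1)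
  rw [← hs1, orthMul_hat hs, orthMul_hat (one_mem P)] at h4
  have h5 : τ.hat (z * (1 - s)) =
      L.starProjection (τ.hat (z * 1)) - L.starProjection (τ.hat (z * s)) := by
    rw [mul_sub, hat_sub, sub_eq_sub_iff_sub_eq_sub]
    exact h4.symm
  rw [h5]
  exact sub_mem (Submodule.starProjection_apply_mem _ _) (Submodule.starProjection_apply_mem _ _)

end

/-- L i is the module generated by the earlier z_j, T i is multiplication by z_i made orthogonal to
L i, and W i is its polar part. The closed ranges of the T i are mutually orthogonal and, by
well-founded induction, span the module, which gives Parseval's identity. The vanishing condition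
and the support s are recorded in order to compare the outcomes over two algebras. -/
theorem exists_gramSchmidt {P : VonNeumannAlgebra H} (hP : P ≤ M) {ι : Type*} [LinearOrder ι]
    [WellFoundedLT ι] (z : ι → M.toStarSubalgebra) : ∃ W : ι → τ.L2 →L[ℂ] τ.L2,
      (∀ i, τ.IsRightMap P (adjoint (W i))) ∧
      (∀ i ξ, W i ξ ∈ τ.rightSpan P (Set.range z)) ∧
      (∀ ξ ∈ τ.rightSpan P (Set.range z), HasSum (fun i => ‖adjoint (W i) ξ‖ ^ 2) (‖ξ‖ ^ 2)) ∧
      (∀ i ξ, ‖W i ξ‖ ≤ ‖ξ‖) ∧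
      (∀ i (m : M.toStarSubalgebra), (m : H →L[ℂ] H) ∈ P →
        τ.hat (z i * m) ∈ τ.rightSpan P (z '' Set.Iio i) → W i (τ.hat m) = 0) ∧
      (∀ i, ∃ s : M.toStarSubalgebra, (s : H →L[ℂ] H) ∈ P ∧
        τ.hat (z i * (1 - s)) ∈ τ.rightSpan P (z '' Set.Iio i) ∧
        ‖τ.hat s‖ = ‖W i (τ.hat 1)‖) := by
  let L : ι → Submodule ℂ τ.L2 := fun i => τ.rightSpan P (z '' Set.Iio i)
  let T : ι → τ.L2 →L[ℂ] τ.L2 := fun i => τ.orthMul P (L i) (z i)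
  let G : ι → Submodule ℂ τ.L2 := fun i => (T i).range.topologicalClosure
  have hGc : ∀ i, IsClosed (G i : Set τ.L2) := fun i => Submodule.isClosed_topologicalClosure _
  choose W hW using fun i => exists_isPolarPart (T i)
  have hL : ∀ i (p : M.toStarSubalgebra), (p : H →L[ℂ] H) ∈ P → ∀ ξ ∈ L i,
    τ.rightMul p ξ ∈ L i := fun i p hp ξ hξ => rightMul_mem_rightSpan p hp ξ hξ
  have hGK : ∀ i, G i ≤ τ.rightSpan P (Set.range z) := fun i =>
    closure_range_orthMul_le (isClosed_rightSpan _ _)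
      (rightSpan_mono le_rfl (Set.image_subset_range _ _))
      fun p hp => hat_mul_mem_rightSpan ⟨i, rfl⟩ hp
  have hGL : ∀ i j, i < j → G i ≤ L j := fun i j hij =>
    closure_range_orthMul_le (isClosed_rightSpan _ _)
      (rightSpan_mono le_rfl (Set.image_mono (Set.Iio_subset_Iio hij.le)))
      fun p hp => hat_mul_mem_rightSpan ⟨i, hij, rfl⟩ hp
  have hGo : ∀ i j, i < j → ∀ ξ ∈ G i, ∀ η ∈ G j, ⟪ξ, η⟫_ℂ = 0 := fun i j hij ξ hξ η hη =>
    (Submodule.mem_orthogonal _ _).1 (closure_range_orthMul_le_orthogonal hη) ξ (hGL i j hij hξ)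
  have htot : τ.rightSpan P (Set.range z) ≤ (⨆ i, G i).topologicalClosure := by
    have hcl := Submodule.isClosed_topologicalClosure (⨆ i, G i)
    refine rightSpan_le hcl ?_
    rintro _ ⟨i, rfl⟩
    induction i using WellFoundedLT.induction with
    | ind i ih =>
      intro p hp
      have h1 : L i ≤ (⨆ i, G i).topologicalClosure := rightSpan_le hcl (by
        rintro _ ⟨j, hj, rfl⟩
        exact ih j hj)
      have h2 : T i (τ.hat p) ∈ (⨆ i, G i).topologicalClosure :=
        Submodule.le_topologicalClosure _ (le_iSup G i
          (Submodule.le_topologicalClosure _ ⟨τ.hat p, rfl⟩))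
      have h3 : τ.hat (z i * p) = T i (τ.hat p) + (L i).starProjection (τ.hat (z i * p)) := by
        rw [orthMul_hat hp, sub_add_cancel]
      rw [h3]
      exact add_mem h2 (h1 (Submodule.starProjection_apply_mem _ _))
  refine ⟨W, fun i => isRightMap_adjoint_of_isPolarPart (hL i) (hW i),
    fun i ξ => hGK i ((hW i).mem_closure ξ), fun ξ hξ => ?_, fun i => (hW i).norm_apply_le,
    fun i m hm hmem => (hW i).apply_eq_zero _ ?_,
    fun i => exists_support_of_isPolarPart hP (hL i) (hW i)⟩
  · refine hasSum_norm_sq_of_orthogonal hGc (fun i j hij ξ hξ η hη => ?_)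
      (fun i => (hW i).norm_adjoint) (fun i ξ hξ => (hW i).adjoint_eq_zero hξ) (htot hξ)
    rcases hij.lt_or_gt with h | h
    · exact hGo i j h ξ hξ η hη
    · exact inner_eq_zero_symm.1 (hGo j i h η hη ξ hξ)
  · rw [orthMul_hat hm, Submodule.starProjection_eq_self_iff.2 hmem, sub_self]

end TraceState

end VonNeumannAlgebra

end

noncomputable section

namespace VonNeumannAlgebra

variable {H : Type u} [NormedAddCommGroup H] [InnerProductSpace ℂ H] [CompleteSpace H]

namespace TraceState

variable {M : VonNeumannAlgebra H} {τ : M.TraceState}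

open ContinuousLinearMap (adjoint adjoint_inner_left adjoint_inner_right)

/-! ### Intertwiners and inclusions of algebras -/

/-- The trace at work: tested on b ∈ P, U 1̂ gives ⟪U* 1̂, b*⟫, and b* has the same 2-norm as b. It
is an inequality, since U* 1̂ may have a component outside L²P. -/
theorem IsRightMap.norm_apply_hat_one_le {P : VonNeumannAlgebra H} {U : τ.L2 →L[ℂ] τ.L2}
    (hU : τ.IsRightMap P U) : ‖U (τ.hat 1)‖ ≤ ‖adjoint U (τ.hat 1)‖ := by
  refine norm_le_of_mem_L2Sub (hU.mem _) (norm_nonneg _) fun b hb => ?_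
  rw [hU.inner_hat_apply hb, one_mul, ← τ.norm_hat_star b]
  exact norm_inner_le_norm _ _

theorem IsRightFrame.hasSum_norm_sq {P : VonNeumannAlgebra H} {K : Submodule ℂ τ.L2} {ι : Type u}
    {R : ι → τ.L2 →L[ℂ] τ.L2} (hR : τ.IsRightFrame P K R) {ξ : τ.L2} (hξ : ξ ∈ K) :
    HasSum (fun i => ‖R i ξ‖ ^ 2) (‖ξ‖ ^ 2) := by
  have h := Complex.hasSum_re (hR.hasSum_inner ξ hξ ξ)
  have h1 : ∀ η : τ.L2, (⟪η, η⟫_ℂ).re = ‖η‖ ^ 2 := fun η => inner_self_eq_norm_sq (𝕜 := ℂ) η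
  simpa only [h1] using h

theorem tsum_ofReal_norm_sq {E : Type*} [NormedAddCommGroup E] {ι : Type*} {f : ι → E} {c : ℝ}
    (h : HasSum (fun i => ‖f i‖ ^ 2) c) :
    ∑' i, ENNReal.ofReal (‖f i‖ ^ 2) = ENNReal.ofReal c := by
  rw [← ENNReal.ofReal_tsum_of_nonneg (fun _ => by positivity) h.summable, h.tsum_eq]

/-- Finiteness does not depend on the frame. Expanding W_j 1̂ in the R_i, applying
`norm_apply_hat_one_le` to R_i W_j and exchanging the sums bounds ∑ ‖W_j 1̂‖² by ∑ ‖R_i* 1̂‖². -/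
theorem IsRightFrame.summable_of_orthogonal {P : VonNeumannAlgebra H} {K : Submodule ℂ τ.L2}
    [CompleteSpace K] {ι : Type u} {κ : Type*} {R : ι → τ.L2 →L[ℂ] τ.L2} (hR : τ.IsRightFrame P K R)
    (hs : Summable fun i => ‖adjoint (R i) (τ.hat 1)‖ ^ 2) {W : κ → τ.L2 →L[ℂ] τ.L2}
    (hW : ∀ j, τ.IsRightMap P (adjoint (W j))) (hWK : ∀ j ξ, W j ξ ∈ K)
    (hWs : ∀ ξ ∈ K, HasSum (fun j => ‖adjoint (W j) ξ‖ ^ 2) (‖ξ‖ ^ 2)) :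
    Summable fun j => ‖W j (τ.hat 1)‖ ^ 2 := by
  have hU : ∀ i j, τ.IsRightMap P (R i ∘L W j) := fun i j =>
    ⟨fun ξ => (hR.isRightMap i).mem _, fun p hp ξ => by
      have h1 := (hW j).adjoint_comm hp ξ
      rw [ContinuousLinearMap.adjoint_adjoint] at h1
      change R i (W j (τ.rightMul p ξ)) = τ.rightMul p (R i (W j ξ))
      rw [h1, (hR.isRightMap i).comm p hp]⟩
  have hle : ∀ i j, ‖R i (W j (τ.hat 1))‖ ≤ ‖adjoint (W j) (adjoint (R i) (τ.hat 1))‖ :=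
    fun i j => by
      have := (hU i j).norm_apply_hat_one_le
      rwa [ContinuousLinearMap.adjoint_comp] at this
  have hproj : ∀ j ξ, adjoint (W j) ξ = adjoint (W j) (K.starProjection ξ) := fun j ξ => by
    rw [← sub_eq_zero, ← map_sub]
    refine ext_inner_left ℂ fun η => ?_
    rw [adjoint_inner_right, inner_zero_right]
    exact (Submodule.mem_orthogonal _ _).1 (Submodule.sub_starProjection_mem_orthogonal ξ) _
      (hWK j η)
  have key : ∑' j, ENNReal.ofReal (‖W j (τ.hat 1)‖ ^ 2) ≠ ⊤ := by
    refine ne_top_of_le_ne_top hs.tsum_ofReal_ne_top ?_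
    calc ∑' j, ENNReal.ofReal (‖W j (τ.hat 1)‖ ^ 2)
        = ∑' j, ∑' i, ENNReal.ofReal (‖R i (W j (τ.hat 1))‖ ^ 2) :=
          tsum_congr fun j => (tsum_ofReal_norm_sq (hR.hasSum_norm_sq (hWK j _))).symm
      _ ≤ ∑' j, ∑' i, ENNReal.ofReal (‖adjoint (W j) (adjoint (R i) (τ.hat 1))‖ ^ 2) := by
          refine ENNReal.tsum_le_tsum fun j => ENNReal.tsum_le_tsum fun i => ?_
          exact ENNReal.ofReal_le_ofReal (pow_le_pow_left₀ (norm_nonneg _) (hle i j) 2)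
      _ = ∑' i, ∑' j, ENNReal.ofReal (‖adjoint (W j) (adjoint (R i) (τ.hat 1))‖ ^ 2) :=
          ENNReal.tsum_comm
      _ ≤ ∑' i, ENNReal.ofReal (‖adjoint (R i) (τ.hat 1)‖ ^ 2) := by
          refine ENNReal.tsum_le_tsum fun i => ?_
          simp only [hproj _ (adjoint (R i) (τ.hat 1))]
          rw [tsum_ofReal_norm_sq (hWs _ (Submodule.starProjection_apply_mem _ _))]
          exact ENNReal.ofReal_le_ofReal (pow_le_pow_left₀ (norm_nonneg _)
            (Submodule.norm_starProjection_apply_le _ _) 2)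
  have := ENNReal.summable_toReal key
  refine this.congr fun j => ?_
  rw [ENNReal.toReal_ofReal (by positivity)]

theorem closedSpan_mul_eq_rightSpan (Q P : VonNeumannAlgebra H) (x : M.toStarSubalgebra) :
    τ.closedSpan {y | ∃ q p : M.toStarSubalgebra, (q : H →L[ℂ] H) ∈ Q ∧
      (p : H →L[ℂ] H) ∈ P ∧ y = q * x * p} = τ.rightSpan P
        (Set.range fun q : {q : M.toStarSubalgebra // (q : H →L[ℂ] H) ∈ Q} => q.1 * x) := by
  rw [rightSpan]
  congr 1
  ext y
  constructor
  · rintro ⟨q, p, hq, hp, rfl⟩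
    exact ⟨_, ⟨⟨q, hq⟩, rfl⟩, p, hp, rfl⟩
  · rintro ⟨_, ⟨q, rfl⟩, p, hp, rfl⟩
    exact ⟨q, p, q.2, hp, rfl⟩

/-- The same family qx, q ∈ A, is orthogonalized over B and over N, for the same well-order. The sum
over B is finite since the dimension over B is, and it dominates the sum over N term by term. -/
theorem intertwiners_mono_right {A B N : VonNeumannAlgebra H} (hB : B ≤ N) (hN : N ≤ M) :
    τ.intertwiners A B ⊆ τ.intertwiners A N := by
  intro x hx
  obtain ⟨ι, R, hR, hs⟩ := exists_isRightFrame (fun p hp ξ hξ => rightMul_mem_closedSpan_mul hp hξ)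
    hx
  obtain ⟨_, _⟩ := exists_wellFoundedLT {q : M.toStarSubalgebra // (q : H →L[ℂ] H) ∈ A}
  let z : {q : M.toStarSubalgebra // (q : H →L[ℂ] H) ∈ A} → M.toStarSubalgebra := fun q => q.1 * x
  obtain ⟨W, hW, hWK, hWs, -, -, hWsupp⟩ := exists_gramSchmidt (τ := τ) (hB.trans hN) z
  obtain ⟨V, hV, -, hVs, hVn, hVz, -⟩ := exists_gramSchmidt (τ := τ) hN z
  have hsum : Summable fun j => ‖W j (τ.hat 1)‖ ^ 2 := by
    refine hR.summable_of_orthogonal hs hW (fun j ξ => ?_) fun ξ hξ => hWs ξ ?_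
    · rw [closedSpan_mul_eq_rightSpan]; exact hWK j ξ
    · rw [closedSpan_mul_eq_rightSpan] at hξ; exact hξ
  -- Let s be the support of the j-th step over B. As z_j(1 - s) lies in the B-span of the earlier
  -- vectors, it lies in their N-span, so V_j kills the vector of 1 - s. Hence ‖V_j 1̂‖ = ‖V_j ŝ‖ ≤
  -- ‖ŝ‖ = ‖W_j 1̂‖.
  have hle : ∀ j, ‖V j (τ.hat 1)‖ ≤ ‖W j (τ.hat 1)‖ := fun j => by
    obtain ⟨s, hsB, hsL, hsW⟩ := hWsupp j
    have h1 := hVz j (1 - s) (sub_mem (one_mem N) (hB hsB)) (rightSpan_mono hB le_rfl hsL)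
    rw [hat_sub, map_sub, sub_eq_zero] at h1
    rw [h1, ← hsW]
    exact hVn j _
  refine rightDim_lt_top hV (fun ξ hξ => hVs ξ ?_) ?_
  · rw [closedSpan_mul_eq_rightSpan] at hξ; exact hξ
  · simp only [ContinuousLinearMap.adjoint_adjoint]
    exact Summable.of_nonneg_of_le (fun _ => by positivity)
      (fun j => pow_le_pow_left₀ (norm_nonneg _) (hle j) 2) hsum

theorem adjoint_adjoint_comp_comp_apply {E F : Type*} [NormedAddCommGroup E]
    [InnerProductSpace ℂ E] [CompleteSpace E] [NormedAddCommGroup F] [InnerProductSpace ℂ F]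
    [CompleteSpace F] (J : E →L[ℂ] F) (R : F →L[ℂ] F) (ξ : E) :
    adjoint (adjoint J ∘L R ∘L J) ξ = adjoint J (adjoint R (J ξ)) := by
  rw [ContinuousLinearMap.adjoint_comp, ContinuousLinearMap.adjoint_comp,
    ContinuousLinearMap.adjoint_adjoint]
  rfl

/-! ### Intertwiners inside N and transitivity of strong malnormality -/

section

variable {N : VonNeumannAlgebra H} (hN : N ≤ M)

theorem norm_adjoint_inclL2_le (ξ : τ.L2) : ‖adjoint (inclL2 hN) ξ‖ ≤ ‖ξ‖ :=
  norm_le_of_inner_eq (adjoint_inner_left (inclL2 hN) (adjoint (inclL2 hN) ξ) ξ)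
    (norm_inclL2 hN _).le

theorem mem_intertwiners_restrict {A B : VonNeumannAlgebra H} (hB : B ≤ N)
    {x : N.toStarSubalgebra} (hx : incl hN x ∈ τ.intertwiners A B) :
    x ∈ (τ.restrict hN).intertwiners A B := by
  obtain ⟨ι, R, hR, hs⟩ := exists_isRightFrame (fun p hp ξ hξ => rightMul_mem_closedSpan_mul hp hξ)
    hx
  -- R_i takes values in L²B, which lies in L²N, so compressing R_i to L²N loses nothing.
  have hex : ∀ i ξ, ∃ η ∈ (τ.restrict hN).L2Sub B, inclL2 hN η = R i (inclL2 hN ξ) := fun i ξ => by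
    have h := (hR.isRightMap i).mem (inclL2 hN ξ)
    rw [← map_inclL2_L2Sub hN hB] at h
    obtain ⟨η, hη, h2⟩ := h
    exact ⟨η, hη, h2⟩
  let R' : ι → (τ.restrict hN).L2 →L[ℂ] (τ.restrict hN).L2 := fun i =>
    adjoint (inclL2 hN) ∘L R i ∘L inclL2 hN
  have hR' : ∀ i ξ η, inclL2 hN η = R i (inclL2 hN ξ) → R' i ξ = η := fun i ξ η h => by
    change adjoint (inclL2 hN) (R i (inclL2 hN ξ)) = η
    rw [← h, adjoint_inclL2_inclL2]
  refine rightDim_lt_top (R := R') (fun i => ⟨fun ξ => ?_, fun p hp ξ => ?_⟩) (fun ξ hξ => ?_) ?_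
  · obtain ⟨η, hη, h⟩ := hex i ξ
    rwa [hR' i ξ η h]
  · obtain ⟨η, hη, h⟩ := hex i ξ
    rw [hR' i ξ η h]
    refine hR' i _ _ ?_
    rw [inclL2_rightMul, inclL2_rightMul, h, (hR.isRightMap i).comm _ hp]
  · have hmem : inclL2 hN ξ ∈ τ.closedSpan {y | ∃ q p : M.toStarSubalgebra, (q : H →L[ℂ] H) ∈ A ∧
        (p : H →L[ℂ] H) ∈ B ∧ y = q * incl hN x * p} := by
      refine map_mem_of_mem_closedSpan (isClosed_closedSpan _) _ ?_ hξ
      rintro _ ⟨q, p, hq, hp, rfl⟩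
      rw [inclL2_hat]
      exact hat_mem_closedSpan ⟨incl hN q, incl hN p, hq, hp, rfl⟩
    have h1 := hR.hasSum_norm_sq hmem
    rw [norm_inclL2] at h1
    have h2 : ∀ i, ‖R' i ξ‖ = ‖R i (inclL2 hN ξ)‖ := fun i => by
      obtain ⟨η, hη, h⟩ := hex i ξ
      rw [hR' i ξ η h, ← h, norm_inclL2]
    simpa only [h2] using h1
  · refine Summable.of_nonneg_of_le (fun _ => by positivity) (fun i => ?_) hs
    refine pow_le_pow_left₀ (norm_nonneg _) ?_ 2
    have h1 : adjoint (R' i) ((τ.restrict hN).hat 1) =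
        adjoint (inclL2 hN) (adjoint (R i) (τ.hat 1)) := by
      have h2 : inclL2 (τ := τ) hN ((τ.restrict hN).hat 1) = τ.hat 1 := inclL2_hat hN 1
      rw [← h2]
      exact adjoint_adjoint_comp_comp_apply (inclL2 hN) (R i) _
    rw [h1]
    exact norm_adjoint_inclL2_le hN _

/-- An intertwiner from A to B is one from A to N, so malnormality of N puts it in N; there it is
still an intertwiner from A to B, and malnormality of B in N applies with the same A. -/
theorem IsStronglyMalnormal.trans {B : VonNeumannAlgebra H} (hB : B ≤ N)
    (h₁ : (τ.restrict hN).IsStronglyMalnormal B) (h₂ : τ.IsStronglyMalnormal N) :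
    τ.IsStronglyMalnormal B := by
  refine ⟨h₁.1, ?_⟩
  rintro x ⟨A, hAB, hA, hab, hx⟩
  have hxN := h₂.2 x ⟨A, hAB.trans hB, hA, hab, intertwiners_mono_right hB hN hx⟩
  exact h₁.2 ⟨x, hxN⟩ ⟨A, hAB, hA, hab, mem_intertwiners_restrict hN hB hx⟩

end

end TraceState

end VonNeumannAlgebra

end
theorem proposition2p6p3 {H : Type u} [NormedAddCommGroup H] [InnerProductSpace ℂ H]
    [CompleteSpace H] (M : VonNeumannAlgebra H) (τ : M.TraceState) :
    (∀ B : VonNeumannAlgebra H, B ≤ M → B.IsDiffuse →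
      (τ.IsCoarse B → τ.IsMixing B) ∧ (τ.IsMixing B → τ.IsStronglyMalnormal B)) ∧
    (∀ (B N : VonNeumannAlgebra H) (_ : B ≤ N) (hN : N ≤ M),
      ((τ.restrict hN).IsCoarse B → τ.IsCoarse N → τ.IsCoarse B) ∧
      ((τ.restrict hN).IsMixing B → τ.IsMixing N → τ.IsMixing B) ∧
      ((τ.restrict hN).IsStronglyMalnormal B → τ.IsStronglyMalnormal N →
        τ.IsStronglyMalnormal B)) ∧
    (∀ B B₀ : VonNeumannAlgebra H, B ≤ M → B₀ ≤ M → B.IsDiffuse → B₀.IsDiffuse →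
      (τ.IsCoarsePair B B₀ → τ.IsMixingPair B B₀) ∧
      (τ.IsMixingPair B B₀ → τ.weakIntertwiners B B₀ = {0})) :=
  ⟨fun _ hB _ => ⟨fun h => h.isMixing hB, fun h => h.isStronglyMalnormal hB⟩,
    fun _ _ hB hN => ⟨VonNeumannAlgebra.TraceState.IsCoarse.trans hN hB,
      VonNeumannAlgebra.TraceState.IsMixing.trans hN hB,
      VonNeumannAlgebra.TraceState.IsStronglyMalnormal.trans hN hB⟩,
    fun _ _ hB hB₀ _ _ => ⟨fun h => h.isMixingPair hB₀, fun h => h.weakIntertwiners_eq hB⟩⟩
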